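/- A \emph{tile} is a unit rhombus with angles $60^\circ$ and $120^\circ$. Two tiles are \emph{adjacent} if they have a common side. A \emph{tredoku tiling} is a finite set $\mathcal T$ of $\tau>4$ non-overlapping tiles in the plane such that: (P1) $\mathcal T$ is edge-connected, i.e. any two of its tiles are joined by a sequence of tiles of $\mathcal T$ in which consecutive tiles are adjacent; (P2) two tiles that touch either do so only at a common vertex or have a side in common; (P3) after the removal of any one tile, any two remaining tiles are joined by a sequence of remaining tiles in which consecutive tiles touch, possibly only at a vertex; (P4) if tiles $A$ and $B$ share a side $p$, then a third tile $C$ shares a side parallel to $p$ with $A$ or with $B$; (P5) no run has more than three tiles, where a run is a sequence of distinct tiles in which consecutive tiles share a side and all these shared sides are parallel; and $\mathcal T$ has no holes, i.e. the complement of the union of the closed tiles is connected. (By P1 and P2, up to an isometry of the plane the tiles are lozenges of the unit triangular lattice.) Let $\rho$ be the number of runs of three tiles of $\mathcal T$, a run and its reversal being counted once. The \emph{spine} of $\mathcal T$ is the set of its tiles that are adjacent to three or four other tiles of $\mathcal T$, and $\mathcal T$ is \emph{irreducible} if its spine is edge-connected. Theorem. There exist irreducible tredoku tilings with $\tau=5$,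 $\rho=2$, and irreducible tredoku tilings with $\tau=7$, $\rho=3$. Every other irreducible tredoku tiling, i.e. every one with $(\tau,\rho)\notin\{(5,2),(7,3)\}$, satisfies $$2\rho-3\le\tau\le2\rho.$$ Conversely, for each $k\in\{0,1,2,3\}$ and every integer $\rho\ge 3+k$ there exists an irreducible tredoku tiling with $\rho$ runs and $\tau=2\rho-k$ tiles. -/

import Mathlib

namespace Tredoku

/-! The plane carries the triangular lattice: the pair `(a, b)` of integers stands for the point
`a • (1, 0) + b • (1 / 2, √3 / 2)`. A connected edge-to-edge arrangement of unit rhombi with angles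
60 and 120 degrees is, up to an isometry of the plane, made of rhombi of this lattice. -/

/-- A point of the triangular lattice, in the coordinates described above. -/
abbrev Point : Type := ℤ × ℤ

/-- The unit vectors at angles 0, 60 and 120 degrees: the three directions of lattice segments. -/
def dir : Fin 3 → Point := ![(1, 0), (0, 1), (-1, 1)]

/-- A unit segment of the lattice: `(p, i)` is the segment from `p` to `p + dir i`. Two segments are
parallel when their second components agree. -/
abbrev Edge : Type := Point × Fin 3

/-- The three orientations of a lozenge: backward slanting, diamond and forward slanting. -/
inductive Kind : Type
  | B
  | D
  | F
  deriving DecidableEq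

/-- The direction of the first pair of parallel sides of a lozenge. -/
def Kind.first : Kind → Fin 3
  | .B => 0
  | .D => 1
  | .F => 0

/-- The direction of the second pair of parallel sides of a lozenge. -/
def Kind.second : Kind → Fin 3
  | .B => 2
  | .D => 2
  | .F => 1

/-- A tile: the lozenge with a corner at `base` that is spanned from there by the unit vectors
`dir kind.first` and `dir kind.second`. -/
@[ext]
structure Tile : Type where
  /-- The orientation. -/
  kind : Kind
  /-- The corner from which the two spanning vectors start. -/
  base : Point
  deriving DecidableEq

namespace Tile

/-- The four vertices of a tile. -/
def vertices (t : Tile) : Finset Point :=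
  {t.base, t.base + dir t.kind.first, t.base + dir t.kind.second,
    t.base + dir t.kind.first + dir t.kind.second}

/-- The four sides of a tile. -/
def sides (t : Tile) : Finset Edge :=
  {(t.base, t.kind.first), (t.base + dir t.kind.second, t.kind.first),
    (t.base, t.kind.second), (t.base + dir t.kind.first, t.kind.second)}

end Tile

/-- A unit triangle of the lattice: `up p` has the vertices `p`, `p + dir 0`, `p + dir 1`, and
`down p` has the vertices `p + dir 0`, `p + dir 1`, `p + dir 0 + dir 1`. -/
inductive Cell : Type
  | up (p : Point)
  | down (p : Point)
  deriving DecidableEq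

/-- The three sides of a unit triangle. -/
def Cell.sides : Cell → Finset Edge
  | .up p => {(p, 0), (p, 1), (p + dir 0, 2)}
  | .down p => {(p + dir 1, 0), (p + dir 0, 1), (p + dir 0, 2)}

/-- The two unit triangles that make up a tile. -/
def Tile.cells (t : Tile) : Finset Cell :=
  match t.kind with
  | .B => {.up t.base, .down (t.base - dir 0)}
  | .D => {.down (t.base - dir 0), .up (t.base + dir 2)}
  | .F => {.up t.base, .down t.base}

/-- The graph of all unit triangles of the plane, two of them being joined when they share a side. -/
def cellGraph : SimpleGraph Cell where
  Adj c d := c ≠ d ∧ ∃ e, e ∈ c.sides ∧ e ∈ d.sides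
  symm := ⟨fun _ _ h => ⟨h.1.symm, h.2.imp fun _ he => ⟨he.2, he.1⟩⟩⟩
  loopless := ⟨fun _ h => h.1 rfl⟩

/-- Two tiles are adjacent when they have a side in common. -/
def adjGraph : SimpleGraph Tile where
  Adj s t := s ≠ t ∧ ∃ e, e ∈ s.sides ∧ e ∈ t.sides
  symm := ⟨fun _ _ h => ⟨h.1.symm, h.2.imp fun _ he => ⟨he.2, he.1⟩⟩⟩
  loopless := ⟨fun _ h => h.1 rfl⟩

/-- Two tiles are neighbours when they touch, that is, when they have at least a vertex in common. -/
def touchGraph : SimpleGraph Tile where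
  Adj s t := s ≠ t ∧ ∃ p, p ∈ s.vertices ∧ p ∈ t.vertices
  symm := ⟨fun _ _ h => ⟨h.1.symm, h.2.imp fun _ he => ⟨he.2, he.1⟩⟩⟩
  loopless := ⟨fun _ h => h.1 rfl⟩

/-- `IsRibbon T i l`: the list `l` consists of distinct tiles of `T`, and any two consecutive ones
share a side of direction `i` (so that all the shared sides are parallel). -/
def IsRibbon (T : Finset Tile) (i : Fin 3) (l : List Tile) : Prop :=
  l.Nodup ∧ (∀ t ∈ l, t ∈ T) ∧
    l.IsChain (fun s t => ∃ e : Edge, e.2 = i ∧ e ∈ s.sides ∧ e ∈ t.sides)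

/-- The runs of three tiles of `T`, each one as the set of its tiles. -/
def runs (T : Finset Tile) : Set (Set Tile) :=
  {R | ∃ (i : Fin 3) (a b c : Tile), IsRibbon T i [a, b, c] ∧ R = {a, b, c}}

/-- The number of runs, `ρ`. -/
noncomputable def numRuns (T : Finset Tile) : ℕ := (runs T).ncard

/-- A finite set of tiles is a tredoku tiling (without holes). -/
structure IsTredoku (T : Finset Tile) : Prop where
  /-- There are more than four tiles. -/
  four_lt_card : 4 < T.card
  /-- Connectedness, where meeting in a single vertex does not count as a connection. -/
  edge_connected : (adjGraph.induce (T : Set Tile)).Connected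
  /-- Different tiles do not overlap. For tiles of the triangular lattice this says that two tiles
  that touch do so only at a vertex or have a side in common. -/
  no_overlap : ∀ s ∈ T, ∀ t ∈ T, s ≠ t → Disjoint s.cells t.cells
  /-- Removing one tile does not disconnect the tiling, where meeting in a single vertex does count
  as a connection. -/
  connected_of_remove : ∀ t ∈ T, (touchGraph.induce ((T : Set Tile) \ {t})).Connected
  /-- If two tiles share a side, then some third tile shares a side parallel to it with one
  of them. -/
  exists_third : ∀ a ∈ T, ∀ b ∈ T, a ≠ b → ∀ p : Edge, p ∈ a.sides → p ∈ b.sides →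
    ∃ c ∈ T, c ≠ a ∧ c ≠ b ∧ ∃ q : Edge, q.2 = p.2 ∧ q ∈ c.sides ∧ (q ∈ a.sides ∨ q ∈ b.sides)
  /-- There are no runs of more than three tiles. -/
  run_length_le : ∀ (i : Fin 3) (l : List Tile), IsRibbon T i l → l.length ≤ 3
  /-- There are no holes: the complement of the union of the (closed) tiles is connected.
  In terms of the lattice, the graph of the uncovered unit triangles is connected. -/
  no_holes : (cellGraph.induce {c : Cell | ∀ t ∈ T, c ∉ t.cells}).Connected

/-- The number of tiles of `T` that are adjacent to `t`; `t` is an `i`-tile if this number is `i`. -/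
noncomputable def adjCount (T : Finset Tile) (t : Tile) : ℕ :=
  {s : Tile | s ∈ T ∧ adjGraph.Adj t s}.ncard

/-- The spine: the set of the 3-tiles and 4-tiles. -/
def spine (T : Finset Tile) : Set Tile :=
  {t | t ∈ T ∧ (adjCount T t = 3 ∨ adjCount T t = 4)}

/-- An irreducible tredoku tiling is one whose spine is edge-connected. -/
def IsIrreducible (T : Finset Tile) : Prop :=
  IsTredoku T ∧ (adjGraph.induce (spine T)).Connected

end Tredoku

/-! Call the inner tile of a run of three its middle and the outer two its ends. P4 and P5 amount to
a local rule, `RunsOfThree`: of two tiles sharing a side, exactly one has a neighbour beyond its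
opposite side. That one is the middle of the run, and the other one points to it. Since each run has
one middle and two ends, τ − 2ρ is the sum of 1 − `endCount` over the tiles. As `endCount` is at
most 2, this is the number of roots (tiles at which no run ends) minus the number of tiles at which
two runs end (`IsTredoku.card_sub`).

Without holes, a tile with just two neighbours, on opposite sides, would violate P3; hence the spine
is the set of middles (`IsTredoku.mem_spine_iff`). A middle is an end of at most one run, so it has
at most one outgoing pointer. If there is a root, connectedness of the spine makes all pointers in
the spine lead to it, so it is unique.

Let two runs end at `t`. Their middles lie in the spine, which avoids `t`, so they are joined
without `t`. As there are no holes, the corner of `t` between the two shared sides is surrounded by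
tiles (`surrounded_of_reachable`). Around a surrounded point, counting shared sides with sign + for
middles and − for ends shows that roots and two-run ends are equally many (`Surrounded.card_eq`). So
each two-run end has a corner of the root to itself, there are at most four of them, and τ − 2ρ lies
between −3 and 1.

If τ − 2ρ = 1, there is a root and no two-run end, so no corner of the root is surrounded. At most 5
of the 6 triangles at each corner are covered, 20 incidences in all. The root takes 6 and its four
neighbours at least 3 each; the 2 that remain allow at most one further run. This leaves (5, 2) and
(7, 3).

The Jordan curve arguments use cochains mod 2: a closed path of triangles is a closed cochain, hence
the coboundary of a function on the lattice points (`exists_potential`), which tells the inside from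
the outside.

For existence, small tilings are given as ordered lists whose order certifies connectedness and
absence of holes (`GoodList`). A step that adds two tiles and one run (`AttachesPair`) is then
repeated along a staircase (`ChainTip`). -/

namespace Tredoku

/-! ### Segments, triangles and lozenges of the lattice. -/

/-- The two endpoints of a segment. -/
def Edge.ends (e : Edge) : Finset Point := {e.1, e.1 + dir e.2}

/-- The unit triangle `up _` that has a given segment as a side. -/
def upCell (e : Edge) : Cell := ![.up e.1, .up e.1, .up (e.1 - dir 0)] e.2

/-- The unit triangle `down _` that has a given segment as a side. -/
def downCell (e : Edge) : Cell := ![.down (e.1 - dir 1), .down (e.1 - dir 0), .down (e.1 - dir 0)] e.2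

/-- The vertices of a unit triangle. -/
def Cell.vertices : Cell → Finset Point
  | .up p => {p, p + dir 0, p + dir 1}
  | .down p => {p + dir 0, p + dir 1, p + dir 0 + dir 1}

/-- The short diagonal of a tile. -/
def Tile.diag (t : Tile) : Edge :=
  match t.kind with
  | .B => (t.base, 1)
  | .D => (t.base + dir 2, 0)
  | .F => (t.base + dir 0, 2)

/-- The side of a tile opposite to a given side. -/
def Tile.opp (t : Tile) (e : Edge) : Edge :=
  if e = (t.base, t.kind.first) then (t.base + dir t.kind.second, t.kind.first)
  else if e = (t.base + dir t.kind.second, t.kind.first) then (t.base, t.kind.first)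
  else if e = (t.base, t.kind.second) then (t.base + dir t.kind.first, t.kind.second)
  else (t.base, t.kind.second)

/-- A linear functional that is constant along each lattice line of the direction of the segment. -/
def Edge.level (e : Edge) : ℤ := ![e.1.2, e.1.1, -(e.1.1 + e.1.2)] e.2

theorem mem_cell_sides {e : Edge} {c : Cell} : e ∈ c.sides ↔ c = upCell e ∨ c = downCell e := by
  obtain ⟨⟨x, y⟩, i⟩ := e
  obtain ⟨a, b⟩ | ⟨a, b⟩ := c <;> fin_cases i <;>
    simp [Cell.sides, upCell, downCell, dir, Prod.ext_iff] <;> omega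

theorem upCell_ne_downCell (e f : Edge) : upCell e ≠ downCell f := by
  obtain ⟨p, i⟩ := e
  obtain ⟨q, j⟩ := f
  fin_cases i <;> fin_cases j <;> simp [upCell, downCell]

theorem eq_of_cells_eq {e f : Edge} (h : upCell e = upCell f) (h' : downCell e = downCell f) :
    e = f := by
  obtain ⟨⟨x, y⟩, i⟩ := e
  obtain ⟨⟨a, b⟩, j⟩ := f
  fin_cases i <;> fin_cases j <;> simp [upCell, downCell, dir, Prod.ext_iff] at h h' ⊢ <;> omega

/-- A lozenge is encoded by its short diagonal, so that questions about tiles become questions about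
the two triangles on a segment. -/
theorem Tile.cells_eq (t : Tile) : t.cells = {upCell t.diag, downCell t.diag} := by
  obtain ⟨k, a, b⟩ := t
  cases k <;> simp [Tile.cells, Tile.diag, upCell, downCell, dir, Finset.pair_comm, sub_eq_add_neg]

/-- The boundary of a tile consists of the segments that separate the inside from the outside.
Incidence of sides thus becomes propositional logic about cells. -/
theorem Tile.mem_sides_iff {t : Tile} {e : Edge} :
    e ∈ t.sides ↔ (upCell e ∈ t.cells ∧ downCell e ∉ t.cells) ∨
      (upCell e ∉ t.cells ∧ downCell e ∈ t.cells) := by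
  obtain ⟨⟨x, y⟩, i⟩ := e
  obtain ⟨k, a, b⟩ := t
  cases k <;> fin_cases i <;>
    simp [Tile.cells, Tile.sides, upCell, downCell, dir, Prod.ext_iff, Kind.first, Kind.second] <;> omega

theorem Tile.diag_notMem_sides (t : Tile) : t.diag ∉ t.sides := by
  simp [Tile.mem_sides_iff, Tile.cells_eq]

theorem Tile.opp_mem {t : Tile} {e : Edge} (_h : e ∈ t.sides) : t.opp e ∈ t.sides := by
  unfold Tile.opp Tile.sides
  split_ifs <;> simp

theorem Kind.first_ne_second (k : Kind) : k.first ≠ k.second := by cases k <;> decide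

theorem dir_ne_zero (i : Fin 3) : dir i ≠ 0 := by fin_cases i <;> simp [dir]

theorem Tile.opp_snd {t : Tile} {e : Edge} (h : e ∈ t.sides) : (t.opp e).2 = e.2 := by
  simp only [Tile.sides, Finset.mem_insert, Finset.mem_singleton] at h
  have h1 := t.kind.first_ne_second
  rcases h with rfl | rfl | rfl | rfl <;> simp [Tile.opp, h1.symm, dir_ne_zero]

theorem Tile.opp_ne {t : Tile} {e : Edge} (h : e ∈ t.sides) : t.opp e ≠ e := by
  simp only [Tile.sides, Finset.mem_insert, Finset.mem_singleton] at h
  have h1 := t.kind.first_ne_second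
  rcases h with rfl | rfl | rfl | rfl <;> simp [Tile.opp, h1.symm, dir_ne_zero]

theorem Tile.opp_opp {t : Tile} {e : Edge} (h : e ∈ t.sides) : t.opp (t.opp e) = e := by
  simp only [Tile.sides, Finset.mem_insert, Finset.mem_singleton] at h
  have h1 := t.kind.first_ne_second
  rcases h with rfl | rfl | rfl | rfl <;> simp [Tile.opp, h1.symm, dir_ne_zero]

theorem Tile.eq_or_eq_opp {t : Tile} {e f : Edge} (h : e ∈ t.sides) (hf : f ∈ t.sides)
    (hef : f.2 = e.2) : f = e ∨ f = t.opp e := by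
  simp only [Tile.sides, Finset.mem_insert, Finset.mem_singleton] at h hf
  have h1 := t.kind.first_ne_second
  rcases h with rfl | rfl | rfl | rfl <;> rcases hf with rfl | rfl | rfl | rfl <;>
    simp_all [Tile.opp, dir_ne_zero]

/-- Crossing a tile moves by one lattice line, in the direction in which the tile lies from the
side. Ribbons are therefore monotone and cannot close up. -/
theorem Tile.level_opp {t : Tile} {e : Edge} (h : e ∈ t.sides) :
    (upCell e ∈ t.cells ∧ (t.opp e).level = e.level + 1) ∨
    (downCell e ∈ t.cells ∧ (t.opp e).level = e.level - 1) := by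
  obtain ⟨k, a, b⟩ := t
  simp only [Tile.sides, Finset.mem_insert, Finset.mem_singleton] at h
  rcases h with rfl | rfl | rfl | rfl <;> cases k <;>
    simp [Tile.opp, Kind.first, Kind.second, Edge.level, dir, upCell, downCell, Tile.cells,
      Prod.ext_iff] <;> omega

theorem Tile.exists_sides_of_vertex {t : Tile} {v : Point} (h : v ∈ t.vertices) :
    ∃ e ∈ t.sides, ∃ f ∈ t.sides, e.2 ≠ f.2 ∧ ∀ g ∈ t.sides, v ∈ Edge.ends g ↔ g = e ∨ g = f := by
  obtain ⟨k, a, b⟩ := t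
  simp only [Tile.vertices, Finset.mem_insert, Finset.mem_singleton] at h
  rcases h with rfl | rfl | rfl | rfl
  · refine ⟨((a, b), k.first), by simp [Tile.sides], ((a, b), k.second), by simp [Tile.sides],
      k.first_ne_second, fun g hg => ?_⟩
    simp only [Tile.sides, Finset.mem_insert, Finset.mem_singleton] at hg
    rcases hg with rfl | rfl | rfl | rfl <;> cases k <;>
      simp [Edge.ends, Kind.first, Kind.second, dir, Prod.ext_iff]
  · refine ⟨((a, b), k.first), by simp [Tile.sides], ((a, b) + dir k.first, k.second),
      by simp [Tile.sides], k.first_ne_second, fun g hg => ?_⟩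
    simp only [Tile.sides, Finset.mem_insert, Finset.mem_singleton] at hg
    rcases hg with rfl | rfl | rfl | rfl <;> cases k <;>
      simp [Edge.ends, Kind.first, Kind.second, dir, Prod.ext_iff]
  · refine ⟨((a, b) + dir k.second, k.first), by simp [Tile.sides], ((a, b), k.second),
      by simp [Tile.sides], k.first_ne_second, fun g hg => ?_⟩
    simp only [Tile.sides, Finset.mem_insert, Finset.mem_singleton] at hg
    rcases hg with rfl | rfl | rfl | rfl <;> cases k <;>
      simp [Edge.ends, Kind.first, Kind.second, dir, Prod.ext_iff]
  · refine ⟨((a, b) + dir k.second, k.first), by simp [Tile.sides],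
      ((a, b) + dir k.first, k.second), by simp [Tile.sides], k.first_ne_second, fun g hg => ?_⟩
    simp only [Tile.sides, Finset.mem_insert, Finset.mem_singleton] at hg
    rcases hg with rfl | rfl | rfl | rfl <;> cases k <;>
      simp [Edge.ends, Kind.first, Kind.second, dir, Prod.ext_iff]

theorem Tile.ends_subset {t : Tile} {e : Edge} (h : e ∈ t.sides) : Edge.ends e ⊆ t.vertices := by
  obtain ⟨k, a, b⟩ := t
  simp only [Tile.sides, Finset.mem_insert, Finset.mem_singleton] at h
  rcases h with rfl | rfl | rfl | rfl <;> cases k <;>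
    simp [Edge.ends, Tile.vertices, Finset.insert_subset_iff, dir, Kind.first, Kind.second,
      Prod.ext_iff]

/-- A corner of a tile lies on exactly one of two opposite sides. -/
theorem Tile.mem_ends_opp {t : Tile} {e : Edge} (h : e ∈ t.sides) {v : Point} (hv : v ∈ t.vertices) :
    v ∈ Edge.ends (t.opp e) ↔ v ∉ Edge.ends e := by
  obtain ⟨k, a, b⟩ := t
  simp only [Tile.sides, Finset.mem_insert, Finset.mem_singleton] at h
  simp only [Tile.vertices, Finset.mem_insert, Finset.mem_singleton] at hv
  rcases h with rfl | rfl | rfl | rfl <;> rcases hv with rfl | rfl | rfl | rfl <;> cases k <;>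
    simp [Edge.ends, dir, Kind.first, Kind.second, Tile.opp, Prod.ext_iff]

/-- Two sides of a tile that are not parallel have an endpoint in common. -/
theorem Tile.exists_common_end {t : Tile} {e f : Edge} (he : e ∈ t.sides) (hf : f ∈ t.sides)
    (h : e.2 ≠ f.2) : ∃ v ∈ Edge.ends e, v ∈ Edge.ends f := by
  obtain ⟨k, a, b⟩ := t
  by_contra! H
  have h₁ := H e.1 (by simp [Edge.ends])
  have h₂ := H (e.1 + dir e.2) (by simp [Edge.ends])
  clear H
  simp only [Tile.sides, Finset.mem_insert, Finset.mem_singleton] at he hf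
  rcases he with rfl | rfl | rfl | rfl <;> rcases hf with rfl | rfl | rfl | rfl <;> cases k <;>
    simp [Edge.ends, dir, Kind.first, Kind.second, Prod.ext_iff] at h h₁ h₂

theorem ends_subset_upCell (e : Edge) : Edge.ends e ⊆ (upCell e).vertices := by
  obtain ⟨⟨a, b⟩, i⟩ := e
  fin_cases i <;> simp [Edge.ends, dir, upCell, Cell.vertices, Finset.insert_subset_iff, sub_eq_add_neg]

theorem ends_subset_downCell (e : Edge) : Edge.ends e ⊆ (downCell e).vertices := by
  obtain ⟨⟨a, b⟩, i⟩ := e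
  fin_cases i <;> simp [Edge.ends, dir, downCell, Cell.vertices, Finset.insert_subset_iff, sub_eq_add_neg]

theorem Tile.mem_vertices_iff {t : Tile} {v : Point} :
    v ∈ t.vertices ↔ ∃ c ∈ t.cells, v ∈ c.vertices := by
  obtain ⟨k, a, b⟩ := t
  obtain ⟨x, y⟩ := v
  cases k <;> simp [Tile.cells, Tile.vertices, Cell.vertices, dir, Kind.first, Kind.second,
    Prod.ext_iff] <;> omega

/-! ### Non-overlapping tiles and the local form of P4 and P5. -/

/-- Different tiles of `T` have no unit triangle in common. -/
def NonOverlapping (T : Finset Tile) : Prop :=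
  ∀ s ∈ T, ∀ t ∈ T, s ≠ t → Disjoint s.cells t.cells

instance (T : Finset Tile) : Decidable (NonOverlapping T) :=
  inferInstanceAs (Decidable (∀ s ∈ T, ∀ t ∈ T, s ≠ t → Disjoint s.cells t.cells))

/-- The segment `e` belongs to a tile of `T` other than `t`. -/
def Covered (T : Finset Tile) (t : Tile) (e : Edge) : Prop := ∃ s ∈ T, s ≠ t ∧ e ∈ s.sides

instance (T : Finset Tile) (t : Tile) (e : Edge) : Decidable (Covered T t e) :=
  inferInstanceAs (Decidable (∃ s ∈ T, s ≠ t ∧ e ∈ s.sides))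

/-- Of two tiles that share a side, exactly one is continued by another tile beyond its opposite
side. -/
def RunsOfThree (T : Finset Tile) : Prop :=
  ∀ s ∈ T, ∀ t ∈ T, s ≠ t → ∀ e ∈ s.sides, e ∈ t.sides →
    (Covered T s (s.opp e) ↔ ¬ Covered T t (t.opp e))

instance (T : Finset Tile) : Decidable (RunsOfThree T) :=
  inferInstanceAs (Decidable (∀ s ∈ T, ∀ t ∈ T, s ≠ t → ∀ e ∈ s.sides, e ∈ t.sides →
    (Covered T s (s.opp e) ↔ ¬ Covered T t (t.opp e))))

/-- The segments `e`, `g`, `f`, `h` form a closed walk of length four through adjacent triangles.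
The adjacency graph of the triangles is hexagonal and has no 4-cycle, so the walk backtracks. -/
theorem four_cycle_trivial {e f g h : Edge} (h₁ : upCell e = upCell g)
    (h₂ : downCell g = downCell f) (h₃ : upCell f = upCell h) (h₄ : downCell h = downCell e) :
    e = g ∨ f = g := by
  obtain ⟨⟨a, b⟩, i⟩ := e
  obtain ⟨⟨c, d⟩, j⟩ := f
  obtain ⟨⟨x, y⟩, k⟩ := g
  obtain ⟨⟨z, w⟩, l⟩ := h
  fin_cases i <;> fin_cases k <;> simp [upCell, downCell, dir, Prod.ext_iff] at * <;>
  fin_cases j <;> simp at * <;>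
  fin_cases l <;> simp at * <;> omega

theorem Tile.mem_cells {t : Tile} {c : Cell} :
    c ∈ t.cells ↔ c = upCell t.diag ∨ c = downCell t.diag := by
  simp [Tile.cells_eq]

theorem Tile.upCell_mem {t : Tile} {e : Edge} : upCell e ∈ t.cells ↔ upCell e = upCell t.diag := by
  simp [Tile.mem_cells, upCell_ne_downCell]

theorem Tile.downCell_mem {t : Tile} {e : Edge} :
    downCell e ∈ t.cells ↔ downCell e = downCell t.diag := by
  simp [Tile.mem_cells, (upCell_ne_downCell _ _).symm]

namespace NonOverlapping

variable {T : Finset Tile}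

theorem eq_of_mem_cells (hT : NonOverlapping T) {s t : Tile} (hs : s ∈ T) (ht : t ∈ T) {c : Cell}
    (h : c ∈ s.cells) (h' : c ∈ t.cells) : s = t := by
  by_contra hne
  exact Finset.disjoint_left.1 (hT s hs t ht hne) h h'

/-- Two tiles sharing a side lie on different sides of it. -/
theorem cells_of_common (hT : NonOverlapping T) {s t : Tile} (hs : s ∈ T) (ht : t ∈ T) (hst : s ≠ t)
    {e : Edge} (h : e ∈ s.sides) (h' : e ∈ t.sides) :
    (upCell e ∈ s.cells ∧ downCell e ∈ t.cells) ∨ (downCell e ∈ s.cells ∧ upCell e ∈ t.cells) := by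
  rw [Tile.mem_sides_iff] at h h'
  have h1 := fun c => hT.eq_of_mem_cells hs ht (c := c)
  have h2 := h1 (upCell e)
  have h3 := h1 (downCell e)
  tauto

theorem eq_or_eq_of_common (hT : NonOverlapping T) {r s t : Tile} (hr : r ∈ T) (hs : s ∈ T)
    (ht : t ∈ T) (hst : s ≠ t) {e : Edge} (her : e ∈ r.sides) (hes : e ∈ s.sides)
    (het : e ∈ t.sides) : r = s ∨ r = t := by
  have hu : ∀ c ∈ r.cells, c ∈ s.cells ∨ c ∈ t.cells → r = s ∨ r = t := fun c hc h =>
    h.imp (hT.eq_of_mem_cells hr hs hc) (hT.eq_of_mem_cells hr ht hc)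
  rcases hT.cells_of_common hs ht hst hes het with ⟨h1, h2⟩ | ⟨h1, h2⟩ <;>
    rcases Tile.mem_sides_iff.1 her with ⟨h3, -⟩ | ⟨-, h3⟩
  · exact hu _ h3 (Or.inl h1)
  · exact hu _ h3 (Or.inr h2)
  · exact hu _ h3 (Or.inr h2)
  · exact hu _ h3 (Or.inl h1)

/-- Two different tiles have at most one side in common. -/
theorem common_side_unique (hT : NonOverlapping T) {s t : Tile} (hs : s ∈ T) (ht : t ∈ T)
    (hst : s ≠ t) {e f : Edge} (hes : e ∈ s.sides) (het : e ∈ t.sides) (hfs : f ∈ s.sides)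
    (hft : f ∈ t.sides) : e = f := by
  have key : ∀ {s t : Tile}, e ∈ s.sides → f ∈ t.sides → e ∈ t.sides → f ∈ s.sides →
      upCell e ∈ s.cells → downCell e ∈ t.cells →
      (upCell f ∈ s.cells ∧ downCell f ∈ t.cells) ∨ (downCell f ∈ s.cells ∧ upCell f ∈ t.cells) →
      e = f := by
    intro s t hes hft het hfs h1 h2 h3
    rw [Tile.upCell_mem] at h1
    rw [Tile.downCell_mem] at h2
    rw [Tile.upCell_mem, Tile.upCell_mem, Tile.downCell_mem, Tile.downCell_mem] at h3
    rcases h3 with ⟨h3, h4⟩ | ⟨h3, h4⟩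
    · exact eq_of_cells_eq (h1.trans h3.symm) (h2.trans h4.symm)
    -- With `e` and `f` facing opposite ways, the two diagonals together with `e` and `f` would form
    -- a 4-cycle of triangles.
    · rcases four_cycle_trivial h1 h3.symm h4 h2.symm with h | h
      · exact absurd (h ▸ hes) s.diag_notMem_sides
      · exact absurd (h ▸ hfs) s.diag_notMem_sides
  rcases hT.cells_of_common hs ht hst hes het with h | h
  · exact key hes hft het hfs h.1 h.2 (hT.cells_of_common hs ht hst hfs hft)
  · exact key het hfs hes hft h.2 h.1 (hT.cells_of_common ht hs hst.symm hft hfs)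

end NonOverlapping

theorem IsTredoku.nonOverlapping {T : Finset Tile} (hT : IsTredoku T) : NonOverlapping T :=
  hT.no_overlap

/-- If both tiles were continued, there would be a run of four, against P5; if neither were, P4
would fail. -/
theorem IsTredoku.runsOfThree {T : Finset Tile} (hT : IsTredoku T) : RunsOfThree T := by
  have hN := hT.nonOverlapping
  intro s hs t ht hst e hes het
  constructor
  · rintro ⟨x, hx, hxs, hex⟩ ⟨y, hy, hyt, hey⟩
    have hst' : ∀ f ∈ s.sides, f ∈ t.sides → e = f := fun f =>
      hN.common_side_unique hs ht hst hes het (f := f)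
    have hxt : x ≠ t := by
      rintro rfl
      exact Tile.opp_ne hes (hst' _ (Tile.opp_mem hes) hex).symm
    have hys : y ≠ s := by
      rintro rfl
      exact Tile.opp_ne het (hst' _ hey (Tile.opp_mem het)).symm
    -- The two outer sides are two lattice lines apart, whereas parallel sides of one tile are at
    -- most one apart. So the tiles `x` and `y` beyond them differ and the ribbon has four distinct
    -- tiles.
    have hlev : (s.opp e).level - (t.opp e).level = 2 ∨ (s.opp e).level - (t.opp e).level = -2 := by
      have h1 := hN.cells_of_common hs ht hst hes het
      have h2 := Tile.level_opp hes
      have h3 := Tile.level_opp het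
      have h4 := hN.eq_of_mem_cells hs ht (c := upCell e)
      have h5 := hN.eq_of_mem_cells hs ht (c := downCell e)
      rcases h2 with ⟨h2, h2'⟩ | ⟨h2, h2'⟩ <;> rcases h3 with ⟨h3, h3'⟩ | ⟨h3, h3'⟩
      · exact absurd (h4 h2 h3) hst
      · omega
      · omega
      · exact absurd (h5 h2 h3) hst
    have hxy : x ≠ y := by
      rintro rfl
      rcases Tile.eq_or_eq_opp hex hey (by rw [Tile.opp_snd hes, Tile.opp_snd het]) with h | h
      · rw [h] at hlev
        omega
      · have := Tile.level_opp hex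
        rw [← h] at this
        omega
    have hrib : IsRibbon T e.2 [x, s, t, y] := by
      refine ⟨by simp [hxs, hxt, hxy, hst, hys.symm, hyt.symm], by simp [hx, hs, ht, hy], ?_⟩
      simp only [List.isChain_cons_cons, List.IsChain.singleton, and_true]
      exact ⟨⟨_, Tile.opp_snd hes, hex, Tile.opp_mem hes⟩, ⟨e, rfl, hes, het⟩,
        ⟨_, Tile.opp_snd het, Tile.opp_mem het, hey⟩⟩
    have := hT.run_length_le _ _ hrib
    simp at this
  · intro h
    obtain ⟨c, hc, hcs, hct, q, hq, hqc, hq'⟩ := hT.exists_third s hs t ht hst e hes het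
    have hqe : q ≠ e := by
      rintro rfl
      rcases hN.eq_or_eq_of_common hc hs ht hst hqc hes het with h | h <;> contradiction
    rcases hq' with hq' | hq'
    · rcases Tile.eq_or_eq_opp hes hq' hq with h1 | h1
      · exact absurd h1 hqe
      · exact ⟨c, hc, hcs, h1 ▸ hqc⟩
    · rcases Tile.eq_or_eq_opp het hq' hq with h1 | h1
      · exact absurd h1 hqe
      · exact absurd ⟨c, hc, hct, h1 ▸ hqc⟩ h

/-- With `RunsOfThree.run_length_le`, this is the way back from the decidable local rule to P4 and
P5, needed for the constructed tilings. -/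
theorem RunsOfThree.exists_third {T : Finset Tile} (hR : RunsOfThree T) (hN : NonOverlapping T) :
    ∀ a ∈ T, ∀ b ∈ T, a ≠ b → ∀ p : Edge, p ∈ a.sides → p ∈ b.sides →
    ∃ c ∈ T, c ≠ a ∧ c ≠ b ∧ ∃ q : Edge, q.2 = p.2 ∧ q ∈ c.sides ∧
      (q ∈ a.sides ∨ q ∈ b.sides) := by
  have key : ∀ a ∈ T, ∀ b ∈ T, a ≠ b → ∀ p : Edge, p ∈ a.sides → p ∈ b.sides →
      Covered T a (a.opp p) → ∃ c ∈ T, c ≠ a ∧ c ≠ b ∧ ∃ q : Edge, q.2 = p.2 ∧ q ∈ c.sides ∧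
      q ∈ a.sides := by
    rintro a ha b hb hab p hpa hpb ⟨c, hc, hca, hpc⟩
    refine ⟨c, hc, hca, ?_, _, Tile.opp_snd hpa, hpc, Tile.opp_mem hpa⟩
    rintro rfl
    exact Tile.opp_ne hpa (hN.common_side_unique ha hb hab hpa hpb (Tile.opp_mem hpa) hpc).symm
  intro a ha b hb hab p hpa hpb
  by_cases h : Covered T a (a.opp p)
  · obtain ⟨c, hc, hca, hcb, q, h1, h2, h3⟩ := key a ha b hb hab p hpa hpb h
    exact ⟨c, hc, hca, hcb, q, h1, h2, Or.inl h3⟩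
  · rw [hR a ha b hb hab p hpa hpb, not_not] at h
    obtain ⟨c, hc, hca, hcb, q, h1, h2, h3⟩ := key b hb a ha hab.symm p hpb hpa h
    exact ⟨c, hc, hcb, hca, q, h1, h2, Or.inr h3⟩

theorem RunsOfThree.run_length_le {T : Finset Tile} (hR : RunsOfThree T) (hN : NonOverlapping T)
    (i : Fin 3) (l : List Tile) (hl : IsRibbon T i l) : l.length ≤ 3 := by
  obtain ⟨hnd, hmem, hch⟩ := hl
  match l with
  | [] | [_] | [_, _] | [_, _, _] => simp
  | a :: b :: c :: d :: l =>
    exfalso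
    simp only [List.isChain_cons_cons] at hch
    obtain ⟨⟨e₁, he₁, ha, hb⟩, ⟨e₂, he₂, hb', hc⟩, ⟨e₃, he₃, hc', hd⟩, -⟩ := hch
    simp only [List.nodup_cons, List.mem_cons, not_or] at hnd
    have hbT : b ∈ T := hmem b (by simp)
    have hcT : c ∈ T := hmem c (by simp)
    have haT : a ∈ T := hmem a (by simp)
    have hdT : d ∈ T := hmem d (by simp)
    have hbc : b ≠ c := hnd.2.1.1
    refine (hR b hbT c hcT hbc e₂ hb' hc).1 ⟨a, haT, hnd.1.1, ?_⟩ ⟨d, hdT, ?_, ?_⟩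
    · rcases Tile.eq_or_eq_opp hb' hb (he₁.trans he₂.symm) with h | h
      · rw [h] at ha
        rcases hN.eq_or_eq_of_common haT hbT hcT hbc ha hb' hc with h' | h'
        · exact absurd h' hnd.1.1
        · exact absurd h' hnd.1.2.1
      · exact h ▸ ha
    · exact fun h => hnd.2.2.1.1 h.symm
    · rcases Tile.eq_or_eq_opp hc hc' (he₃.trans he₂.symm) with h | h
      · rw [h] at hd
        rcases hN.eq_or_eq_of_common hdT hbT hcT hbc hd hb' hc with h' | h'
        · exact absurd h'.symm hnd.2.1.2.1
        · exact absurd h'.symm hnd.2.2.1.1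
      · exact h ▸ hd

/-! ### Counting runs by their middles and ends. -/

/-- The sides of `t` through which a run passes that has `t` as its middle tile. -/
def midSides (T : Finset Tile) (t : Tile) : Finset Edge :=
  t.sides.filter fun e => Covered T t e ∧ Covered T t (t.opp e)

/-- The sides of `t` through which `t` is the last tile of a run. -/
def endSides (T : Finset Tile) (t : Tile) : Finset Edge :=
  t.sides.filter fun e => Covered T t e ∧ ¬ Covered T t (t.opp e)

/-- The number of runs with middle tile `t`. -/
def midCount (T : Finset Tile) (t : Tile) : ℕ := ((midSides T t).image Prod.snd).card

/-- The number of runs that end at `t`. -/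
def endCount (T : Finset Tile) (t : Tile) : ℕ := (endSides T t).card

theorem mem_midSides {T : Finset Tile} {t : Tile} {e : Edge} :
    e ∈ midSides T t ↔ e ∈ t.sides ∧ Covered T t e ∧ Covered T t (t.opp e) := by
  simp [midSides]

theorem mem_endSides {T : Finset Tile} {t : Tile} {e : Edge} :
    e ∈ endSides T t ↔ e ∈ t.sides ∧ Covered T t e ∧ ¬ Covered T t (t.opp e) := by
  simp [endSides]

theorem Tile.exists_sides_eq (t : Tile) : ∃ e f : Edge, t.sides = {e, t.opp e, f, t.opp f} ∧
    e.2 ≠ f.2 ∧ e ∈ t.sides ∧ f ∈ t.sides := by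
  refine ⟨(t.base, t.kind.first), (t.base, t.kind.second), ?_, t.kind.first_ne_second, ?_, ?_⟩
  · simp [Tile.sides, Tile.opp, t.kind.first_ne_second.symm]
  · simp [Tile.sides]
  · simp [Tile.sides]

/-- The possible ways in which runs meet a tile. -/
theorem side_counts (T : Finset Tile) (t : Tile) :
    (midSides T t).card = 2 * midCount T t ∧ midCount T t + endCount T t ≤ 2 ∧
    (t.sides.filter fun e => Covered T t e).card = 2 * midCount T t + endCount T t := by
  obtain ⟨e, f, h, hef, he, hf⟩ := t.exists_sides_eq
  have h1 := Tile.opp_opp he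
  have h2 := Tile.opp_opp hf
  have h3 := Tile.opp_ne he
  have h4 := Tile.opp_ne hf
  have h5 := Tile.opp_snd he
  have h6 := Tile.opp_snd hf
  have d1 : e ≠ f := fun h => hef (h ▸ rfl)
  have d2 : e ≠ t.opp f := fun h => hef (by rw [h, h6])
  have d3 : t.opp e ≠ f := fun h => hef (by rw [← h, h5])
  have d4 : t.opp e ≠ t.opp f := fun h => hef (by rw [← h5, h, h6])
  unfold midCount endCount midSides endSides
  rw [h]
  by_cases c1 : Covered T t e <;> by_cases c2 : Covered T t (t.opp e) <;>
    by_cases c3 : Covered T t f <;> by_cases c4 : Covered T t (t.opp f) <;>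
    simp [Finset.filter_insert, Finset.filter_singleton, c1, c2, c3, c4, h1, h2, h3.symm, h4.symm, h5, h6, d1, d2, d3, d4, hef]

/-- The sign of a side of `t` shared with another tile: positive if the run through this side has
`t` as its middle tile, negative if it ends at `t`. -/
def sideSign (T : Finset Tile) (t : Tile) (e : Edge) : ℤ :=
  if Covered T t e then if Covered T t (t.opp e) then 1 else -1 else 0

/-- An unshared side has sign 0. At a shared side one tile is a middle and the other an end, so the
signs cancel. -/
theorem sum_sideSign_tiles {T : Finset Tile} (hN : NonOverlapping T) (hR : RunsOfThree T) (e : Edge) :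
    ∑ t ∈ T with e ∈ t.sides, sideSign T t e = 0 := by
  by_cases h : ∃ t ∈ T, e ∈ t.sides ∧ Covered T t e
  · obtain ⟨t, ht, het, s, hs, hst, hes⟩ := h
    have hset : T.filter (fun t => e ∈ t.sides) = {s, t} := by
      ext r
      simp only [Finset.mem_filter, Finset.mem_insert, Finset.mem_singleton]
      constructor
      · rintro ⟨hr, her⟩
        exact hN.eq_or_eq_of_common hr hs ht hst her hes het
      · rintro (rfl | rfl)
        · exact ⟨hs, hes⟩
        · exact ⟨ht, het⟩
    have c1 : Covered T s e := ⟨t, ht, hst.symm, het⟩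
    have c2 : Covered T t e := ⟨s, hs, hst, hes⟩
    have := hR s hs t ht hst e hes het
    rw [hset, Finset.sum_pair hst]
    unfold sideSign
    by_cases c3 : Covered T t (t.opp e) <;> simp_all
  · push Not at h
    refine Finset.sum_eq_zero fun t ht => ?_
    rw [Finset.mem_filter] at ht
    simp [sideSign, h t ht.1 ht.2]

/-- The restriction `p` allows two uses: all sides, for the global count of runs, and the sides at
one point, for the count around a surrounded point. -/
theorem sum_sideSign {T : Finset Tile} (hN : NonOverlapping T) (hR : RunsOfThree T)
    (p : Edge → Prop) [DecidablePred p] :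
    ∑ t ∈ T, ∑ e ∈ t.sides with p e, sideSign T t e = 0 := by
  rw [Finset.sum_comm' (t' := (T.biUnion Tile.sides).filter p)
    (s' := fun e => T.filter fun t => e ∈ t.sides)]
  · exact Finset.sum_eq_zero fun e _ => sum_sideSign_tiles hN hR e
  · intro t e
    simp only [Finset.mem_filter, Finset.mem_biUnion]
    constructor
    · rintro ⟨h1, h2, h3⟩
      exact ⟨⟨h1, h2⟩, ⟨t, h1, h2⟩, h3⟩
    · rintro ⟨⟨h1, h2⟩, -, h3⟩
      exact ⟨h1, h2, h3⟩

theorem sum_sideSign_sides (T : Finset Tile) (t : Tile) :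
    ∑ e ∈ t.sides, sideSign T t e = 2 * (midCount T t : ℤ) - endCount T t := by
  have h : ∀ e ∈ t.sides, sideSign T t e =
      (if Covered T t e ∧ Covered T t (t.opp e) then 1 else 0) -
      (if Covered T t e ∧ ¬ Covered T t (t.opp e) then 1 else 0) := by
    intro e _
    unfold sideSign
    by_cases h1 : Covered T t e <;> by_cases h2 : Covered T t (t.opp e) <;> simp [h1, h2]
  rw [Finset.sum_congr rfl h, Finset.sum_sub_distrib, Finset.sum_boole, Finset.sum_boole]
  have := (side_counts T t).1
  unfold midSides at this
  rw [this]
  simp [endCount, endSides]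

theorem two_mul_sum_midCount {T : Finset Tile} (hN : NonOverlapping T) (hR : RunsOfThree T) :
    2 * ∑ t ∈ T, midCount T t = ∑ t ∈ T, endCount T t := by
  have h := sum_sideSign hN hR (fun _ => True)
  simp only [Finset.filter_true, sum_sideSign_sides, Finset.sum_sub_distrib, ← Finset.mul_sum] at h
  push_cast [← @Nat.cast_inj ℤ]
  linarith

/-- The set of the tiles of `T` that are `t` or share with `t` a side of direction `i`. -/
def runThrough (T : Finset Tile) (x : Tile × Fin 3) : Set Tile :=
  {s | s ∈ T ∧ (s = x.1 ∨ ∃ e : Edge, e.2 = x.2 ∧ e ∈ s.sides ∧ e ∈ x.1.sides)}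

/-- The pairs of a tile and a direction such that the tile is the middle one of a run in that
direction. -/
def middles (T : Finset Tile) : Finset (Tile × Fin 3) :=
  T.biUnion fun t => ((midSides T t).image Prod.snd).image (Prod.mk t)

theorem mem_middles {T : Finset Tile} {x : Tile × Fin 3} :
    x ∈ middles T ↔ x.1 ∈ T ∧ ∃ e ∈ midSides T x.1, e.2 = x.2 := by
  obtain ⟨t, i⟩ := x
  simp only [middles, Finset.mem_biUnion, Finset.mem_image, Prod.mk.injEq]
  constructor
  · rintro ⟨a, ha, b, ⟨e, he, rfl⟩, rfl, rfl⟩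
    exact ⟨ha, e, he, rfl⟩
  · rintro ⟨ht, e, he, rfl⟩
    exact ⟨t, ht, _, ⟨e, he, rfl⟩, rfl, rfl⟩

theorem card_middles (T : Finset Tile) : (middles T).card = ∑ t ∈ T, midCount T t := by
  unfold middles
  rw [Finset.card_biUnion]
  · refine Finset.sum_congr rfl fun t _ => ?_
    rw [Finset.card_image_of_injective _ (Prod.mk_right_injective t)]
    rfl
  · intro s _ t _ hst
    simp only [Function.onFun, Finset.disjoint_left, Finset.mem_image]
    rintro x ⟨i, -, rfl⟩ ⟨j, -, h⟩
    exact hst (congrArg Prod.fst h).symm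

/-- A run determines its middle, since two middles would share a side beyond which both are
continued. It then determines the direction, since the middle shares only one side with each other
tile. -/
theorem runThrough_injOn {T : Finset Tile} (hN : NonOverlapping T) (hR : RunsOfThree T) :
    Set.InjOn (runThrough T) (middles T) := by
  rintro ⟨t, i⟩ hx ⟨t', i'⟩ hx' h
  obtain ⟨ht, e, he, hei⟩ := mem_middles.1 hx
  obtain ⟨ht', e', he', hei'⟩ := mem_middles.1 hx'
  obtain ⟨het, hcov, hcov'⟩ := mem_midSides.1 he
  obtain ⟨het', hcov₁, hcov₁'⟩ := mem_midSides.1 he'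
  simp only at ht ht' hei hei' het het' hcov hcov' hcov₁ hcov₁'
  by_cases htt : t = t'
  · subst htt
    obtain ⟨s, hs, hst, hes⟩ := hcov
    have hmem : s ∈ runThrough T (t, i) := ⟨hs, Or.inr ⟨e, hei, hes, het⟩⟩
    rw [h] at hmem
    rcases hmem with ⟨-, h1 | ⟨f, hf, hfs, hft⟩⟩
    · exact absurd h1 hst
    · have : e = f := hN.common_side_unique hs ht hst hes het hfs hft
      subst this
      simp only at hf
      rw [← hei, ← hf]
  · exfalso
    have h1 : t' ∈ runThrough T (t, i) := h ▸ ⟨ht', Or.inl rfl⟩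
    have h2 : t ∈ runThrough T (t', i') := h ▸ ⟨ht, Or.inl rfl⟩
    rcases h1 with ⟨-, h1 | ⟨f, hfi, hft', hft⟩⟩
    · exact htt h1.symm
    rcases h2 with ⟨-, h2 | ⟨g, hgi, hgt, hgt'⟩⟩
    · exact htt h2
    have hfg : f = g := hN.common_side_unique ht ht' htt hft hft' hgt hgt'
    subst hfg
    have key : ∀ {t : Tile} {e : Edge}, e ∈ t.sides → f ∈ t.sides → f.2 = e.2 → Covered T t e →
        Covered T t (t.opp e) → Covered T t (t.opp f) := by
      intro t e he hf hfe h1 h2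
      rcases Tile.eq_or_eq_opp he hf hfe with h | h
      · rwa [h]
      · rwa [h, Tile.opp_opp he]
    exact (hR t ht t' ht' htt f hft hft').1 (key het hft (hfi.trans hei.symm) hcov hcov')
      (key het' hft' (hgi.trans hei'.symm) hcov₁ hcov₁')

theorem runs_eq_image {T : Finset Tile} (hN : NonOverlapping T) :
    runs T = runThrough T '' middles T := by
  ext R
  simp only [runs, Set.mem_ofPred_eq, Set.mem_image, Finset.mem_coe]
  have key : ∀ {a b c : Tile} {e : Edge}, a ∈ T → b ∈ T → c ∈ T → a ≠ b → b ≠ c →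
      e ∈ b.sides → e ∈ a.sides → b.opp e ∈ c.sides → runThrough T (b, e.2) = {a, b, c} := by
    intro a b c e ha hb hc hab hbc heb hea hec
    ext s
    simp only [runThrough, Set.mem_ofPred_eq, Set.mem_insert_iff, Set.mem_singleton_iff]
    constructor
    · rintro ⟨hs, h | ⟨f, hf, hfs, hfb⟩⟩
      · exact Or.inr (Or.inl h)
      rcases Tile.eq_or_eq_opp heb hfb hf with h | h
      · rw [h] at hfs
        rcases hN.eq_or_eq_of_common hs ha hb hab hfs hea heb with h | h
        · exact Or.inl h
        · exact Or.inr (Or.inl h)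
      · rw [h] at hfs
        rcases hN.eq_or_eq_of_common hs hb hc hbc hfs (Tile.opp_mem heb) hec with h | h
        · exact Or.inr (Or.inl h)
        · exact Or.inr (Or.inr h)
    · rintro (rfl | rfl | rfl)
      · exact ⟨ha, Or.inr ⟨e, rfl, hea, heb⟩⟩
      · exact ⟨hb, Or.inl rfl⟩
      · exact ⟨hc, Or.inr ⟨_, Tile.opp_snd heb, hec, Tile.opp_mem heb⟩⟩
  constructor
  · rintro ⟨i, a, b, c, ⟨hnd, hmem, hch⟩, rfl⟩
    simp only [List.isChain_cons_cons, List.IsChain.singleton, and_true] at hch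
    obtain ⟨⟨e, rfl, hea, heb⟩, f, hfe, hfb, hfc⟩ := hch
    simp only [List.nodup_cons, List.mem_cons, List.not_mem_nil, or_false, not_or] at hnd
    have ha : a ∈ T := hmem a (by simp)
    have hb : b ∈ T := hmem b (by simp)
    have hc : c ∈ T := hmem c (by simp)
    have hfo : f = b.opp e := by
      rcases Tile.eq_or_eq_opp heb hfb hfe with h | h
      · rw [h] at hfc
        rcases hN.eq_or_eq_of_common hc ha hb hnd.1.1 hfc hea heb with h' | h'
        · exact absurd h'.symm hnd.1.2
        · exact absurd h'.symm hnd.2.1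
      · exact h
    subst hfo
    exact ⟨(b, e.2), mem_middles.2 ⟨hb, e, mem_midSides.2 ⟨heb, ⟨a, ha, hnd.1.1, hea⟩,
      ⟨c, hc, fun h => hnd.2.1 h.symm, hfc⟩⟩, rfl⟩, key ha hb hc hnd.1.1 hnd.2.1 heb hea hfc⟩
  · rintro ⟨⟨b, i⟩, hx, rfl⟩
    obtain ⟨hb, e, he, hei⟩ := mem_middles.1 hx
    obtain ⟨heb, ⟨a, ha, hab, hea⟩, ⟨c, hc, hcb, hec⟩⟩ := mem_midSides.1 he
    simp only at hei hb heb hab hcb hec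
    subst hei
    refine ⟨e.2, a, b, c, ⟨?_, by simp [ha, hb, hc], ?_⟩, key ha hb hc hab hcb.symm heb hea hec⟩
    · have hac : a ≠ c := by
        rintro rfl
        exact Tile.opp_ne heb
          (hN.common_side_unique ha hb hab hea heb hec (Tile.opp_mem heb)).symm
      simp [hab, hac, hcb.symm]
    · simp only [List.isChain_cons_cons, List.IsChain.singleton, and_true]
      exact ⟨⟨e, rfl, hea, heb⟩, ⟨_, Tile.opp_snd heb, Tile.opp_mem heb, hec⟩⟩

theorem numRuns_eq {T : Finset Tile} (hN : NonOverlapping T) (hR : RunsOfThree T) :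
    numRuns T = ∑ t ∈ T, midCount T t := by
  rw [numRuns, runs_eq_image hN, (runThrough_injOn hN hR).ncard_image,
    Set.ncard_coe_finset, card_middles]

/-- A tile of `T` beyond the side `e` of `t`, if there is one. -/
noncomputable def acrossTile (T : Finset Tile) (t : Tile) (e : Edge) : Tile :=
  open Classical in if h : Covered T t e then h.choose else t

theorem acrossTile_spec {T : Finset Tile} {t : Tile} {e : Edge} (h : Covered T t e) :
    acrossTile T t e ∈ T ∧ acrossTile T t e ≠ t ∧ e ∈ (acrossTile T t e).sides := by
  rw [acrossTile, dif_pos h]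
  exact h.choose_spec

theorem acrossTile_injOn {T : Finset Tile} (hN : NonOverlapping T) {t : Tile} (ht : t ∈ T) :
    Set.InjOn (acrossTile T t) (t.sides.filter fun e => Covered T t e) := by
  intro e he f hf h
  simp only [Finset.coe_filter, Set.mem_ofPred_eq] at he hf
  obtain ⟨h1, h2, h3⟩ := acrossTile_spec he.2
  obtain ⟨-, -, h4⟩ := acrossTile_spec hf.2
  exact hN.common_side_unique h1 ht h2 h3 he.1 (h ▸ h4) hf.1

theorem adjCount_eq_card {T : Finset Tile} (hN : NonOverlapping T) {t : Tile} (ht : t ∈ T) :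
    adjCount T t = (t.sides.filter fun e => Covered T t e).card := by
  rw [← Set.ncard_coe_finset, ← (acrossTile_injOn hN ht).ncard_image, adjCount]
  congr 1
  ext s
  simp only [Set.mem_ofPred_eq, Set.mem_image, Finset.coe_filter]
  constructor
  · rintro ⟨hs, hts, e, het, hes⟩
    have hc : Covered T t e := ⟨s, hs, hts.symm, hes⟩
    obtain ⟨h1, h2, h3⟩ := acrossTile_spec hc
    refine ⟨e, ⟨het, hc⟩, ?_⟩
    rcases hN.eq_or_eq_of_common h1 hs ht hts.symm h3 hes het with h | h
    · exact h
    · exact absurd h h2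
  · rintro ⟨e, ⟨het, hc⟩, rfl⟩
    obtain ⟨h1, h2, h3⟩ := acrossTile_spec hc
    exact ⟨h1, h2.symm, e, het, h3⟩

theorem adjCount_eq {T : Finset Tile} (hN : NonOverlapping T) {t : Tile} (ht : t ∈ T) :
    adjCount T t = 2 * midCount T t + endCount T t := by
  rw [adjCount_eq_card hN ht, (side_counts T t).2.2]

theorem reachable_induce_induction {V : Type*} {G : SimpleGraph V} {S : Set V} {P : V → Prop}
    {a b : S} (h : (G.induce S).Reachable a b) (ha : P a)
    (hP : ∀ x ∈ S, ∀ y ∈ S, G.Adj x y → P x → P y) : P b := by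
  obtain ⟨w⟩ := h
  induction w with
  | nil => exact ha
  | @cons u v _ hadj _ ih => exact ih (hP u u.2 v v.2 hadj ha)

/-! ### Cochains mod 2 on the triangulated plane. -/

/-- The coboundary of a `ZMod 2`-valued function on segments. -/
def cobdry (c : Edge → ZMod 2) (x : Cell) : ZMod 2 := ∑ e ∈ x.sides, c e

/-- The indicator function of a unit triangle. -/
def cellInd (a x : Cell) : ZMod 2 := if x = a then 1 else 0

theorem zmod_two_add_self (a : ZMod 2) : a + a = 0 := CharTwo.add_self_eq_zero a

theorem cobdry_add (c d : Edge → ZMod 2) (x : Cell) : cobdry (c + d) x = cobdry c x + cobdry d x := by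
  simp [cobdry, Finset.sum_add_distrib]

theorem cobdry_single (e : Edge) (x : Cell) :
    cobdry (Pi.single e 1) x = cellInd (upCell e) x + cellInd (downCell e) x := by
  unfold cobdry cellInd
  have hsum : ∑ f ∈ x.sides, (Pi.single e 1 : Edge → ZMod 2) f = if e ∈ x.sides then 1 else 0 := by
    simp [Pi.single_apply]
  rw [hsum]
  have := upCell_ne_downCell e e
  by_cases h1 : x = upCell e
  · subst h1
    simp [mem_cell_sides, this]
  · by_cases h2 : x = downCell e
    · subst h2
      simp [mem_cell_sides, this.symm]
    · simp [mem_cell_sides, h1, h2]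

theorem cellGraph_adj {x y : Cell} (h : cellGraph.Adj x y) : ∃ e,
    (x = upCell e ∧ y = downCell e) ∨ (x = downCell e ∧ y = upCell e) := by
  obtain ⟨hne, e, hx, hy⟩ := h
  rw [mem_cell_sides] at hx hy
  refine ⟨e, ?_⟩
  rcases hx with rfl | rfl <;> rcases hy with rfl | rfl <;> simp at hne ⊢

theorem cellGraph_adj_up_down (e : Edge) : cellGraph.Adj (upCell e) (downCell e) :=
  ⟨upCell_ne_downCell e e, e, by simp [mem_cell_sides], by simp [mem_cell_sides]⟩

/-- The segments crossed by a path of unit triangles. -/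
theorem exists_cochain_of_reachable {S : Set Cell} {a b : S}
    (h : (cellGraph.induce S).Reachable a b) :
    ∃ c : Edge → ZMod 2, (∀ e, c e ≠ 0 → upCell e ∈ S ∧ downCell e ∈ S) ∧
      ∀ x, cobdry c x = cellInd a x + cellInd b x := by
  obtain ⟨w⟩ := h
  induction w with
  | nil => exact ⟨0, by simp, fun x => by simp [cobdry, zmod_two_add_self]⟩
  | @cons u v z hadj _ ih =>
    obtain ⟨c, h1, h2⟩ := ih
    obtain ⟨e, he⟩ := cellGraph_adj hadj
    refine ⟨Pi.single e 1 + c, fun f hf => ?_, fun x => ?_⟩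
    · by_cases hfe : f = e
      · subst hfe
        rcases he with ⟨h3, h4⟩ | ⟨h3, h4⟩
        · exact ⟨h3 ▸ u.2, h4 ▸ v.2⟩
        · exact ⟨h4 ▸ v.2, h3 ▸ u.2⟩
      · exact h1 f (by simpa [hfe] using hf)
    · rw [cobdry_add, cobdry_single, h2]
      have := zmod_two_add_self (cellInd v x)
      rcases he with ⟨h3, h4⟩ | ⟨h3, h4⟩
      · simp only [Function.Embedding.subtype_apply] at h3 h4
        rw [← h3, ← h4]
        linear_combination this
      · simp only [Function.Embedding.subtype_apply] at h3 h4
        rw [← h3, ← h4]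
        linear_combination this

theorem exists_antidifference (h : ℤ → ZMod 2) :
    ∃ g : ℤ → ZMod 2, g 0 = 0 ∧ ∀ n, g (n + 1) = g n + h n := by
  refine ⟨fun n => match n with
    | .ofNat k => ∑ j ∈ Finset.range k, h j
    | .negSucc k => ∑ j ∈ Finset.range (k + 1), h (-(j + 1)), by simp, fun n => ?_⟩
  match n with
  | .ofNat k => exact Finset.sum_range_succ _ k
  | .negSucc 0 =>
    have h2 : Int.negSucc 0 + 1 = Int.ofNat 0 := rfl
    rw [h2]
    simp [zmod_two_add_self]
  | .negSucc (k + 1) =>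
    have h2 : Int.negSucc (k + 1) + 1 = Int.negSucc k := rfl
    have h3 : Int.negSucc (k + 1) = -(((k + 1 : ℕ) : ℤ) + 1) := by rw [Int.negSucc_eq]
    rw [h2]
    simp only
    rw [Finset.sum_range_succ _ (k + 1), h3]
    linear_combination -zmod_two_add_self (h (-(((k + 1 : ℕ) : ℤ) + 1)))

/-- A closed cochain on the triangulated plane is the coboundary of a function on the points. -/
theorem exists_potential {c : Edge → ZMod 2} (hc : ∀ x, cobdry c x = 0) :
    ∃ F : Point → ZMod 2, ∀ e : Edge, F (e.1 + dir e.2) = F e.1 + c e := by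
  have hup : ∀ x y : ℤ, c ((x, y), 0) + c ((x, y), 1) + c ((x + 1, y), 2) = 0 := by
    intro x y
    have := hc (.up (x, y))
    simp only [cobdry, Cell.sides] at this
    rw [Finset.sum_insert (by simp), Finset.sum_insert (by simp), Finset.sum_singleton] at this
    simp only [dir, Matrix.cons_val_zero, Prod.mk_add_mk, add_zero] at this
    linear_combination this
  have hdown : ∀ x y : ℤ, c ((x, y + 1), 0) + c ((x + 1, y), 1) + c ((x + 1, y), 2) = 0 := by
    intro x y
    have := hc (.down (x, y))
    simp only [cobdry, Cell.sides] at this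
    rw [Finset.sum_insert (by simp), Finset.sum_insert (by simp), Finset.sum_singleton] at this
    simp only [dir, Matrix.cons_val_zero, Matrix.cons_val_one, Prod.mk_add_mk, add_zero] at this
    linear_combination this
  obtain ⟨g, -, hg⟩ := exists_antidifference fun x => c ((x, 0), 0)
  choose G hG0 hG using fun x : ℤ => exists_antidifference fun y => c ((x, y), 1)
  have h1 : ∀ x y : ℤ, g x + G x (y + 1) = g x + G x y + c ((x, y), 1) := fun x y => by
    rw [hG]
    ring
  have h0 : ∀ x y : ℤ, g (x + 1) + G (x + 1) y = g x + G x y + c ((x, y), 0) := by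
    intro x y
    -- The potential is integrated along the axis and then up each column. Closedness on the two
    -- triangles of a unit rhombus makes the error along horizontal segments independent of `y`, and
    -- it vanishes for `y = 0`.
    have step : ∀ y : ℤ, g (x + 1) + G (x + 1) (y + 1) - (g x + G x (y + 1) + c ((x, y + 1), 0)) =
        g (x + 1) + G (x + 1) y - (g x + G x y + c ((x, y), 0)) := fun y => by
      rw [hG, hG]
      linear_combination hup x y - hdown x y + zmod_two_add_self (c ((x + 1, y), 1)) -
        zmod_two_add_self (c ((x, y), 1))
    rw [← sub_eq_zero]
    induction y using Int.induction_on with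
    | zero => rw [hG0, hG0, hg]; ring
    | succ n ih => rw [step, ih]
    | pred n ih =>
      have := step (-(n : ℤ) - 1)
      rw [sub_add_cancel] at this
      rw [← this, ih]
  refine ⟨fun p => g p.1 + G p.1 p.2, ?_⟩
  rintro ⟨⟨x, y⟩, i⟩
  fin_cases i
  · simpa [dir] using h0 x y
  · simpa [dir] using h1 x y
  · have e1 := h0 (x - 1) y
    have e2 := h1 (x - 1) y
    have e3 := hup (x - 1) y
    rw [sub_add_cancel] at e1 e3
    have := zmod_two_add_self (c ((x - 1, y), 0))
    simp only [dir, Fin.reduceFinMk, Matrix.cons_val, Prod.mk_add_mk]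
    rw [← sub_eq_add_neg]
    linear_combination e2 - e1 + e3 - zmod_two_add_self (c ((x, y), 2)) - this

/-- Deleting one corner from the boundary of a rhombus leaves a path through the other three. The
point `v` need not be a corner. -/
theorem const_of_forall_sides {t : Tile} {v : Point} {F : Point → ZMod 2}
    (h : ∀ e ∈ t.sides, v ∉ Edge.ends e → F (e.1 + dir e.2) = F e.1) :
    ∀ x ∈ t.vertices, x ≠ v → ∀ y ∈ t.vertices, y ≠ v → F x = F y := by
  have hmem : ∀ p i, v ∉ Edge.ends (p, i) ↔ p ≠ v ∧ p + dir i ≠ v := fun p i => by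
    simp [Edge.ends, eq_comm]
  have h1 := h (t.base, t.kind.first) (by simp [Tile.sides])
  have h2 := h (t.base, t.kind.second) (by simp [Tile.sides])
  have h3 := h (t.base + dir t.kind.first, t.kind.second) (by simp [Tile.sides])
  have h4 := h (t.base + dir t.kind.second, t.kind.first) (by simp [Tile.sides])
  rw [hmem] at h1 h2 h3 h4
  simp only [add_right_comm t.base (dir t.kind.second) (dir t.kind.first)] at h1 h2 h3 h4
  clear hmem h
  simp only [Tile.vertices, Finset.mem_insert, Finset.mem_singleton]
  have hne : t.base ≠ t.base + dir t.kind.first + dir t.kind.second ∧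
      t.base + dir t.kind.first ≠ t.base + dir t.kind.second := by
    obtain ⟨k, a, b⟩ := t
    cases k <;> simp [dir, Kind.first, Kind.second, Prod.ext_iff]
  generalize t.base + dir t.kind.first + dir t.kind.second = d at *
  generalize t.base + dir t.kind.first = b at *
  generalize t.base + dir t.kind.second = c at *
  generalize t.base = a at *
  rintro x (rfl | rfl | rfl | rfl) hx y (rfl | rfl | rfl | rfl) hy <;> grind

/-! ### Consequences of the absence of holes. -/

/-- The unit triangles covered by the tiles of `T`. -/
def covered (T : Finset Tile) : Finset Cell := T.biUnion Tile.cells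

theorem mem_covered {T : Finset Tile} {c : Cell} : c ∈ covered T ↔ ∃ t ∈ T, c ∈ t.cells := by
  simp [covered]

/-- The complement of the union of the tiles is connected. -/
def NoHoles (R : Finset Cell) : Prop := (cellGraph.induce {c | c ∉ R}).Connected

theorem noHoles_covered_iff {T : Finset Tile} : NoHoles (covered T) ↔
    (cellGraph.induce {c : Cell | ∀ t ∈ T, c ∉ t.cells}).Connected := by
  have : {c : Cell | c ∉ covered T} = {c : Cell | ∀ t ∈ T, c ∉ t.cells} := by
    ext c
    simp [mem_covered]
  rw [NoHoles, this]

/-- Beyond a side that is not shared there is an uncovered triangle. -/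
theorem exists_free_beyond {T : Finset Tile} (hN : NonOverlapping T) {t : Tile} (ht : t ∈ T)
    {e : Edge} (he : e ∈ t.sides) (h : ¬ Covered T t e) : ∃ p ∉ covered T,
    (p = downCell e ∧ upCell e ∈ t.cells) ∨ (p = upCell e ∧ downCell e ∈ t.cells) := by
  rcases Tile.mem_sides_iff.1 he with ⟨h1, h2⟩ | ⟨h1, h2⟩
  · refine ⟨downCell e, fun hc => ?_, Or.inl ⟨rfl, h1⟩⟩
    obtain ⟨s, hs, hcs⟩ := mem_covered.1 hc
    have hst : s ≠ t := by rintro rfl; exact h2 hcs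
    exact h ⟨s, hs, hst, Tile.mem_sides_iff.2
      (Or.inr ⟨fun hu => hst (hN.eq_of_mem_cells hs ht hu h1), hcs⟩)⟩
  · refine ⟨upCell e, fun hc => ?_, Or.inr ⟨rfl, h2⟩⟩
    obtain ⟨s, hs, hcs⟩ := mem_covered.1 hc
    have hst : s ≠ t := by rintro rfl; exact h1 hcs
    exact h ⟨s, hs, hst, Tile.mem_sides_iff.2
      (Or.inl ⟨hcs, fun hu => hst (hN.eq_of_mem_cells hs ht hu h2)⟩)⟩

/-- A path of uncovered triangles does not cross a side of a tile. -/
theorem exists_cochain_of_free {T : Finset Tile} (hH : NoHoles (covered T)) {p q : Cell}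
    (hp : p ∉ covered T) (hq : q ∉ covered T) : ∃ c : Edge → ZMod 2,
    (∀ t ∈ T, ∀ e, upCell e ∈ t.cells ∨ downCell e ∈ t.cells → c e = 0) ∧
      ∀ x, cobdry c x = cellInd p x + cellInd q x := by
  obtain ⟨c, h1, h2⟩ := exists_cochain_of_reachable (hH.preconnected ⟨p, hp⟩ ⟨q, hq⟩)
  refine ⟨c, fun t ht e he => ?_, h2⟩
  by_contra hne
  obtain ⟨h3, h4⟩ := h1 e hne
  rcases he with he | he
  · exact h3 (mem_covered.2 ⟨t, ht, he⟩)
  · exact h4 (mem_covered.2 ⟨t, ht, he⟩)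

theorem Tile.up_or_down_mem {t : Tile} {e : Edge} (h : e ∈ t.sides) :
    upCell e ∈ t.cells ∨ downCell e ∈ t.cells := by
  rcases Tile.mem_sides_iff.1 h with h | h
  · exact Or.inl h.1
  · exact Or.inr h.2

theorem NonOverlapping.diag_notMem_sides {T : Finset Tile} (hN : NonOverlapping T) {s t : Tile}
    (hs : s ∈ T) (ht : t ∈ T) : t.diag ∉ s.sides := by
  intro h
  rcases Tile.up_or_down_mem h with h1 | h1
  · have : s = t := hN.eq_of_mem_cells hs ht h1 (by simp [Tile.cells_eq])
    exact t.diag_notMem_sides (this ▸ h)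
  · have : s = t := hN.eq_of_mem_cells hs ht h1 (by simp [Tile.cells_eq])
    exact t.diag_notMem_sides (this ▸ h)

theorem Edge.eq_add_of_ends {F : Point → ZMod 2} {k : ZMod 2} {e : Edge}
    (h : F (e.1 + dir e.2) = F e.1 + k) {x y : Point} (hx : x ∈ Edge.ends e) (hy : y ∈ Edge.ends e)
    (hxy : x ≠ y) : F x = F y + k := by
  simp only [Edge.ends, Finset.mem_insert, Finset.mem_singleton] at hx hy
  have := zmod_two_add_self k
  rcases hx with rfl | rfl <;> rcases hy with rfl | rfl
  · exact absurd rfl hxy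
  · rw [h]
    linear_combination -this
  · exact h
  · exact absurd rfl hxy

/-- In a tiling without holes, a tile that is adjacent to other tiles along exactly two opposite
sides separates the tiling. -/
theorem covered_of_connected_of_remove {T : Finset Tile} (hN : NonOverlapping T)
    (hH : NoHoles (covered T)) {t : Tile} (ht : t ∈ T)
    (hrem : (touchGraph.induce ((T : Set Tile) \ {t})).Connected) {e f : Edge} (he : e ∈ t.sides)
    (hf : f ∈ t.sides) (hef : e.2 ≠ f.2) (h₁ : Covered T t e) (h₂ : Covered T t (t.opp e)) :
    Covered T t f ∨ Covered T t (t.opp f) := by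
  by_contra! ⟨hn₁, hn₂⟩
  have hf' := Tile.opp_mem hf
  obtain ⟨p, hp, hp'⟩ := exists_free_beyond hN ht hf hn₁
  obtain ⟨q, hq, hq'⟩ := exists_free_beyond hN ht hf' hn₂
  obtain ⟨c, hc, hc'⟩ := exists_cochain_of_free hH hp hq
  -- The path of uncovered triangles from `p` to `q` is closed up through `t`, across `f`, the short
  -- diagonal and the side opposite to `f`.
  have hzero : ∀ x, cobdry (c + Pi.single f 1 + Pi.single (t.opp f) 1 + Pi.single t.diag 1) x = 0 := by
    intro x
    simp only [cobdry_add, cobdry_single, hc']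
    have hf1 := Tile.level_opp hf
    have hf2 := Tile.level_opp hf'
    rw [Tile.opp_opp hf] at hf2
    have a1 := zmod_two_add_self (cellInd p x)
    have a2 := zmod_two_add_self (cellInd q x)
    have a3 := zmod_two_add_self (cellInd (upCell t.diag) x)
    have a4 := zmod_two_add_self (cellInd (downCell t.diag) x)
    have b1 := Tile.mem_sides_iff.1 hf
    have b2 := Tile.mem_sides_iff.1 hf'
    simp only [Tile.upCell_mem, Tile.downCell_mem] at *
    rcases hp' with ⟨rfl, h1⟩ | ⟨rfl, h1⟩ <;> rcases hq' with ⟨rfl, h2⟩ | ⟨rfl, h2⟩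
    -- Opposite sides of `t` face opposite ways, so `p` and `q` cannot both lie below their sides;
    -- likewise they cannot both lie above.
    · exfalso
      simp only [h1, h2, true_and, not_true, false_and, or_false] at b1 b2
      simp only [h1, h2, b1, b2, true_and, false_and, or_false] at hf1 hf2
      omega
    · rw [h1, h2]
      linear_combination a1 + a2 + a3 + a4
    · rw [h1, h2]
      linear_combination a1 + a2 + a3 + a4
    · exfalso
      simp only [h1, h2, and_true, not_true, and_false, false_or] at b1 b2
      simp only [h1, h2, b1, b2, true_and, false_and, false_or] at hf1 hf2
      omega
  obtain ⟨F, hF⟩ := exists_potential hzero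
  -- The curve crosses no side of another tile, so the potential is constant on each of them and
  -- along any chain of touching tiles that avoids `t`.
  have hconst : ∀ s ∈ T, s ≠ t → ∀ x ∈ s.vertices, ∀ y ∈ s.vertices, F x = F y := by
    intro s hs hst x hx y hy
    obtain ⟨v, hv⟩ := Infinite.exists_notMem_finset {x, y}
    simp only [Finset.mem_insert, Finset.mem_singleton, not_or] at hv
    refine const_of_forall_sides (fun g hg _ => ?_) x hx (Ne.symm hv.1) y hy (Ne.symm hv.2)
    have g1 : g ≠ f := by rintro rfl; exact hn₁ ⟨s, hs, hst, hg⟩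
    have g2 : g ≠ t.opp f := by rintro rfl; exact hn₂ ⟨s, hs, hst, hg⟩
    have g3 : g ≠ t.diag := by rintro rfl; exact hN.diag_notMem_sides hs ht hg
    rw [hF]
    simp [g1, g2, g3, hc s hs g (Tile.up_or_down_mem hg)]
  obtain ⟨a, ha, hat, hea⟩ := h₁
  obtain ⟨b, hb, hbt, heb⟩ := h₂
  obtain ⟨x, hxe, hxf⟩ := Tile.exists_common_end he hf hef
  obtain ⟨y, hye, hyf⟩ := Tile.exists_common_end (Tile.opp_mem he) hf (by rwa [Tile.opp_snd he])
  have hxy : x ≠ y := by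
    rintro rfl
    exact (Tile.mem_ends_opp he (Tile.ends_subset he hxe)).1 hye hxe
  have key := reachable_induce_induction
    (P := fun s => ∀ y ∈ s.vertices, F y = F x)
    (hrem.preconnected ⟨a, ha, hat⟩ ⟨b, hb, hbt⟩)
    (fun y hy => hconst a ha hat y hy x (Tile.ends_subset hea hxe)) ?_ y (Tile.ends_subset heb hye)
  -- The ends of `f` lie on `e` and on its opposite side, which belong to tiles connected without
  -- `t`. Yet the curve crosses `f` exactly once.
  · have h1 := Edge.eq_add_of_ends (hF f) hyf hxf hxy.symm
    have g3 : f ≠ t.diag := by rintro rfl; exact t.diag_notMem_sides hf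
    simp only [Pi.add_apply, hc t ht f (Tile.up_or_down_mem hf), Pi.single_eq_same,
      Pi.single_eq_of_ne (Tile.opp_ne hf).symm, Pi.single_eq_of_ne g3, key] at h1
    simp at h1
  · rintro r ⟨hr, hrt⟩ s ⟨hs, hst⟩ ⟨-, z, hzr, hzs⟩ hP y hy
    rw [hconst s hs hst y hy z hzs, hP z hzr]

/-- The unit triangles around a lattice point, in cyclic order. -/
def star (v : Point) : Fin 6 → Cell :=
  ![.up v, .down (v - dir 0), .up (v - dir 0), .down (v - dir 0 - dir 1), .up (v - dir 1),
    .down (v - dir 1)]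

/-- The segments around a lattice point, in cyclic order. -/
def spoke (v : Point) : Fin 6 → Edge :=
  ![(v, 1), (v, 2), (v - dir 0, 0), (v - dir 1, 1), (v - dir 2, 2), (v, 0)]

theorem mem_vertices_iff_star {v : Point} {c : Cell} : v ∈ c.vertices ↔ ∃ k, c = star v k := by
  obtain ⟨x, y⟩ := v
  obtain ⟨a, b⟩ | ⟨a, b⟩ := c <;>
    simp [Cell.vertices, star, dir, Fin.exists_fin_succ, Prod.ext_iff] <;> omega

theorem star_injective (v : Point) : Function.Injective (star v) := by
  obtain ⟨x, y⟩ := v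
  intro i j h
  fin_cases i <;> fin_cases j <;> simp [star, dir, Prod.ext_iff] at h ⊢ <;> omega

theorem star_adj (v : Point) (k : Fin 6) : cellGraph.Adj (star v k) (star v (k + 1)) := by
  have h := cellGraph_adj_up_down (spoke v k)
  obtain ⟨x, y⟩ := v
  fin_cases k <;> simp [star, spoke, upCell, downCell, dir] at h ⊢ <;>
    first | simpa [sub_eq_add_neg] using h | simpa [sub_eq_add_neg] using h.symm

/-- Two triangles at a point that have a common side share a side at this point. -/
theorem mem_ends_of_mem_vertices {v : Point} {e : Edge} (h : v ∈ (upCell e).vertices)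
    (h' : v ∈ (downCell e).vertices) : v ∈ Edge.ends e := by
  obtain ⟨x, y⟩ := v
  obtain ⟨⟨a, b⟩, i⟩ := e
  fin_cases i <;> simp [Cell.vertices, upCell, downCell, Edge.ends, dir, Prod.ext_iff] at h h' ⊢ <;>
    omega

theorem star_reachable {v : Point} {a b : Cell} (ha : v ∈ a.vertices) (hb : v ∈ b.vertices) :
    (cellGraph.induce {c : Cell | v ∈ c.vertices}).Reachable ⟨a, ha⟩ ⟨b, hb⟩ := by
  have h0 : ∀ k : Fin 6, v ∈ (star v k).vertices := fun k => mem_vertices_iff_star.2 ⟨k, rfl⟩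
  have h1 : ∀ k : Fin 6, (cellGraph.induce {c : Cell | v ∈ c.vertices}).Reachable
      ⟨star v 0, h0 0⟩ ⟨star v k, h0 k⟩ := by
    intro k
    induction k using Fin.induction with
    | zero => rfl
    | succ i ih =>
      refine ih.trans (SimpleGraph.Adj.reachable ?_)
      have := star_adj v i.castSucc
      rw [Fin.coeSucc_eq_succ] at this
      exact this
  obtain ⟨i, rfl⟩ := mem_vertices_iff_star.1 ha
  obtain ⟨j, rfl⟩ := mem_vertices_iff_star.1 hb
  exact (h1 i).symm.trans (h1 j)

/-- In a tiling without holes, let `e` and `f` be shared sides of a tile `t` that meet at `v`, the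
side opposite to `e` not being shared. If the tiles beyond `e` and `f` are connected without `t`,
then `v` is surrounded by tiles. -/
theorem surrounded_of_reachable {T : Finset Tile} (hN : NonOverlapping T)
    (hH : NoHoles (covered T)) {t : Tile} (ht : t ∈ T) {e f : Edge} (he : e ∈ t.sides)
    (hf : f ∈ t.sides) (hef : e.2 ≠ f.2) (hn : ¬ Covered T t (t.opp e)) {S : Set Tile}
    (hS : S ⊆ (T : Set Tile) \ {t}) {a b : S} (hea : e ∈ (a : Tile).sides)
    (hfb : f ∈ (b : Tile).sides) (hab : (adjGraph.induce S).Reachable a b) {v : Point}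
    (hve : v ∈ Edge.ends e) (hvf : v ∈ Edge.ends f) {z : Cell} (hz : v ∈ z.vertices) :
    z ∈ covered T := by
  by_contra hzT
  have he' := Tile.opp_mem he
  have hf' := Tile.opp_mem hf
  have hvt := Tile.ends_subset he hve
  obtain ⟨p, hp, hp'⟩ := exists_free_beyond hN ht he' hn
  obtain ⟨c, hc, hc'⟩ := exists_cochain_of_free hH hzT hp
  obtain ⟨w, hw, hvw⟩ := Tile.mem_vertices_iff.1 hvt
  -- An uncovered `z` at `v` gives a closed curve: from `z` through uncovered triangles to `p`, into
  -- `t` across the side opposite to `e`, then around `v` back to `z`.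
  obtain ⟨d, hd, hd'⟩ := exists_cochain_of_reachable (star_reachable hvw hz)
  have hinner : ∃ u ∈ t.cells, ∀ x, cobdry (Pi.single (t.opp e) 1) x = cellInd p x + cellInd u x := by
    rcases hp' with ⟨rfl, h⟩ | ⟨rfl, h⟩
    · exact ⟨_, h, fun x => by rw [cobdry_single, add_comm]⟩
    · exact ⟨_, h, fun x => by rw [cobdry_single]⟩
  obtain ⟨u, hu, hu'⟩ := hinner
  -- The diagonal is crossed only if the triangle `u` where the curve enters `t` differs from the
  -- triangle `w` where it starts to go around `v`.
  have hdiag : ∃ k : ZMod 2, ∀ x, cobdry (Pi.single t.diag k) x = cellInd u x + cellInd w x := by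
    rw [Tile.mem_cells] at hu hw
    have h0 : ∀ x, cobdry (Pi.single t.diag 0) x = 0 := fun x => by simp [cobdry]
    rcases hu with rfl | rfl <;> rcases hw with rfl | rfl
    · exact ⟨0, fun x => by rw [h0, zmod_two_add_self]⟩
    · exact ⟨1, fun x => by rw [cobdry_single]⟩
    · exact ⟨1, fun x => by rw [cobdry_single, add_comm]⟩
    · exact ⟨0, fun x => by rw [h0, zmod_two_add_self]⟩
  obtain ⟨k, hk⟩ := hdiag
  have hzero : ∀ x, cobdry (c + Pi.single (t.opp e) 1 + Pi.single t.diag k + d) x = 0 := by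
    intro x
    simp only [cobdry_add, hk, hu', hc', hd']
    linear_combination zmod_two_add_self (cellInd z x) + zmod_two_add_self (cellInd p x) +
      zmod_two_add_self (cellInd u x) + zmod_two_add_self (cellInd w x)
  obtain ⟨F, hF⟩ := exists_potential hzero
  have hval : ∀ s ∈ T, ∀ g ∈ s.sides, v ∉ Edge.ends g →
      F (g.1 + dir g.2) = F g.1 + if g = t.opp e then 1 else 0 := by
    intro s hs g hg hvg
    rw [hF]
    have g3 : g ≠ t.diag := by rintro rfl; exact hN.diag_notMem_sides hs ht hg
    -- The part of the curve around `v` crosses only segments that end at `v`.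
    have g4 : d g = 0 := by
      by_contra h
      exact hvg (mem_ends_of_mem_vertices (hd g h).1 (hd g h).2)
    simp [g3, g4, hc s hs g (Tile.up_or_down_mem hg), Pi.single_apply]
  have hconst : ∀ s ∈ T, s ≠ t → ∀ x ∈ s.vertices, x ≠ v → ∀ y ∈ s.vertices, y ≠ v → F x = F y := by
    intro s hs hst
    refine const_of_forall_sides fun g hg hvg => ?_
    have g2 : g ≠ t.opp e := by rintro rfl; exact hn ⟨s, hs, hst, hg⟩
    rw [hval s hs g hg hvg, if_neg g2, add_zero]
  have hve' : v ∉ Edge.ends (t.opp e) := fun h => (Tile.mem_ends_opp he hvt).1 h hve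
  have hvf' : v ∉ Edge.ends (t.opp f) := fun h => (Tile.mem_ends_opp hf hvt).1 h hvf
  obtain ⟨x, hxe, hxf⟩ := Tile.exists_common_end he hf' (by rwa [Tile.opp_snd hf])
  obtain ⟨y, hye, hyf⟩ := Tile.exists_common_end he' hf (by rwa [Tile.opp_snd he])
  obtain ⟨o, hoe, hof⟩ := Tile.exists_common_end he' hf' (by rwa [Tile.opp_snd he, Tile.opp_snd hf])
  have hxv : x ≠ v := by rintro rfl; exact hvf' hxf
  have hyv : y ≠ v := by rintro rfl; exact hve' hye
  have hxo : x ≠ o := by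
    rintro rfl
    exact (Tile.mem_ends_opp he (Tile.ends_subset he hxe)).1 hoe hxe
  have hyo : y ≠ o := by
    rintro rfl
    exact (Tile.mem_ends_opp hf (Tile.ends_subset hf hyf)).1 hof hyf
  -- Along the boundary of `t` from `x` over `o` to `y` the curve is crossed once, whereas along the
  -- tiles joining `a` to `b` it is not crossed at all.
  have h1 := Edge.eq_add_of_ends (hval t ht _ hf' hvf') hxf hof hxo
  have h2 := Edge.eq_add_of_ends (hval t ht _ he' hve') hye hoe hyo
  rw [if_pos rfl] at h2
  rw [if_neg (by intro h; apply hef; rw [← Tile.opp_snd he, ← h, Tile.opp_snd hf]), add_zero] at h1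
  have key := reachable_induce_induction
    (P := fun s => ∀ y ∈ s.vertices, y ≠ v → F y = F x) hab
    (fun y hy hyv => hconst a (hS a.2).1 (hS a.2).2 y hy hyv x (Tile.ends_subset hea hxe) hxv) ?_ y
    (Tile.ends_subset hfb hyf) hyv
  · rw [h1, h2] at key
    simp at key
  · rintro r hr s hs ⟨-, g, hgr, hgs⟩ hP y hy hyv
    -- Here adjacency is needed: tiles that merely touch might do so only at `v`, whereas a shared
    -- side has an end other than `v`.
    obtain ⟨q, hq, hqv⟩ : ∃ q ∈ Edge.ends g, q ≠ v := by
      by_cases h : g.1 = v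
      · exact ⟨g.1 + dir g.2, by simp [Edge.ends], by simp [h, dir_ne_zero]⟩
      · exact ⟨g.1, by simp [Edge.ends], h⟩
    rw [hconst s (hS hs).1 (hS hs).2 y hy hyv q (Tile.ends_subset hgs hq) hqv,
      hP q (Tile.ends_subset hgr hq) hqv]

/-! ### Pointers and the spine. -/

/-- The tile `s` is the last tile of a run with middle tile `m`. -/
def PointsTo (T : Finset Tile) (s m : Tile) : Prop :=
  s ∈ T ∧ m ∈ T ∧ s ≠ m ∧ ∃ e, e ∈ endSides T s ∧ e ∈ midSides T m

theorem midCount_pos {T : Finset Tile} {t : Tile} : 0 < midCount T t ↔ (midSides T t).Nonempty := by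
  rw [midCount, Finset.card_pos, Finset.image_nonempty]

theorem midCount_pos_of_mem {T : Finset Tile} {t : Tile} {e : Edge} (h : e ∈ midSides T t) :
    0 < midCount T t := midCount_pos.2 ⟨e, h⟩

theorem PointsTo.midCount_pos {T : Finset Tile} {s m : Tile} (h : PointsTo T s m) :
    0 < midCount T m := by
  obtain ⟨-, -, -, e, -, h⟩ := h
  exact midCount_pos_of_mem h

theorem PointsTo.endCount_pos {T : Finset Tile} {s m : Tile} (h : PointsTo T s m) :
    0 < endCount T s := by
  obtain ⟨-, -, -, e, h, -⟩ := h
  exact Finset.card_pos.2 ⟨e, h⟩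

/-- Of two adjacent tiles, one points to the other. -/
theorem RunsOfThree.mem_endSides_or {T : Finset Tile} (hR : RunsOfThree T) {s t : Tile} (hs : s ∈ T)
    (ht : t ∈ T) (hst : s ≠ t) {e : Edge} (hes : e ∈ s.sides) (het : e ∈ t.sides) :
    (e ∈ endSides T s ∧ e ∈ midSides T t) ∨ (e ∈ midSides T s ∧ e ∈ endSides T t) := by
  have h := hR s hs t ht hst e hes het
  have h1 : Covered T s e := ⟨t, ht, hst.symm, het⟩
  have h2 : Covered T t e := ⟨s, hs, hst, hes⟩
  simp only [mem_midSides, mem_endSides, hes, het, h1, h2, true_and]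
  tauto

theorem PointsTo.of_mem_midSides {T : Finset Tile} (hR : RunsOfThree T) {s t : Tile} (hs : s ∈ T)
    (ht : t ∈ T) (hst : s ≠ t) {e : Edge} (hes : e ∈ s.sides) (het : e ∈ midSides T t) :
    PointsTo T s t := by
  refine ⟨hs, ht, hst, e, ?_, het⟩
  rcases hR.mem_endSides_or hs ht hst hes (mem_midSides.1 het).1 with h | h
  · exact h.1
  · exact absurd (mem_midSides.1 het).2.2 (mem_endSides.1 h.2).2.2

theorem PointsTo.unique {T : Finset Tile} (hN : NonOverlapping T) {s m m' : Tile}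
    (hs : endCount T s ≤ 1) (h : PointsTo T s m) (h' : PointsTo T s m') : m = m' := by
  obtain ⟨hsT, hm, hsm, e, he, hem⟩ := h
  obtain ⟨-, hm', hsm', e', he', hem'⟩ := h'
  have : e = e' := Finset.card_le_one.1 hs e he e' he'
  subst this
  rcases hN.eq_or_eq_of_common hm hsT hm' hsm' (mem_midSides.1 hem).1 (mem_endSides.1 he).1
    (mem_midSides.1 hem').1 with h | h
  · exact absurd h.symm hsm
  · exact h

namespace IsTredoku

variable {T : Finset Tile}

theorem noHoles (hT : IsTredoku T) : NoHoles (covered T) := noHoles_covered_iff.2 hT.no_holes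

theorem counts_pos (hT : IsTredoku T) {t : Tile} (ht : t ∈ T) :
    0 < 2 * midCount T t + endCount T t := by
  rw [← (side_counts T t).2.2, Finset.card_pos]
  by_contra hemp
  rw [Finset.not_nonempty_iff_eq_empty, Finset.filter_eq_empty_iff] at hemp
  obtain ⟨s, hs, hst⟩ := Finset.exists_mem_ne (lt_trans (by norm_num) hT.four_lt_card) t
  refine hst (reachable_induce_induction (P := fun x => x = t)
    (hT.edge_connected.preconnected ⟨t, ht⟩ ⟨s, hs⟩) rfl ?_)
  rintro x - y hy ⟨hxy, e, hex, hey⟩ rfl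
  exact absurd ⟨y, hy, hxy.symm, hey⟩ (hemp hex)

/-- A middle is shared on two opposite sides; by P3 and `covered_of_connected_of_remove` it has a
neighbour in the other direction as well. -/
theorem three_le_of_midCount_pos (hT : IsTredoku T) {t : Tile} (ht : t ∈ T)
    (h : 0 < midCount T t) : 3 ≤ 2 * midCount T t + endCount T t := by
  obtain ⟨e, he⟩ := midCount_pos.1 h
  obtain ⟨het, h1, h2⟩ := mem_midSides.1 he
  obtain ⟨a, b, hs, hab, ha, hb⟩ := t.exists_sides_eq
  obtain ⟨f, hf, hfe⟩ : ∃ f ∈ t.sides, e.2 ≠ f.2 := by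
    by_cases hea : e.2 = a.2
    · exact ⟨b, hb, hea ▸ hab⟩
    · exact ⟨a, ha, hea⟩
  obtain ⟨g, hg, hgf, hcov⟩ : ∃ g ∈ t.sides, g.2 = f.2 ∧ Covered T t g := by
    rcases covered_of_connected_of_remove hT.nonOverlapping hT.noHoles ht
      (hT.connected_of_remove t ht) het hf hfe h1 h2 with h | h
    · exact ⟨f, hf, rfl, h⟩
    · exact ⟨_, Tile.opp_mem hf, Tile.opp_snd hf, h⟩
  rw [← (side_counts T t).2.2]
  have hsub : {e, t.opp e, g} ⊆ t.sides.filter fun e => Covered T t e := by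
    simp [Finset.insert_subset_iff, het, h1, h2, hg, hcov, Tile.opp_mem het]
  have hcard : ({e, t.opp e, g} : Finset Edge).card = 3 := by
    refine Finset.card_eq_three.2 ⟨_, _, _, (Tile.opp_ne het).symm, ?_, ?_, rfl⟩
    · rintro rfl
      exact hfe hgf
    · rintro h
      exact hfe (by rw [← hgf, ← h, Tile.opp_snd het])
  exact hcard ▸ Finset.card_le_card hsub

/-- A tile that is no middle has only its at most two run ends as shared sides; a middle has at
least three shared sides. -/
theorem mem_spine_iff (hT : IsTredoku T) {t : Tile} :
    t ∈ spine T ↔ t ∈ T ∧ 0 < midCount T t := by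
  simp only [spine, Set.mem_ofPred_eq]
  refine and_congr_right fun ht => ?_
  rw [adjCount_eq hT.nonOverlapping ht]
  have h1 := (side_counts T t).2.1
  have h2 := hT.three_le_of_midCount_pos ht
  omega

theorem two_mul_numRuns (hT : IsTredoku T) : 2 * numRuns T = ∑ t ∈ T, endCount T t := by
  rw [numRuns_eq hT.nonOverlapping hT.runsOfThree,
    two_mul_sum_midCount hT.nonOverlapping hT.runsOfThree]

end IsTredoku

theorem sum_one_sub_endCount (T S : Finset Tile) : ∑ t ∈ S, (1 - (endCount T t : ℤ)) =
    (S.filter fun t => endCount T t = 0).card - (S.filter fun t => endCount T t = 2).card := by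
  rw [Finset.card_filter, Finset.card_filter]
  push_cast
  rw [← Finset.sum_sub_distrib]
  refine Finset.sum_congr rfl fun t _ => ?_
  have := (side_counts T t).2.1
  have : endCount T t = 0 ∨ endCount T t = 1 ∨ endCount T t = 2 := by omega
  rcases this with h | h | h <;> simp [h]

/-! ### Surrounded points and the number of two-run ends. -/

/-- All unit triangles at `v` are covered by tiles of `T`. -/
def Surrounded (T : Finset Tile) (v : Point) : Prop := ∀ z : Cell, v ∈ z.vertices → z ∈ covered T

theorem Surrounded.covered {T : Finset Tile} (hN : NonOverlapping T) {v : Point}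
    (hv : Surrounded T v) {t : Tile} (ht : t ∈ T) {e : Edge} (he : e ∈ t.sides)
    (hve : v ∈ Edge.ends e) : Covered T t e := by
  by_contra h
  obtain ⟨p, hp, h1⟩ := exists_free_beyond hN ht he h
  refine hp (hv p ?_)
  rcases h1 with ⟨rfl, -⟩ | ⟨rfl, -⟩
  · exact ends_subset_downCell e hve
  · exact ends_subset_upCell e hve

/-- Both sides of `t` at `v` are shared. A run cannot end at `t` through a side away from `v`,
because the opposite side is at `v` and hence shared. So with `k` ends at `t`, the signs at `v` add
up to (2 − `k`) − `k`. -/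
theorem Surrounded.sum_sideSign_eq {T : Finset Tile} (hN : NonOverlapping T) {v : Point}
    (hv : Surrounded T v) {t : Tile} (ht : t ∈ T) (hvt : v ∈ t.vertices) :
    ∑ e ∈ t.sides with v ∈ Edge.ends e, sideSign T t e = 2 * (1 - (endCount T t : ℤ)) := by
  obtain ⟨e, he, f, hf, hef, hiff⟩ := Tile.exists_sides_of_vertex hvt
  have hset : (t.sides.filter fun g => v ∈ Edge.ends g) = {e, f} := by
    ext g
    simp only [Finset.mem_filter, Finset.mem_insert, Finset.mem_singleton]
    constructor
    · rintro ⟨h1, h2⟩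
      exact (hiff g h1).1 h2
    · rintro (rfl | rfl)
      · exact ⟨he, (hiff _ he).2 (Or.inl rfl)⟩
      · exact ⟨hf, (hiff _ hf).2 (Or.inr rfl)⟩
  have ce := hv.covered hN ht he ((hiff _ he).2 (Or.inl rfl))
  have cf := hv.covered hN ht hf ((hiff _ hf).2 (Or.inr rfl))
  have d1 : e ≠ f := fun h => hef (h ▸ rfl)
  have hends : endSides T t = ({e, f} : Finset Edge).filter fun g => ¬ Covered T t (t.opp g) := by
    ext g
    simp only [mem_endSides, Finset.mem_filter, Finset.mem_insert, Finset.mem_singleton]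
    constructor
    · rintro ⟨h1, h2, h3⟩
      refine ⟨?_, h3⟩
      by_contra hne
      have h4 := (not_congr (hiff g h1)).2 hne
      refine h3 (hv.covered hN ht (Tile.opp_mem h1) ((Tile.mem_ends_opp h1 hvt).2 h4))
    · rintro ⟨rfl | rfl, h⟩
      · exact ⟨he, ce, h⟩
      · exact ⟨hf, cf, h⟩
  rw [hset, Finset.sum_pair d1, endCount, hends]
  by_cases c1 : Covered T t (t.opp e) <;> by_cases c2 : Covered T t (t.opp f) <;>
    simp [sideSign, ce, cf, c1, c2, Finset.filter_insert, Finset.filter_singleton, d1]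

/-- Around a point surrounded by tiles, there are as many tiles at which no run ends as tiles at
which two runs end. -/
theorem Surrounded.card_eq {T : Finset Tile} (hN : NonOverlapping T) (hR : RunsOfThree T) {v : Point}
    (hv : Surrounded T v) :
    ((T.filter fun t => v ∈ t.vertices).filter fun t => endCount T t = 0).card =
    ((T.filter fun t => v ∈ t.vertices).filter fun t => endCount T t = 2).card := by
  have h1 := sum_one_sub_endCount T (T.filter fun t => v ∈ t.vertices)
  have h2 := sum_sideSign hN hR (fun e => v ∈ Edge.ends e)
  rw [← Finset.sum_filter_add_sum_filter_not T (fun t => v ∈ t.vertices),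
    Finset.sum_congr (g := fun t => 2 * (1 - (endCount T t : ℤ))) rfl
      (fun t ht => hv.sum_sideSign_eq hN (Finset.mem_filter.1 ht).1 (Finset.mem_filter.1 ht).2),
    ← Finset.mul_sum, h1, Finset.sum_eq_zero (s := T.filter fun t => ¬ v ∈ t.vertices)] at h2
  · omega
  · intro t ht
    refine Finset.sum_eq_zero fun e he => ?_
    rw [Finset.mem_filter] at he
    exact absurd (Tile.ends_subset he.1 he.2) (Finset.mem_filter.1 ht).2

namespace IsIrreducible

variable {T : Finset Tile}

/-- Following the pointers from a tile of the spine leads to the tile at which no run ends. -/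
theorem reflTransGen_pointsTo (h : IsIrreducible T) {x : Tile} (hx : x ∈ T)
    (hx0 : endCount T x = 0) {s : Tile} (hs : s ∈ T) (hs' : 0 < midCount T s) :
    Relation.ReflTransGen (PointsTo T) s x := by
  have hT := h.1
  have hN := hT.nonOverlapping
  have hxm : 0 < midCount T x := by
    have := hT.counts_pos hx
    omega
  refine reachable_induce_induction (P := fun s => Relation.ReflTransGen (PointsTo T) s x)
    (h.2.preconnected ⟨x, hT.mem_spine_iff.2 ⟨hx, hxm⟩⟩ ⟨s, hT.mem_spine_iff.2 ⟨hs, hs'⟩⟩)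
    Relation.ReflTransGen.refl ?_
  rintro a ha b hb ⟨hab, e, hea, heb⟩ hP
  rw [hT.mem_spine_iff] at ha hb
  rcases hT.runsOfThree.mem_endSides_or ha.1 hb.1 hab hea heb with ⟨h1, h2⟩ | ⟨h1, h2⟩
  · have hp : PointsTo T a b := ⟨ha.1, hb.1, hab, e, h1, h2⟩
    have ha1 : endCount T a ≤ 1 := by
      have := (side_counts T a).2.1
      omega
    rcases Relation.ReflTransGen.cases_head hP with rfl | ⟨c, hc, hcx⟩
    · have := hp.endCount_pos
      omega
    -- A middle has only one outgoing pointer, so the chain from `a` to `x` starts with the step to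
    -- `b`.
    · rwa [hp.unique hN ha1 hc]
  · exact Relation.ReflTransGen.head ⟨hb.1, ha.1, hab.symm, e, h2, h1⟩ hP

/-- A root is a middle, so its chain of pointers leads to the other root; but a root has no outgoing
pointer. -/
theorem eq_of_endCount_eq_zero (h : IsIrreducible T) {x y : Tile} (hx : x ∈ T) (hy : y ∈ T)
    (hx0 : endCount T x = 0) (hy0 : endCount T y = 0) : x = y := by
  have hxm : 0 < midCount T x := by
    have := h.1.counts_pos hx
    omega
  rcases Relation.ReflTransGen.cases_head (h.reflTransGen_pointsTo hy hy0 hx hxm) with rfl | ⟨c, hc, -⟩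
  · rfl
  · have := hc.endCount_pos
    omega

/-- A tile at which two runs end has a corner surrounded by tiles. -/
theorem exists_surrounded (h : IsIrreducible T) {t : Tile} (ht : t ∈ T) (ht2 : endCount T t = 2) :
    ∃ v ∈ t.vertices, Surrounded T v := by
  have hT := h.1
  have hN := hT.nonOverlapping
  have hmid : midCount T t = 0 := by
    have := (side_counts T t).2.1
    omega
  obtain ⟨e, f, hef, hset⟩ := Finset.card_eq_two.1 (show (endSides T t).card = 2 from ht2)
  have he : e ∈ endSides T t := by simp [hset]
  have hf : f ∈ endSides T t := by simp [hset]
  obtain ⟨het, ⟨a, ha, hat, hea⟩, hen⟩ := mem_endSides.1 he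
  obtain ⟨hft, ⟨b, hb, hbt, hfb⟩, hfn⟩ := mem_endSides.1 hf
  have hdir : e.2 ≠ f.2 := by
    intro hd
    rcases Tile.eq_or_eq_opp het hft hd.symm with h | h
    · exact hef h.symm
    · rw [← h] at hen
      exact hen ⟨b, hb, hbt, hfb⟩
  -- The neighbours of `t` are the middles of the runs ending at `t`, hence in the spine, while `t`
  -- is not. The spine therefore joins them without `t`.
  have hspine : ∀ {c : Tile} {g : Edge}, c ∈ T → c ≠ t → g ∈ c.sides → g ∈ t.sides → c ∈ spine T := by
    intro c g hc hct hgc hgt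
    refine hT.mem_spine_iff.2 ⟨hc, ?_⟩
    rcases hT.runsOfThree.mem_endSides_or hc ht hct hgc hgt with h1 | h1
    · have := midCount_pos_of_mem h1.2
      omega
    · exact midCount_pos_of_mem h1.1
  obtain ⟨v, hve, hvf⟩ := Tile.exists_common_end het hft hdir
  refine ⟨v, Tile.ends_subset het hve, fun z hz => ?_⟩
  have hsub : spine T ⊆ (T : Set Tile) \ {t} := ?_
  · exact surrounded_of_reachable hN hT.noHoles ht het hft hdir hen hsub
      (a := ⟨a, hspine ha hat hea het⟩) (b := ⟨b, hspine hb hbt hfb hft⟩) hea hfb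
      (h.2.preconnected _ _) hve hvf hz
  intro s hs
  obtain ⟨h1, h2⟩ := hT.mem_spine_iff.1 hs
  refine ⟨h1, fun hst => ?_⟩
  rw [Set.mem_singleton_iff.1 hst, hmid] at h2
  exact absurd h2 (lt_irrefl 0)

theorem card_endCount_eq_zero_le (h : IsIrreducible T) :
    (T.filter fun t => endCount T t = 0).card ≤ 1 := by
  refine Finset.card_le_one.2 fun x hx y hy => ?_
  rw [Finset.mem_filter] at hx hy
  exact h.eq_of_endCount_eq_zero hx.1 hy.1 hx.2 hy.2

theorem card_vertices_le (t : Tile) : t.vertices.card ≤ 4 := Finset.card_le_four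

/-- At the surrounded corner chosen for a two-run end there are as many two-run ends as roots. As
there is at most one root, the root has this corner and no other two-run end has it. This injects
the two-run ends into the corners of the root. -/
theorem card_endCount_eq_two_le (h : IsIrreducible T) :
    (T.filter fun t => endCount T t = 2).card ≤ 4 * (T.filter fun t => endCount T t = 0).card := by
  have hN := h.1.nonOverlapping
  have hex : ∀ t : Tile, ∃ v, t ∈ T → endCount T t = 2 → v ∈ t.vertices ∧ Surrounded T v := by
    intro t
    by_cases ht : t ∈ T ∧ endCount T t = 2
    · obtain ⟨v, h1, h2⟩ := h.exists_surrounded ht.1 ht.2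
      exact ⟨v, fun _ _ => ⟨h1, h2⟩⟩
    · exact ⟨0, fun h1 h2 => absurd ⟨h1, h2⟩ ht⟩
  choose v hv using hex
  have hcard : ∀ t, t ∈ T → endCount T t = 2 →
      0 < ((T.filter fun s => v t ∈ s.vertices).filter fun s => endCount T s = 0).card ∧
      ((T.filter fun s => v t ∈ s.vertices).filter fun s => endCount T s = 2).card ≤ 1 := by
    intro t ht ht2
    obtain ⟨h1, h2⟩ := hv t ht ht2
    have h3 := h2.card_eq hN h.1.runsOfThree
    have h4 : ((T.filter fun s => v t ∈ s.vertices).filter fun s => endCount T s = 0).card ≤ 1 :=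
      (Finset.card_le_card (Finset.filter_subset_filter _ (Finset.filter_subset _ _))).trans
        h.card_endCount_eq_zero_le
    have h5 : 0 < ((T.filter fun s => v t ∈ s.vertices).filter fun s => endCount T s = 2).card :=
      Finset.card_pos.2 ⟨t, by simp [ht, ht2, h1]⟩
    omega
  have h1 : (T.filter fun t => endCount T t = 2).card ≤
      ((T.filter fun t => endCount T t = 0).biUnion Tile.vertices).card := by
    refine Finset.card_le_card_of_injOn v ?_ ?_
    · intro t ht
      simp only [Finset.coe_filter, Set.mem_ofPred_eq] at ht
      obtain ⟨x, hx⟩ := Finset.card_pos.1 (hcard t ht.1 ht.2).1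
      simp only [Finset.mem_filter] at hx
      simp only [Finset.coe_biUnion, Set.mem_iUnion, Finset.coe_filter, Set.mem_ofPred_eq]
      exact ⟨x, ⟨hx.1.1, hx.2⟩, hx.1.2⟩
    · intro s hs t ht hst
      simp only [Finset.coe_filter, Set.mem_ofPred_eq] at hs ht
      refine Finset.card_le_one.1 (hcard t ht.1 ht.2).2 s ?_ t ?_
      · simp [hs, hst ▸ (hv s hs.1 hs.2).1]
      · simp [ht, (hv t ht.1 ht.2).1]
  refine h1.trans (Finset.card_biUnion_le.trans ?_)
  rw [mul_comm]
  exact Finset.sum_le_card_nsmul _ _ _ fun t _ => card_vertices_le t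

end IsIrreducible

/-- The number of tiles minus the number of run ends, computed tile by tile. -/
theorem IsTredoku.card_sub (T : Finset Tile) (hT : IsTredoku T) : (T.card : ℤ) - 2 * numRuns T =
    (T.filter fun t => endCount T t = 0).card - (T.filter fun t => endCount T t = 2).card := by
  rw [← sum_one_sub_endCount, Finset.sum_sub_distrib]
  have := hT.two_mul_numRuns
  simp
  exact_mod_cast this

/-! ### The exceptional case: angles at the corners of the root, in units of 60°. -/

/-- The number of unit triangles of a tile at a given point. -/
def cellsAt (t : Tile) (v : Point) : ℕ := (t.cells.filter fun c => v ∈ c.vertices).card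

theorem cellsAt_pos {t : Tile} {v : Point} (h : v ∈ t.vertices) : 0 < cellsAt t v := by
  obtain ⟨c, hc, hv⟩ := Tile.mem_vertices_iff.1 h
  exact Finset.card_pos.2 ⟨c, by simp [hc, hv]⟩

theorem sum_cellsAt (t : Tile) (S : Finset Point) :
    ∑ v ∈ S, cellsAt t v = ∑ c ∈ t.cells, (S ∩ c.vertices).card := by
  simp only [cellsAt, Finset.card_filter, ← Finset.filter_mem_eq_inter]
  exact Finset.sum_comm

theorem Tile.card_cells (t : Tile) : t.cells.card = 2 := by
  rw [Tile.cells_eq, Finset.card_pair (upCell_ne_downCell _ _)]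

theorem Cell.card_vertices (c : Cell) : c.vertices.card = 3 := by
  refine Finset.card_eq_three.2 ?_
  obtain ⟨a, b⟩ | ⟨a, b⟩ := c
  · exact ⟨_, _, _, by simp [dir], by simp [dir], by simp [dir], rfl⟩
  · exact ⟨_, _, _, by simp [dir], by simp [dir], by simp [dir], rfl⟩

theorem sum_cellsAt_vertices (t : Tile) : ∑ v ∈ t.vertices, cellsAt t v = 6 := by
  rw [sum_cellsAt, Finset.sum_const_nat (m := 3), Tile.card_cells]
  intro c hc
  rw [Finset.inter_eq_right.2 fun v hv => Tile.mem_vertices_iff.2 ⟨c, hc, hv⟩, c.card_vertices]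

theorem Edge.card_ends (e : Edge) : (Edge.ends e).card = 2 :=
  Finset.card_pair (by simp [dir_ne_zero])

/-- Neighbouring angles of a rhombus add up to 180°. One end of each side lies on the short
diagonal, where both triangles of the tile meet. -/
theorem three_le_sum_cellsAt_ends {t : Tile} {e : Edge} (he : e ∈ t.sides) :
    3 ≤ ∑ v ∈ Edge.ends e, cellsAt t v := by
  have h1 : ∀ v ∈ Edge.ends e, 0 < cellsAt t v := fun v hv => cellsAt_pos (Tile.ends_subset he hv)
  have h2 : ∃ v ∈ Edge.ends e, v ∈ Edge.ends t.diag := by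
    obtain ⟨k, a, b⟩ := t
    by_contra! H
    have h₁ := H e.1 (by simp [Edge.ends])
    have h₂ := H (e.1 + dir e.2) (by simp [Edge.ends])
    clear H
    simp only [Tile.sides, Finset.mem_insert, Finset.mem_singleton] at he
    rcases he with rfl | rfl | rfl | rfl <;> cases k <;>
      simp [Edge.ends, dir, Kind.first, Kind.second, Tile.diag, Prod.ext_iff] at h₁ h₂
  obtain ⟨v, hv, hvd⟩ := h2
  have h3 : 2 ≤ cellsAt t v := by
    rw [cellsAt, Finset.filter_true_of_mem, Tile.card_cells]
    intro c hc
    rcases Tile.mem_cells.1 hc with rfl | rfl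
    · exact ends_subset_upCell _ hvd
    · exact ends_subset_downCell _ hvd
  rw [← Finset.add_sum_erase _ _ hv]
  have h4 : ∑ x ∈ (Edge.ends e).erase v, 1 ≤ ∑ x ∈ (Edge.ends e).erase v, cellsAt t x :=
    Finset.sum_le_sum fun x hx => h1 x (Finset.mem_of_mem_erase hx)
  rw [Finset.sum_const, Finset.card_erase_of_mem hv, Edge.card_ends] at h4
  simp at h4
  omega

theorem sum_cellsAt_le_five {T : Finset Tile} (hN : NonOverlapping T) {v : Point}
    (hv : ¬ Surrounded T v) : ∑ t ∈ T, cellsAt t v ≤ 5 := by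
  unfold Surrounded at hv
  push Not at hv
  obtain ⟨z, hz, hzT⟩ := hv
  have h1 : ∑ t ∈ T, cellsAt t v =
      (T.biUnion fun t => t.cells.filter fun c => v ∈ c.vertices).card := by
    rw [Finset.card_biUnion]
    · rfl
    · intro s hs t ht hst
      exact Finset.disjoint_filter_filter (hN s hs t ht hst)
  have h2 : (T.biUnion fun t => t.cells.filter fun c => v ∈ c.vertices) ⊆
      (Finset.univ.image (star v)).erase z := by
    intro c hc
    simp only [Finset.mem_biUnion, Finset.mem_filter] at hc
    obtain ⟨t, ht, hct, hvc⟩ := hc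
    obtain ⟨k, hk⟩ := mem_vertices_iff_star.1 hvc
    refine Finset.mem_erase.2 ⟨?_, by simp [hk]⟩
    rintro rfl
    exact hzT (mem_covered.2 ⟨t, ht, hct⟩)
  have h3 : z ∈ Finset.univ.image (star v) := by
    obtain ⟨k, hk⟩ := mem_vertices_iff_star.1 hz
    simp [hk]
  have h4 := Finset.card_le_card h2
  rw [Finset.card_erase_of_mem h3, Finset.card_image_of_injective _ (star_injective v)] at h4
  simpa [h1] using h4

open Classical in
/-- The last tiles of the runs with middle tile `m`. -/
noncomputable def children (T : Finset Tile) (m : Tile) : Finset Tile :=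
  T.filter fun s => PointsTo T s m

theorem mem_children {T : Finset Tile} {s m : Tile} : s ∈ children T m ↔ PointsTo T s m := by
  simp only [children, Finset.mem_filter, and_iff_right_iff_imp]
  exact fun h => h.1

theorem pointsTo_acrossTile {T : Finset Tile} (hR : RunsOfThree T) {m : Tile} (hm : m ∈ T) {e : Edge}
    (he : e ∈ midSides T m) : PointsTo T (acrossTile T m e) m := by
  obtain ⟨h1, h2, h3⟩ := acrossTile_spec (mem_midSides.1 he).2.1
  exact PointsTo.of_mem_midSides hR h1 hm h2 h3 he

theorem two_mul_midCount_le_card_children {T : Finset Tile} (hN : NonOverlapping T)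
    (hR : RunsOfThree T) {m : Tile} (hm : m ∈ T) : 2 * midCount T m ≤ (children T m).card := by
  rw [← (side_counts T m).1]
  refine Finset.card_le_card_of_injOn (acrossTile T m) ?_ ?_
  · intro e he
    exact mem_children.2 (pointsTo_acrossTile hR hm he)
  · refine (acrossTile_injOn hN hm).mono fun e he => ?_
    obtain ⟨h1, h2, -⟩ := mem_midSides.1 he
    simp [h1, h2]

/-- The side shared with the middle of a run that ends at `y` is not parallel to the sides shared
with the tiles of a run with middle tile `y`. -/
theorem snd_ne_of_mem_endSides {T : Finset Tile} {y : Tile} {e f : Edge} (he : e ∈ endSides T y)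
    (hf : f ∈ midSides T y) : e.2 ≠ f.2 := by
  intro h
  obtain ⟨he1, he2, he3⟩ := mem_endSides.1 he
  obtain ⟨hf1, hf2, hf3⟩ := mem_midSides.1 hf
  rcases Tile.eq_or_eq_opp he1 hf1 h.symm with rfl | rfl
  · exact he3 hf3
  · exact he3 hf2

section Count

variable {T : Finset Tile} {x : Tile}

theorem three_le_of_pointsTo {s : Tile} (h : PointsTo T s x) :
    3 ≤ ∑ v ∈ x.vertices, cellsAt s v := by
  obtain ⟨-, -, -, e, he, hex⟩ := h
  refine (three_le_sum_cellsAt_ends (mem_endSides.1 he).1).trans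
    (Finset.sum_le_sum_of_subset (Tile.ends_subset (mem_midSides.1 hex).1))

theorem one_le_of_mem_vertices {s : Tile} {v : Point} (hv : v ∈ x.vertices) (h : v ∈ s.vertices) :
    1 ≤ ∑ v ∈ x.vertices, cellsAt s v :=
  (cellsAt_pos h).trans_le
    (Finset.single_le_sum (f := fun v => cellsAt s v) (fun _ _ => Nat.zero_le _) hv)

/-- The side along which `y` points to `x` is not parallel to the side shared by `y` and `s`, so the
two meet in a corner. -/
theorem exists_common_vertex {s y : Tile} (hs : PointsTo T s y) (hy : PointsTo T y x) :
    ∃ v ∈ x.vertices, v ∈ s.vertices ∧ v ∈ y.vertices ∧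
      ∃ e, v ∈ Edge.ends e ∧ e ∈ endSides T s ∧ e ∈ midSides T y := by
  obtain ⟨-, -, -, e, he, hex⟩ := hy
  obtain ⟨-, -, -, f, hf, hfy⟩ := hs
  have he1 := (mem_endSides.1 he).1
  have hf1 := (mem_midSides.1 hfy).1
  obtain ⟨v, hve, hvf⟩ := Tile.exists_common_end he1 hf1 (snd_ne_of_mem_endSides he hfy)
  exact ⟨v, Tile.ends_subset (mem_midSides.1 hex).1 hve,
    Tile.ends_subset (mem_endSides.1 hf).1 hvf, Tile.ends_subset he1 hve, f, hvf, hf, hfy⟩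

/-- The run with middle `s` passes through opposite sides of `s`, and one of them contains the
corner that `s` shares with `x`. The tile beyond that side reaches this corner. -/
theorem exists_grandchild (hR : RunsOfThree T) {s y : Tile} (hs : PointsTo T s y)
    (hy : PointsTo T y x) (hm : 0 < midCount T s) :
    ∃ r, PointsTo T r s ∧ 1 ≤ ∑ v ∈ x.vertices, cellsAt r v := by
  obtain ⟨v, hvx, hvs, hvy, e, hve, hes, hey⟩ := exists_common_vertex hs hy
  obtain ⟨f, hf⟩ := midCount_pos.1 hm
  obtain ⟨hf1, hf2, hf3⟩ := mem_midSides.1 hf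
  obtain ⟨g, hg, hvg⟩ : ∃ g ∈ midSides T s, v ∈ Edge.ends g := by
    by_cases hvf : v ∈ Edge.ends f
    · exact ⟨f, hf, hvf⟩
    · refine ⟨s.opp f, mem_midSides.2 ⟨Tile.opp_mem hf1, hf3, ?_⟩, (Tile.mem_ends_opp hf1 hvs).2 hvf⟩
      rwa [Tile.opp_opp hf1]
  refine ⟨acrossTile T s g, pointsTo_acrossTile hR hs.1 hg, one_le_of_mem_vertices hvx ?_⟩
  exact Tile.ends_subset (acrossTile_spec (mem_midSides.1 hg).2.1).2.2 hvg

theorem disjoint_children (hN : NonOverlapping T) (hend : ∀ t ∈ T, endCount T t ≤ 1) {y z : Tile}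
    (hyz : y ≠ z) : Disjoint (children T y) (children T z) := by
  rw [Finset.disjoint_left]
  intro s h1 h2
  rw [mem_children] at h1 h2
  exact hyz (h1.unique hN (hend s h1.1) h2)

theorem twelve_le_sum_children (hN : NonOverlapping T) (hR : RunsOfThree T) (hx : x ∈ T)
    (hx2 : midCount T x = 2) : 12 ≤ ∑ t ∈ children T x, ∑ v ∈ x.vertices, cellsAt t v := by
  have h1 : ∑ t ∈ children T x, 3 ≤ ∑ t ∈ children T x, ∑ v ∈ x.vertices, cellsAt t v :=
    Finset.sum_le_sum fun t ht => three_le_of_pointsTo (mem_children.1 ht)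
  have h2 := two_mul_midCount_le_card_children hN hR hx
  simp at h1
  omega

theorem two_le_sum_children (hN : NonOverlapping T) (hR : RunsOfThree T) {y : Tile}
    (hy : PointsTo T y x) (hy1 : 0 < midCount T y) :
    2 ≤ ∑ t ∈ children T y, ∑ v ∈ x.vertices, cellsAt t v := by
  have h1 : ∑ t ∈ children T y, 1 ≤ ∑ t ∈ children T y, ∑ v ∈ x.vertices, cellsAt t v := by
    refine Finset.sum_le_sum fun t ht => ?_
    obtain ⟨v, h1, h2, -⟩ := exists_common_vertex (mem_children.1 ht) hy
    exact one_le_of_mem_vertices h1 h2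
  have h2 := two_mul_midCount_le_card_children hN hR hy.1
  simp at h1
  omega

/-- Of the 20 available units, the root takes 6 and its four neighbours at least 12. -/
theorem sum_children_insert_le (hN : NonOverlapping T) (hR : RunsOfThree T) (hx : x ∈ T)
    (hx2 : midCount T x = 2) (hsum : ∑ t ∈ T, ∑ v ∈ x.vertices, cellsAt t v ≤ 20)
    (S : Finset Tile) (hST : S ⊆ T) (hxS : x ∉ S)
    (hS : Disjoint (children T x) S) : ∑ t ∈ S, ∑ v ∈ x.vertices, cellsAt t v ≤ 2 := by
  have hxc : x ∉ children T x := fun h => (mem_children.1 h).2.2.1 rfl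
  have h1 : ∑ t ∈ insert x (children T x ∪ S), ∑ v ∈ x.vertices, cellsAt t v ≤ 20 := by
    refine (Finset.sum_le_sum_of_subset ?_).trans hsum
    refine Finset.insert_subset hx (Finset.union_subset ?_ hST)
    exact fun t ht => (mem_children.1 ht).1
  rw [Finset.sum_insert (by simp [hxc, hxS]), Finset.sum_union hS, sum_cellsAt_vertices] at h1
  have h2 := twelve_le_sum_children hN hR hx hx2
  omega

theorem not_mem_children (hx0 : endCount T x = 0) (y : Tile) : x ∉ children T y := fun h => by
  have := (mem_children.1 h).endCount_pos
  omega

/-- The two tiles pointing to a middle next to the root use up the remaining 2 units, so there is no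
room for a second such middle. -/
theorem eq_of_pointsTo_of_pointsTo (hN : NonOverlapping T) (hR : RunsOfThree T)
    (hend : ∀ t ∈ T, endCount T t ≤ 1) (hx : x ∈ T) (hx0 : endCount T x = 0)
    (hx2 : midCount T x = 2) (hsum : ∑ t ∈ T, ∑ v ∈ x.vertices, cellsAt t v ≤ 20)
    {y z : Tile} (hy : PointsTo T y x) (hz : PointsTo T z x)
    (hy1 : 0 < midCount T y) (hz1 : 0 < midCount T z) : y = z := by
  by_contra hyz
  have hsub : ∀ m, children T m ⊆ T := fun m t ht => (mem_children.1 ht).1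
  have hnx : ∀ m, x ∉ children T m := not_mem_children hx0
  have h1 := sum_children_insert_le hN hR hx hx2 hsum (children T y ∪ children T z)
    (Finset.union_subset (hsub _) (hsub _)) (by simp [hnx])
    (Finset.disjoint_union_right.2 ⟨disjoint_children hN hend hy.2.2.1.symm,
      disjoint_children hN hend hz.2.2.1.symm⟩)
  rw [Finset.sum_union (disjoint_children hN hend hyz)] at h1
  have h2 := two_le_sum_children hN hR hy hy1
  have h3 := two_le_sum_children hN hR hz hz1
  omega

/-- The tiles pointing to `y` take 2 units. If one of them were a middle, a tile pointing to it
would need a third unit. -/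
theorem midCount_eq_zero_of_pointsTo (hN : NonOverlapping T) (hR : RunsOfThree T)
    (hend : ∀ t ∈ T, endCount T t ≤ 1) (hx : x ∈ T) (hx0 : endCount T x = 0)
    (hx2 : midCount T x = 2) (hsum : ∑ t ∈ T, ∑ v ∈ x.vertices, cellsAt t v ≤ 20)
    {s y : Tile} (hs : PointsTo T s y) (hy : PointsTo T y x) :
    midCount T s = 0 := by
  by_contra hm
  obtain ⟨r, hr, hr1⟩ := exists_grandchild hR hs hy (Nat.pos_of_ne_zero hm)
  have hsub : ∀ m, children T m ⊆ T := fun m t ht => (mem_children.1 ht).1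
  have hnx : ∀ m, x ∉ children T m := not_mem_children hx0
  have hsx : s ≠ x := by
    rintro rfl
    have := hs.endCount_pos
    omega
  have hrs := mem_children.2 hr
  have hdis : ∀ m, m ≠ s → r ∉ children T m := fun m hms h =>
    Finset.disjoint_left.1 (disjoint_children hN hend hms) h hrs
  have hrx : r ≠ x := by
    rintro rfl
    exact hnx _ hrs
  have h1 := sum_children_insert_le hN hR hx hx2 hsum (insert r (children T y))
    (Finset.insert_subset hr.1 (hsub _)) (by simp [hnx, hrx.symm])
    (Finset.disjoint_insert_right.2 ⟨hdis _ hsx.symm, disjoint_children hN hend hy.2.2.1.symm⟩)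
  rw [Finset.sum_insert (hdis _ hs.2.2.1.symm)] at h1
  have h2 := two_le_sum_children hN hR hy hs.midCount_pos
  omega

end Count

/-- If no tile is the last tile of two runs, then there are at most three runs or no tile at which
no run ends. -/
theorem IsIrreducible.numRuns_le_three {T : Finset Tile} (h : IsIrreducible T)
    (h2 : (T.filter fun t => endCount T t = 2).card = 0) {x : Tile} (hx : x ∈ T)
    (hx0 : endCount T x = 0) : numRuns T = 2 ∨ numRuns T = 3 := by
  have hT := h.1
  have hN := hT.nonOverlapping
  have hR := hT.runsOfThree
  have hend : ∀ t ∈ T, endCount T t ≤ 1 := by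
    intro t ht
    have h1 := (side_counts T t).2.1
    have h3 : endCount T t ≠ 2 := fun h3 => by
      rw [Finset.card_eq_zero, Finset.filter_eq_empty_iff] at h2
      exact h2 ht h3
    omega
  have hx2 : midCount T x = 2 := by
    have h1 := hT.counts_pos hx
    have h3 := hT.three_le_of_midCount_pos hx
    have h4 := (side_counts T x).2.1
    omega
  -- A surrounded corner of the root would have a two-run end.
  have hsur : ∀ v ∈ x.vertices, ¬ Surrounded T v := by
    intro v hv hs
    have h1 := hs.card_eq hN hR
    have h3 : 0 < ((T.filter fun t => v ∈ t.vertices).filter fun t => endCount T t = 0).card :=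
      Finset.card_pos.2 ⟨x, by simp [hx, hv, hx0]⟩
    have h4 := Finset.card_le_card
      (Finset.filter_subset_filter (fun t => endCount T t = 2) (T.filter_subset (fun t => v ∈ t.vertices)))
    omega
  have hsum : ∑ t ∈ T, ∑ v ∈ x.vertices, cellsAt t v ≤ 20 := by
    rw [Finset.sum_comm]
    refine (Finset.sum_le_card_nsmul _ _ 5 fun v hv => sum_cellsAt_le_five hN (hsur v hv)).trans ?_
    have : x.vertices.card ≤ 4 := IsIrreducible.card_vertices_le x
    simp
    omega
  have hle : ∀ t ∈ T.erase x, midCount T t ≤ if 0 < midCount T t then 1 else 0 := by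
    intro t ht
    rw [Finset.mem_erase] at ht
    have h1 := (side_counts T t).2.1
    have h3 : endCount T t ≠ 0 := fun h0 => ht.1 (h.eq_of_endCount_eq_zero ht.2 hx h0 hx0)
    split_ifs <;> omega
  have hruns : numRuns T = 2 + ∑ t ∈ T.erase x, midCount T t := by
    rw [numRuns_eq hN hR, ← Finset.add_sum_erase _ _ hx, hx2]
  have hcard : ((T.erase x).filter fun t => 0 < midCount T t).card ≤ 1 := by
    -- On a longer chain of pointers from `y`, the tile two steps before `x` would be a middle.
    have hdirect : ∀ y ∈ T, y ≠ x → 0 < midCount T y → PointsTo T y x := by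
      intro y hy hyx hy1
      rcases Relation.ReflTransGen.cases_tail (h.reflTransGen_pointsTo hx hx0 hy hy1) with
        h1 | ⟨z, hyz, hzx⟩
      · exact absurd h1.symm hyx
      rcases Relation.ReflTransGen.cases_tail hyz with h1 | ⟨w, hyw, hwz⟩
      · exact h1 ▸ hzx
      · exfalso
        have h1 := midCount_eq_zero_of_pointsTo hN hR hend hx hx0 hx2 hsum hwz hzx
        rcases Relation.ReflTransGen.cases_tail hyw with rfl | ⟨u, -, huw⟩
        · omega
        · have := huw.midCount_pos
          omega
    refine Finset.card_le_one.2 fun y hy z hz => ?_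
    simp only [Finset.mem_filter, Finset.mem_erase] at hy hz
    exact eq_of_pointsTo_of_pointsTo hN hR hend hx hx0 hx2 hsum (hdirect y hy.1.2 hy.1.1 hy.2)
      (hdirect z hz.1.2 hz.1.1 hz.2) hy.2 hz.2
  have h3 := Finset.sum_le_sum hle
  rw [← Finset.card_filter] at h3
  omega

/-- The counts of roots and two-run ends leave only τ = 2ρ + 1 to be excluded. In that case ρ is 2
or 3, so (τ, ρ) is one of the two exceptional pairs. -/
theorem IsIrreducible.card_bounds {T : Finset Tile} (h : IsIrreducible T)
    (h5 : ¬ (T.card = 5 ∧ numRuns T = 2)) (h7 : ¬ (T.card = 7 ∧ numRuns T = 3)) :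
    2 * (numRuns T : ℤ) - 3 ≤ T.card ∧ (T.card : ℤ) ≤ 2 * numRuns T := by
  have h1 := h.1.card_sub T
  have h2 := h.card_endCount_eq_two_le
  have h3 := h.card_endCount_eq_zero_le
  refine ⟨by omega, ?_⟩
  by_contra hlt
  have h4 : (T.filter fun t => endCount T t = 2).card = 0 := by omega
  obtain ⟨x, hx⟩ := Finset.card_pos.1
    (show 0 < (T.filter fun t => endCount T t = 0).card by omega)
  rw [Finset.mem_filter] at hx
  have := h.numRuns_le_three h4 hx.1 hx.2
  omega

/-! ### Connectedness certified by the order of a list. -/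

section Connectivity

variable {V : Type*} {G : SimpleGraph V}

theorem induce_insert_connected {S : Set V} (hS : (G.induce S).Connected) {a b : V} (hb : b ∈ S)
    (hab : G.Adj a b) : (G.induce (insert a S)).Connected := by
  have h1 := SimpleGraph.induce_pair_connected_of_adj hab
  have h2 := SimpleGraph.induce_union_connected h1.preconnected hS.preconnected
    ⟨b, by simp, hb⟩
  have h3 : ({a, b} ∪ S : Set V) = insert a S := by
    ext x
    simp only [Set.mem_union, Set.mem_insert_iff, Set.mem_singleton_iff]
    constructor
    · rintro ((h | rfl) | h) <;> simp_all
    · rintro (h | h) <;> simp_all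
  rwa [h3] at h2

theorem induce_union_connected_of_adj {S S' : Set V} (hS : (G.induce S).Connected)
    (hS' : (G.induce S').Connected) {a b : V} (ha : a ∈ S) (hb : b ∈ S') (hab : G.Adj a b) :
    (G.induce (S ∪ S')).Connected := by
  have h1 := SimpleGraph.induce_union_connected (induce_insert_connected hS' hb hab).preconnected
    hS.preconnected ⟨a, by simp, ha⟩
  have h2 : (insert a S' ∪ S : Set V) = S ∪ S' := by
    ext x
    simp only [Set.mem_union, Set.mem_insert_iff]
    constructor
    · rintro ((rfl | h) | h) <;> simp_all
    · rintro (h | h) <;> simp_all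
  rwa [h2] at h1

theorem induce_singleton_connected (a : V) : (G.induce {a}).Connected := by
  rw [SimpleGraph.induce_singleton_eq_top]
  exact SimpleGraph.connected_top

theorem Reachable.induce_mono {S S' : Set V} (h : S ⊆ S') {a b : S}
    (hab : (G.induce S).Reachable a b) :
    (G.induce S').Reachable ⟨a, h a.2⟩ ⟨b, h b.2⟩ :=
  hab.map (G.induceHomOfLE h).toHom

/-- Each element of the list but the last one is joined to a later one. -/
def Linked (r : V → V → Prop) : List V → Prop
  | [] => True
  | a :: l => (l = [] ∨ ∃ b ∈ l, r a b) ∧ Linked r l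

instance Linked.decidable [DecidableEq V] (r : V → V → Prop) [DecidableRel r] :
    (l : List V) → Decidable (Linked r l)
  | [] => inferInstanceAs (Decidable True)
  | a :: l =>
    have := Linked.decidable r l
    inferInstanceAs (Decidable ((l = [] ∨ ∃ b ∈ l, r a b) ∧ Linked r l))

theorem Linked.connected {l : List V} (h : Linked G.Adj l) (hl : l ≠ []) :
    (G.induce {x | x ∈ l}).Connected := by
  induction l with
  | nil => exact absurd rfl hl
  | cons a l ih =>
    obtain ⟨h1, h2⟩ := h
    have h3 : {x | x ∈ a :: l} = insert a {x | x ∈ l} := by ext x; simp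
    rw [h3]
    rcases h1 with rfl | ⟨b, hb, hab⟩
    · have h4 : insert a {x | x ∈ ([] : List V)} = {a} := by ext x; simp
      rw [h4]
      exact induce_singleton_connected a
    · exact induce_insert_connected (ih h2 (List.ne_nil_of_mem hb)) hb hab

theorem Linked.of_append {r : V → V → Prop} {l l' : List V} (h : Linked r (l ++ l')) :
    Linked r l' := by
  induction l with
  | nil => exact h
  | cons a l ih => exact ih h.2

/-- If each element of a list is joined to a later one and to an earlier one, and the first one to
the last one, then the list remains connected when an element is removed. -/
theorem connected_of_remove_of_linked {l : List V} (hl : 2 ≤ l.length) (hnd : l.Nodup)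
    (h : Linked G.Adj l) (h' : Linked G.Adj l.reverse)
    (hlast : ∀ a ∈ l.head?, ∀ b ∈ l.getLast?, G.Adj a b) {t : V} (ht : t ∈ l) :
    (G.induce ({x | x ∈ l} \ {t})).Connected := by
  obtain ⟨l₁, l₂, rfl⟩ := List.append_of_mem ht
  have h1 : ({x | x ∈ l₁ ++ t :: l₂} \ {t} : Set V) = {x | x ∈ l₁} ∪ {x | x ∈ l₂} := by
    have hn : t ∉ l₁ ∧ t ∉ l₂ := by
      rw [List.nodup_middle, List.nodup_cons, List.mem_append, not_or] at hnd
      exact hnd.1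
    ext x
    simp only [Set.mem_sdiff, Set.mem_ofPred_eq, List.mem_append, List.mem_cons,
      Set.mem_singleton_iff, Set.mem_union]
    constructor
    · rintro ⟨h | h | h, h'⟩
      · exact Or.inl h
      · exact absurd h h'
      · exact Or.inr h
    · rintro (h | h)
      · exact ⟨Or.inl h, fun hx => hn.1 (hx ▸ h)⟩
      · exact ⟨Or.inr (Or.inr h), fun hx => hn.2 (hx ▸ h)⟩
  rw [h1]
  -- Later links keep the part after `t` connected, earlier links the part before `t`, and the first
  -- and last elements join the two parts.
  have h2 : Linked G.Adj l₂ := (Linked.of_append h).2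
  have h3 : Linked G.Adj l₁.reverse := by
    rw [List.reverse_append, List.reverse_cons, List.append_assoc] at h'
    exact (Linked.of_append h').2
  have h4 : l₁ ≠ [] → (G.induce {x | x ∈ l₁}).Connected := fun hne => by
    have h5 := h3.connected (by simpa using hne)
    have h6 : {x | x ∈ l₁.reverse} = {x | x ∈ l₁} := by ext x; simp
    rwa [h6] at h5
  rcases l₁ with _ | ⟨a, l₁⟩
  · have : l₂ ≠ [] := by rintro rfl; simp at hl
    have h5 : ({x | x ∈ ([] : List V)} ∪ {x | x ∈ l₂} : Set V) = {x | x ∈ l₂} := by ext x; simp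
    rw [h5]
    exact h2.connected this
  rcases List.eq_nil_or_concat l₂ with rfl | ⟨l₂, b, rfl⟩
  · have h5 : ({x | x ∈ a :: l₁} ∪ {x | x ∈ ([] : List V)} : Set V) = {x | x ∈ a :: l₁} := by
      ext x; simp
    rw [h5]
    exact h4 (by simp)
  · refine induce_union_connected_of_adj (h4 (by simp)) (h2.connected (by simp)) (a := a) (b := b)
      (by simp) (by simp) (hlast a (by simp) b ?_)
    rw [List.concat_eq_append, ← List.cons_append, ← List.append_assoc, List.getLast?_append]
    simp

end Connectivity

/-! ### Verification of examples by computation. -/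

instance : DecidableRel adjGraph.Adj := fun s t =>
  inferInstanceAs (Decidable (s ≠ t ∧ ∃ e ∈ s.sides, e ∈ t.sides))

instance : DecidableRel touchGraph.Adj := fun s t =>
  inferInstanceAs (Decidable (s ≠ t ∧ ∃ p ∈ s.vertices, p ∈ t.vertices))

instance : DecidableRel cellGraph.Adj := fun c d =>
  inferInstanceAs (Decidable (c ≠ d ∧ ∃ e ∈ c.sides, e ∈ d.sides))

/-- A local condition under which the removal of the triangle `c` from the complement of `R` does
not disconnect this complement. -/
def Removable (R : Finset Cell) (c : Cell) : Prop :=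
  ∀ z ∈ c.vertices, (∃ d ∈ R, cellGraph.Adj c d ∧ z ∈ d.vertices) ∨
    ∀ k, star z k ≠ c → star z k ∉ R

instance (R : Finset Cell) (c : Cell) : Decidable (Removable R c) :=
  inferInstanceAs (Decidable (∀ z ∈ c.vertices, (∃ d ∈ R, cellGraph.Adj c d ∧ z ∈ d.vertices) ∨
    ∀ k, star z k ≠ c → star z k ∉ R))

theorem adj_eq_cases {c d : Cell} (h : cellGraph.Adj c d) :
    match c with
    | .up p => d = .down (p - dir 1) ∨ d = .down (p - dir 0) ∨ d = .down p
    | .down p => d = .up (p + dir 1) ∨ d = .up (p + dir 0) ∨ d = .up p := by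
  obtain ⟨hne, e, hc, hd⟩ := h
  rw [mem_cell_sides] at hd
  rcases c with p | p <;> simp only [Cell.sides, Finset.mem_insert, Finset.mem_singleton] at hc <;>
    rcases hc with rfl | rfl | rfl <;> rcases hd with rfl | rfl <;>
    simp [upCell, downCell] at hne ⊢

/-- Two neighbours of a triangle are the ones next to it around a common vertex. -/
theorem exists_star_of_adj {c d d' : Cell} (h : cellGraph.Adj c d) (h' : cellGraph.Adj c d')
    (hne : d ≠ d') : ∃ z k, c = star z k ∧
      ((d = star z (k + 1) ∧ d' = star z (k + 5)) ∨ (d' = star z (k + 1) ∧ d = star z (k + 5))) := by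
  have h1 := adj_eq_cases h
  have h2 := adj_eq_cases h'
  rcases c with ⟨a, b⟩ | ⟨a, b⟩ <;> rcases h1 with rfl | rfl | rfl <;>
    rcases h2 with rfl | rfl | rfl <;> first
    | exact absurd rfl hne
    | (refine ⟨(a, b), 0, ?_⟩; simp [star, dir]; done)
    | (refine ⟨(a + 1, b), 2, ?_⟩; simp [star, dir]; done)
    | (refine ⟨(a, b + 1), 4, ?_⟩; simp [star, dir]; done)
    | (refine ⟨(a + 1, b), 1, ?_⟩; simp [star, dir]; done)
    | (refine ⟨(a + 1, b + 1), 3, ?_⟩; simp [star, dir]; done)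
    | (refine ⟨(a, b + 1), 5, ?_⟩; simp [star, dir])

theorem star_adj_iff {z : Point} {k j : Fin 6} (h : cellGraph.Adj (star z k) (star z j)) :
    j = k + 1 ∨ j = k + 5 := by
  have h1 := adj_eq_cases h
  obtain ⟨x, y⟩ := z
  fin_cases k <;> fin_cases j <;> simp [star, dir, Prod.ext_iff] at h1 ⊢ <;> omega

/-- Going around a point, leaving out one triangle. -/
theorem star_path {S : Set Cell} {z : Point} {k : Fin 6} (h : ∀ j, j ≠ k → star z j ∈ S) :
    (cellGraph.induce S).Reachable ⟨star z (k + 1), h _ (by clear * -; revert k; decide)⟩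
      ⟨star z (k + 5), h _ (by clear * -; revert k; decide)⟩ := by
  have step : ∀ j, ∀ hj : j ≠ k, ∀ hj' : j + 1 ≠ k,
      (cellGraph.induce S).Reachable ⟨star z j, h j hj⟩ ⟨star z (j + 1), h _ hj'⟩ :=
    fun j _ _ => SimpleGraph.Adj.reachable (star_adj z j)
  have h1 := step (k + 1) (by clear * -; revert k; decide) (by clear * -; revert k; decide)
  have h2 := step (k + 1 + 1) (by clear * -; revert k; decide) (by clear * -; revert k; decide)
  have h3 := step (k + 1 + 1 + 1) (by clear * -; revert k; decide) (by clear * -; revert k; decide)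
  have h4 := step (k + 1 + 1 + 1 + 1) (by clear * -; revert k; decide) (by clear * -; revert k; decide)
  have h5 : k + 5 = k + 1 + 1 + 1 + 1 + 1 := by clear * -; revert k; decide
  have h6 := ((h1.trans h2).trans h3).trans h4
  simp only [h5]
  exact h6

theorem noHoles_empty : NoHoles ∅ := by
  have hmem : ∀ c : Cell, c ∈ {c : Cell | c ∉ (∅ : Finset Cell)} := fun c => by simp
  have hstar : ∀ v : Point, ∀ a b : Cell, v ∈ a.vertices → v ∈ b.vertices →
      (cellGraph.induce {c : Cell | c ∉ (∅ : Finset Cell)}).Reachable ⟨a, hmem a⟩ ⟨b, hmem b⟩ :=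
    fun v a b ha hb => Reachable.induce_mono (fun c _ => hmem c) (star_reachable ha hb)
  have hx : ∀ x y : ℤ, (cellGraph.induce {c : Cell | c ∉ (∅ : Finset Cell)}).Reachable
      ⟨.up (x, y), hmem _⟩ ⟨.up (x + 1, y), hmem _⟩ := fun x y =>
    hstar (x + 1, y) _ _ (by simp [Cell.vertices, dir]) (by simp [Cell.vertices])
  have hy : ∀ x y : ℤ, (cellGraph.induce {c : Cell | c ∉ (∅ : Finset Cell)}).Reachable
      ⟨.up (x, y), hmem _⟩ ⟨.up (x, y + 1), hmem _⟩ := fun x y =>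
    hstar (x, y + 1) _ _ (by simp [Cell.vertices, dir]) (by simp [Cell.vertices])
  have hline : ∀ x : ℤ, (cellGraph.induce {c : Cell | c ∉ (∅ : Finset Cell)}).Reachable
      ⟨.up (0, 0), hmem _⟩ ⟨.up (x, 0), hmem _⟩ := by
    intro x
    induction x using Int.induction_on with
    | zero => rfl
    | succ n ih => exact ih.trans (hx _ _)
    | pred n ih =>
      have := hx (-(n : ℤ) - 1) 0
      simp only [sub_add_cancel] at this
      exact ih.trans this.symm
  have hplane : ∀ x y : ℤ, (cellGraph.induce {c : Cell | c ∉ (∅ : Finset Cell)}).Reachable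
      ⟨.up (0, 0), hmem _⟩ ⟨.up (x, y), hmem _⟩ := by
    intro x y
    induction y using Int.induction_on with
    | zero => exact hline x
    | succ n ih => exact ih.trans (hy _ _)
    | pred n ih =>
      have := hy x (-(n : ℤ) - 1)
      simp only [sub_add_cancel] at this
      exact ih.trans this.symm
  rw [NoHoles, SimpleGraph.connected_iff_exists_forall_reachable]
  refine ⟨⟨.up (0, 0), hmem _⟩, ?_⟩
  rintro ⟨⟨x, y⟩ | ⟨x, y⟩, h⟩
  · exact hplane x y
  · exact (hplane (x + 1) y).trans
      (hstar (x + 1, y) _ _ (by simp [Cell.vertices]) (by simp [Cell.vertices, dir]))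

instance : Infinite Cell := Infinite.of_injective Cell.up fun _ _ h => Cell.up.inj h

/-- A path of free triangles through `c` enters and leaves by two neighbours of `c`, and is rerouted
around the vertex that they share with `c`. -/
theorem NoHoles.insert {R : Finset Cell} (hR : NoHoles R) {c : Cell} (hc : c ∉ R)
    (h : Removable R c) : NoHoles (insert c R) := by
  have hmem : ∀ {x : Cell}, x ∉ R → x ≠ c → x ∈ {x | x ∉ Insert.insert c R} := fun hx hxc => by
    simp [hx, hxc]
  have hnbr : ∀ d d' : Cell, ∀ (hd : d ∉ R) (hd' : d' ∉ R) (h1 : cellGraph.Adj c d)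
      (h2 : cellGraph.Adj c d'), (cellGraph.induce {x | x ∉ Insert.insert c R}).Reachable
        ⟨d, hmem hd h1.1.symm⟩ ⟨d', hmem hd' h2.1.symm⟩ := by
    intro d d' hd hd' h1 h2
    by_cases hdd : d = d'
    · subst hdd
      rfl
    obtain ⟨z, k, rfl, hk⟩ := exists_star_of_adj h1 h2 hdd
    have hfree : ∀ j, star z j ≠ star z k → star z j ∉ R := by
      -- The only neighbours of `c` at `z` are `d` and `d'`, both free. So the first alternative of
      -- `Removable` fails and the other five triangles at `z` are free.
      rcases h z (mem_vertices_iff_star.2 ⟨k, rfl⟩) with ⟨x, hx, hxa, hzx⟩ | h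
      · exfalso
        obtain ⟨j, rfl⟩ := mem_vertices_iff_star.1 hzx
        rcases star_adj_iff hxa with rfl | rfl <;> rcases hk with ⟨rfl, rfl⟩ | ⟨rfl, rfl⟩ <;>
          contradiction
      · exact h
    have hpath := star_path (S := {x | x ∉ Insert.insert (star z k) R}) (z := z) (k := k) fun j hj =>
      hmem (hfree j fun h => hj (star_injective z h)) fun h => hj (star_injective z h)
    rcases hk with ⟨rfl, rfl⟩ | ⟨rfl, rfl⟩
    · exact hpath
    · exact hpath.symm
  rw [NoHoles, SimpleGraph.connected_iff_exists_forall_reachable]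
  obtain ⟨a, ha⟩ := Infinite.exists_notMem_finset (Insert.insert c R)
  rw [Finset.mem_insert, not_or] at ha
  refine ⟨⟨a, hmem ha.2 ha.1⟩, ?_⟩
  rintro ⟨b, hb⟩
  have hb' : b ∉ R ∧ b ≠ c := by
    rw [Set.mem_ofPred_eq, Finset.mem_insert, not_or] at hb
    exact ⟨hb.2, hb.1⟩
  -- While the path sits at `c`, the invariant remembers a free neighbour of `c` already reached
  -- without `c`.
  have key := reachable_induce_induction (P := fun y =>
    (y = c → ∃ d, ∃ hd : d ∉ R, ∃ hdc : cellGraph.Adj c d,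
      (cellGraph.induce {x | x ∉ Insert.insert c R}).Reachable ⟨a, hmem ha.2 ha.1⟩
        ⟨d, hmem hd hdc.1.symm⟩) ∧
    ∀ hy : y ∉ R, ∀ hyc : y ≠ c,
      (cellGraph.induce {x | x ∉ Insert.insert c R}).Reachable ⟨a, hmem ha.2 ha.1⟩ ⟨y, hmem hy hyc⟩)
    (hR.preconnected ⟨a, ha.2⟩ ⟨b, hb'.1⟩) ⟨fun h => absurd h ha.1, fun _ _ => .refl _⟩ ?_
  · exact key.2 hb'.1 hb'.2
  · rintro x hx y hy hxy ⟨h1, h2⟩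
    by_cases hxc : x = c
    · subst hxc
      refine ⟨fun h => absurd h hxy.1.symm, fun _ hyc => ?_⟩
      obtain ⟨d, hd, hdc, hreach⟩ := h1 rfl
      exact hreach.trans (hnbr d y hd hy hdc hxy)
    · refine ⟨?_, fun _ hyc => (h2 hx hxc).trans (SimpleGraph.Adj.reachable ?_)⟩
      · rintro rfl
        exact ⟨x, hx, hxy.symm, h2 hx hxc⟩
      · exact hxy

theorem isIrreducible_of_local {T : Finset Tile} (h4 : 4 < T.card) (hN : NonOverlapping T)
    (hR : RunsOfThree T) (hadj : (adjGraph.induce (T : Set Tile)).Connected)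
    (hrem : ∀ t ∈ T, (touchGraph.induce ((T : Set Tile) \ {t})).Connected)
    (hH : NoHoles (covered T))
    (hsp : (adjGraph.induce {t | t ∈ T ∧ 0 < midCount T t}).Connected) : IsIrreducible T := by
  have hT : IsTredoku T := ⟨h4, hadj, hN, hrem, hR.exists_third hN, hR.run_length_le hN,
    noHoles_covered_iff.1 hH⟩
  refine ⟨hT, ?_⟩
  have : spine T = {t | t ∈ T ∧ 0 < midCount T t} := Set.ext fun t => hT.mem_spine_iff
  rwa [this]

/-- The tiles of the list can be added to the tiling one after the other, starting from the end of
the list, without creating holes. -/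
def Shellable : List Tile → Prop
  | [] => True
  | t :: l => ((Removable (covered l.toFinset) (upCell t.diag) ∧
      Removable (insert (upCell t.diag) (covered l.toFinset)) (downCell t.diag)) ∨
      (Removable (covered l.toFinset) (downCell t.diag) ∧
      Removable (insert (downCell t.diag) (covered l.toFinset)) (upCell t.diag))) ∧ Shellable l

instance Shellable.decidable : (l : List Tile) → Decidable (Shellable l)
  | [] => inferInstanceAs (Decidable True)
  | t :: l =>
    have := Shellable.decidable l
    inferInstanceAs (Decidable (((Removable (covered l.toFinset) (upCell t.diag) ∧
      Removable (insert (upCell t.diag) (covered l.toFinset)) (downCell t.diag)) ∨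
      (Removable (covered l.toFinset) (downCell t.diag) ∧
      Removable (insert (downCell t.diag) (covered l.toFinset)) (upCell t.diag))) ∧ Shellable l))

theorem covered_insert (t : Tile) (T : Finset Tile) :
    covered (insert t T) = insert (upCell t.diag) (insert (downCell t.diag) (covered T)) := by
  rw [covered, Finset.biUnion_insert, Tile.cells_eq]
  ext c
  simp [covered]

theorem noHoles_covered_insert {t : Tile} {T : Finset Tile} (hH : NoHoles (covered T))
    (hd : ∀ s ∈ T, Disjoint t.cells s.cells)
    (h : (Removable (covered T) (upCell t.diag) ∧
      Removable (insert (upCell t.diag) (covered T)) (downCell t.diag)) ∨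
      (Removable (covered T) (downCell t.diag) ∧
      Removable (insert (downCell t.diag) (covered T)) (upCell t.diag))) :
    NoHoles (covered (insert t T)) := by
  have hfree : ∀ c ∈ t.cells, c ∉ covered T := by
    intro c hc hcT
    obtain ⟨s, hs, hcs⟩ := mem_covered.1 hcT
    exact Finset.disjoint_left.1 (hd s hs) hc hcs
  have hup := hfree (upCell t.diag) (by simp [Tile.cells_eq])
  have hdown := hfree (downCell t.diag) (by simp [Tile.cells_eq])
  have hne := upCell_ne_downCell t.diag t.diag
  rw [covered_insert]
  rcases h with ⟨h1, h2⟩ | ⟨h1, h2⟩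
  · rw [Finset.insert_comm]
    exact (hH.insert hup h1).insert (by simp [hdown, hne.symm]) h2
  · exact (hH.insert hdown h1).insert (by simp [hup, hne]) h2

theorem Shellable.noHoles {l : List Tile} (h : Shellable l) (hN : NonOverlapping l.toFinset)
    (hnd : l.Nodup) : NoHoles (covered l.toFinset) := by
  induction l with
  | nil => exact noHoles_empty
  | cons t l ih =>
    rw [List.nodup_cons] at hnd
    rw [List.toFinset_cons] at hN ⊢
    refine noHoles_covered_insert (ih h.2 (fun a ha b hb => hN a (Finset.mem_insert_of_mem ha) b
      (Finset.mem_insert_of_mem hb)) hnd.2) (fun s hs => hN t (by simp) s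
      (Finset.mem_insert_of_mem hs) ?_) h.1
    rintro rfl
    exact hnd.1 (List.mem_toFinset.1 hs)

/-- A criterion for irreducibility that can be checked by computation. -/
def GoodList (l : List Tile) : Prop :=
  4 < l.length ∧ l.Nodup ∧ NonOverlapping l.toFinset ∧ RunsOfThree l.toFinset ∧
    Linked adjGraph.Adj l ∧ Linked touchGraph.Adj l.reverse ∧
    (∀ a ∈ l.head?, ∀ b ∈ l.getLast?, touchGraph.Adj a b) ∧ Shellable l ∧
    Linked adjGraph.Adj (l.filter fun t => 0 < midCount l.toFinset t) ∧
    (l.filter fun t => 0 < midCount l.toFinset t) ≠ []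

instance (l : List Tile) : Decidable (GoodList l) :=
  inferInstanceAs (Decidable (4 < l.length ∧ l.Nodup ∧ NonOverlapping l.toFinset ∧
    RunsOfThree l.toFinset ∧ Linked adjGraph.Adj l ∧ Linked touchGraph.Adj l.reverse ∧
    (∀ a ∈ l.head?, ∀ b ∈ l.getLast?, touchGraph.Adj a b) ∧ Shellable l ∧
    Linked adjGraph.Adj (l.filter fun t => 0 < midCount l.toFinset t) ∧
    (l.filter fun t => 0 < midCount l.toFinset t) ≠ []))

theorem Linked.imp {V : Type*} {r r' : V → V → Prop} (h : ∀ a b, r a b → r' a b) :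
    ∀ {l : List V}, Linked r l → Linked r' l
  | [], _ => trivial
  | _ :: _, ⟨h1, h2⟩ =>
    ⟨h1.imp id fun ⟨b, hb, hab⟩ => ⟨b, hb, h _ b hab⟩, h2.imp h⟩

theorem touchGraph_adj_of_adj {s t : Tile} (h : adjGraph.Adj s t) : touchGraph.Adj s t := by
  obtain ⟨hne, e, hs, ht⟩ := h
  exact ⟨hne, e.1, Tile.ends_subset hs (by simp [Edge.ends]), Tile.ends_subset ht (by simp [Edge.ends])⟩

theorem GoodList.isIrreducible {l : List Tile} (h : GoodList l) : IsIrreducible l.toFinset := by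
  obtain ⟨h4, hnd, hN, hR, hadj, htouch, hlast, hsh, hsp, hne⟩ := h
  have hset : (l.toFinset : Set Tile) = {x | x ∈ l} := by ext x; simp
  refine isIrreducible_of_local ?_ hN hR ?_ ?_ (hsh.noHoles hN hnd) ?_
  · rwa [List.toFinset_card_of_nodup hnd]
  · rw [hset]
    exact hadj.connected (by rintro rfl; simp at h4)
  · intro t ht
    rw [hset]
    exact connected_of_remove_of_linked (by omega) hnd
      (hadj.imp fun _ _ => touchGraph_adj_of_adj) htouch hlast (List.mem_toFinset.1 ht)
  · have := hsp.connected hne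
    have hset' : {x | x ∈ l.filter fun t => 0 < midCount l.toFinset t} =
        {t | t ∈ l.toFinset ∧ 0 < midCount l.toFinset t} := by
      ext t
      simp
    rwa [hset'] at this

theorem IsIrreducible.numRuns_eq {T : Finset Tile} (h : IsIrreducible T) :
    numRuns T = ∑ t ∈ T, midCount T t := Tredoku.numRuns_eq h.1.nonOverlapping h.1.runsOfThree

/-! ### Attaching a pair of tiles to a tip. -/

/-- The data of a tile `p` attached to `t` along `f`, whose other two corners are not corners of
tiles of `T`. -/
structure Attaches (T : Finset Tile) (t p : Tile) (f : Edge) : Prop where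
  mem : t ∈ T
  side : f ∈ t.sides
  side' : f ∈ p.sides
  fresh : ∀ x ∈ Edge.ends (p.opp f), ∀ s ∈ T, x ∉ s.vertices

namespace Attaches

variable {T : Finset Tile} {t p : Tile} {f : Edge}

theorem notMem (h : Attaches T t p f) : p ∉ T := fun hp =>
  h.fresh (p.opp f).1 (by simp [Edge.ends]) p hp
    (Tile.ends_subset (Tile.opp_mem h.side') (by simp [Edge.ends]))

/-- Each side of `p` other than `f` contains one of the far corners. -/
theorem exists_far {g : Edge} (h : f ∈ p.sides) (hg : g ∈ p.sides) (hgf : g ≠ f) :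
    ∃ x ∈ Edge.ends (p.opp f), x ∈ Edge.ends g := by
  by_cases hd : g.2 = f.2
  · rcases Tile.eq_or_eq_opp h hg hd with h' | rfl
    · exact absurd h' hgf
    · exact ⟨_, Finset.mem_insert_self _ _, Finset.mem_insert_self _ _⟩
  · exact Tile.exists_common_end (Tile.opp_mem h) hg (by rw [Tile.opp_snd h]; exact Ne.symm hd)

theorem eq_of_mem_sides (h : Attaches T t p f) {s : Tile} (hs : s ∈ T) {g : Edge}
    (hgp : g ∈ p.sides) (hgs : g ∈ s.sides) : g = f := by
  by_contra hne
  obtain ⟨x, hx, hxg⟩ := exists_far h.side' hgp hne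
  exact h.fresh x hx s hs (Tile.ends_subset hgs hxg)

/-- A triangle has three vertices, only two of which can lie on `f`. -/
theorem exists_far_of_cell {c : Cell} (h : f ∈ p.sides) (hc : c ∈ p.cells) :
    ∃ x ∈ Edge.ends (p.opp f), x ∈ c.vertices := by
  by_contra! hne
  have h1 : c.vertices ⊆ Edge.ends f := by
    intro v hv
    by_contra hvf
    have hvp : v ∈ p.vertices := Tile.mem_vertices_iff.2 ⟨c, hc, hv⟩
    exact hne v ((Tile.mem_ends_opp h hvp).2 hvf) hv
  have := Finset.card_le_card h1
  rw [Cell.card_vertices, Edge.card_ends] at this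
  omega

theorem disjoint_cells (h : Attaches T t p f) {s : Tile} (hs : s ∈ T) :
    Disjoint p.cells s.cells := by
  rw [Finset.disjoint_left]
  intro c hcp hcs
  obtain ⟨x, hx, hxc⟩ := exists_far_of_cell h.side' hcp
  exact h.fresh x hx s hs (Tile.mem_vertices_iff.2 ⟨c, hcs, hxc⟩)

theorem star_free (h : Attaches T t p f) {x : Point} (hx : x ∈ Edge.ends (p.opp f)) (k : Fin 6) :
    star x k ∉ covered T := by
  intro hc
  obtain ⟨s, hs, hcs⟩ := mem_covered.1 hc
  exact h.fresh x hx s hs (Tile.mem_vertices_iff.2 ⟨_, hcs, mem_vertices_iff_star.2 ⟨k, rfl⟩⟩)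

theorem noHoles (h : Attaches T t p f) (hH : NoHoles (covered T)) :
    NoHoles (covered (insert p T)) := by
  refine noHoles_covered_insert hH (fun s => h.disjoint_cells) ?_
  -- The triangle `c` of `p` at `f` is added before `c'`. At the ends of `f` it has the covered
  -- neighbour `d` across `f`; at a far corner nothing is covered yet. Then `c` plays the role of
  -- `d` for `c'`.
  have key : ∀ {c c' d : Cell}, c ∈ p.cells → c' ∈ p.cells → cellGraph.Adj c' c →
      Edge.ends f ⊆ c.vertices → d ∈ t.cells → cellGraph.Adj c d → Edge.ends f ⊆ d.vertices →
      Removable (covered T) c ∧ Removable (insert c (covered T)) c' := by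
    intro c c' d hc hc' hcc hfc hd hcd hfd
    refine ⟨fun z hz => ?_, fun z hz => ?_⟩
    · have hzp : z ∈ p.vertices := Tile.mem_vertices_iff.2 ⟨c, hc, hz⟩
      by_cases hzf : z ∈ Edge.ends f
      · exact Or.inl ⟨d, mem_covered.2 ⟨t, h.mem, hd⟩, hcd, hfd hzf⟩
      · exact Or.inr fun k _ => h.star_free ((Tile.mem_ends_opp h.side' hzp).2 hzf) k
    · have hzp : z ∈ p.vertices := Tile.mem_vertices_iff.2 ⟨c', hc', hz⟩
      by_cases hzc : z ∈ c.vertices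
      · exact Or.inl ⟨c, by simp, hcc, hzc⟩
      · have hzf : z ∉ Edge.ends f := fun hzf => hzc (hfc hzf)
        refine Or.inr fun k _ => ?_
        rw [Finset.mem_insert, not_or]
        refine ⟨?_, h.star_free ((Tile.mem_ends_opp h.side' hzp).2 hzf) k⟩
        rintro rfl
        exact hzc (mem_vertices_iff_star.2 ⟨k, rfl⟩)
  have hup : upCell p.diag ∈ p.cells := by simp [Tile.cells_eq]
  have hdown : downCell p.diag ∈ p.cells := by simp [Tile.cells_eq]
  have hdisj := Finset.disjoint_left.1 (h.disjoint_cells h.mem)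
  have hadj := cellGraph_adj_up_down p.diag
  have hadj' := cellGraph_adj_up_down f
  rcases Tile.mem_sides_iff.1 h.side' with ⟨h1, -⟩ | ⟨-, h1⟩
  · have h2 := (Tile.up_or_down_mem h.side).resolve_left (hdisj h1)
    have h3 := Tile.upCell_mem.1 h1
    refine Or.inl (key (d := downCell f) hup hdown hadj.symm ?_ h2 (h3 ▸ hadj')
      (ends_subset_downCell f))
    exact h3 ▸ ends_subset_upCell f
  · have h2 := (Tile.up_or_down_mem h.side).resolve_right (hdisj h1)
    have h3 := Tile.downCell_mem.1 h1
    refine Or.inr (key (d := upCell f) hdown hup hadj ?_ h2 (h3 ▸ hadj'.symm)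
      (ends_subset_upCell f))
    exact h3 ▸ ends_subset_downCell f

end Attaches

/-- Two tiles `p` and `q` attached to opposite sides of `t`, where `t` is adjacent to another tile of
`T` along `e` only. -/
structure AttachesPair (T : Finset Tile) (t p q : Tile) (e f : Edge) : Prop where
  left : Attaches T t p f
  right : Attaches T t q (t.opp f)
  side : e ∈ t.sides
  not_parallel : e.2 ≠ f.2
  covered : Covered T t e
  not_covered_opp : ¬ Covered T t (t.opp e)
  not_covered_left : ¬ Covered T t f
  not_covered_right : ¬ Covered T t (t.opp f)
  fresh_left : ∀ x ∈ Edge.ends (p.opp f), x ∉ q.vertices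
  fresh_right : ∀ x ∈ Edge.ends (q.opp (t.opp f)), x ∉ p.vertices

namespace AttachesPair

variable {T : Finset Tile} {t p q : Tile} {e f : Edge}

theorem symm (h : AttachesPair T t p q e f) : AttachesPair T t q p e (t.opp f) := by
  have hff := Tile.opp_opp h.left.side
  refine ⟨h.right, ?_, h.side, ?_, h.covered, h.not_covered_opp, h.not_covered_right, ?_,
    h.fresh_right, ?_⟩
  · rw [hff]
    exact h.left
  · rw [Tile.opp_snd h.left.side]
    exact h.not_parallel
  · rw [hff]
    exact h.not_covered_left
  · rw [hff]
    exact h.fresh_left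

theorem right_insert (h : AttachesPair T t p q e f) : Attaches (insert p T) t q (t.opp f) := by
  refine ⟨Finset.mem_insert_of_mem h.left.mem, h.right.side, h.right.side', fun x hx s hs => ?_⟩
  rcases Finset.mem_insert.1 hs with rfl | hs
  · exact h.fresh_right x hx
  · exact h.right.fresh x hx s hs

theorem notMem_right (h : AttachesPair T t p q e f) : q ∉ insert p T := h.right_insert.notMem

theorem ne (h : AttachesPair T t p q e f) : q ≠ p := fun hqp =>
  h.notMem_right (hqp ▸ Finset.mem_insert_self _ _)

theorem ne_left (h : AttachesPair T t p q e f) {s : Tile} (hs : s ∈ T) : s ≠ p := fun hsp =>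
  h.left.notMem (hsp ▸ hs)

theorem mem_insert {s : Tile} : s ∈ insert q (insert p T) ↔ s = q ∨ s = p ∨ s ∈ T := by
  simp

theorem eq_of_left (h : AttachesPair T t p q e f) {s : Tile} (hs : s ∈ T) {g : Edge}
    (hgp : g ∈ p.sides) (hgs : g ∈ s.sides) : g = f ∧ s = t := by
  have hg := h.left.eq_of_mem_sides hs hgp hgs
  subst hg
  refine ⟨rfl, ?_⟩
  by_contra hst
  exact h.not_covered_left ⟨s, hs, hst, hgs⟩

theorem not_common (h : AttachesPair T t p q e f) {g : Edge} (hgp : g ∈ p.sides) :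
    g ∉ q.sides := fun hgq => by
  have h1 := h.right_insert.eq_of_mem_sides (Finset.mem_insert_self _ _) hgq hgp
  obtain ⟨x, hx, hxg⟩ := Attaches.exists_far h.left.side' hgp
    (h1 ▸ Tile.opp_ne h.left.side)
  exact h.fresh_left x hx (Tile.ends_subset hgq hxg)

theorem nonOverlapping (h : AttachesPair T t p q e f) (hN : NonOverlapping T) :
    NonOverlapping (insert q (insert p T)) := by
  have h1 : ∀ s ∈ T, Disjoint p.cells s.cells := fun s => h.left.disjoint_cells
  have h2 : ∀ s ∈ insert p T, Disjoint q.cells s.cells := fun s => h.right_insert.disjoint_cells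
  have h3 : NonOverlapping (insert p T) := by
    intro a ha b hb hab
    rcases Finset.mem_insert.1 ha with rfl | ha' <;> rcases Finset.mem_insert.1 hb with rfl | hb'
    · exact absurd rfl hab
    · exact h1 b hb'
    · exact (h1 a ha').symm
    · exact hN a ha' b hb' hab
  intro a ha b hb hab
  rcases Finset.mem_insert.1 ha with rfl | ha' <;> rcases Finset.mem_insert.1 hb with rfl | hb'
  · exact absurd rfl hab
  · exact h2 b hb'
  · exact (h2 a ha').symm
  · exact h3 a ha' b hb' hab

theorem noHoles (h : AttachesPair T t p q e f) (hH : NoHoles (Tredoku.covered T)) :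
    NoHoles (Tredoku.covered (insert q (insert p T))) :=
  h.right_insert.noHoles (h.left.noHoles hH)

theorem covered_old_iff (h : AttachesPair T t p q e f) {s : Tile} (hs : s ∈ T) {g : Edge}
    (hg : g ∈ s.sides) : Covered (insert q (insert p T)) s g ↔
      Covered T s g ∨ (s = t ∧ (g = f ∨ g = t.opp f)) := by
  constructor
  · rintro ⟨r, hr, hrs, hgr⟩
    rcases mem_insert.1 hr with rfl | rfl | hr
    · obtain ⟨h1, h2⟩ := h.symm.eq_of_left hs hgr hg
      exact Or.inr ⟨h2, Or.inr h1⟩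
    · obtain ⟨h1, h2⟩ := h.eq_of_left hs hgr hg
      exact Or.inr ⟨h2, Or.inl h1⟩
    · exact Or.inl ⟨r, hr, hrs, hgr⟩
  · rintro (⟨r, hr, hrs, hgr⟩ | ⟨rfl, rfl | rfl⟩)
    · exact ⟨r, by simp [hr], hrs, hgr⟩
    · exact ⟨p, by simp, (h.ne_left hs).symm, h.left.side'⟩
    · exact ⟨q, by simp, (h.symm.ne_left hs).symm, h.right.side'⟩

theorem covered_left_iff (h : AttachesPair T t p q e f) {g : Edge} (hg : g ∈ p.sides) :
    Covered (insert q (insert p T)) p g ↔ g = f := by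
  constructor
  · rintro ⟨r, hr, hrs, hgr⟩
    rcases mem_insert.1 hr with rfl | rfl | hr
    · exact absurd hgr (h.not_common hg)
    · exact absurd rfl hrs
    · exact (h.eq_of_left hr hg hgr).1
  · rintro rfl
    exact ⟨t, by simp [h.left.mem], h.ne_left h.left.mem, h.left.side⟩

theorem insert_comm (T : Finset Tile) (p q : Tile) :
    insert q (insert p T) = insert p (insert q T) := Finset.insert_comm q p T

/-- The only new run is `p`, `t`, `q` with middle `t`. -/
theorem runsOfThree (h : AttachesPair T t p q e f) (hR : RunsOfThree T) :
    RunsOfThree (insert q (insert p T)) := by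
  have hleft : ∀ {p q : Tile} {f : Edge}, AttachesPair T t p q e f →
      ¬ Covered (insert q (insert p T)) p (p.opp f) ∧
      Covered (insert q (insert p T)) t (t.opp f) := by
    intro p q f h
    refine ⟨fun hc => ?_, ?_⟩
    · exact Tile.opp_ne h.left.side'
        ((h.covered_left_iff (Tile.opp_mem h.left.side')).1 hc)
    · exact (h.covered_old_iff h.left.mem h.right.side).2 (Or.inr ⟨rfl, Or.inr rfl⟩)
  have hp := hleft h
  have hq := hleft h.symm
  rw [insert_comm, Tile.opp_opp h.left.side] at hq
  intro a ha b hb hab g hga hgb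
  rcases mem_insert.1 ha with rfl | rfl | ha' <;> rcases mem_insert.1 hb with rfl | rfl | hb'
  · exact absurd rfl hab
  · exact absurd hga (h.not_common hgb)
  · obtain ⟨rfl, rfl⟩ := h.symm.eq_of_left hb' hga hgb
    rw [Tile.opp_opp h.left.side]
    simp [hq]
  · exact absurd hgb (h.not_common hga)
  · exact absurd rfl hab
  · obtain ⟨rfl, rfl⟩ := h.eq_of_left hb' hga hgb
    simp [hp]
  · obtain ⟨rfl, rfl⟩ := h.symm.eq_of_left ha' hgb hga
    rw [Tile.opp_opp h.left.side]
    simp [hq]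
  · obtain ⟨rfl, rfl⟩ := h.eq_of_left ha' hgb hga
    simp [hp]
  -- Old runs are not prolonged: a newly shared side of `t` opposite to an old shared side would
  -- make `f` or its opposite an old shared side.
  · have key : ∀ {a b : Tile}, a ∈ T → b ∈ T → a ≠ b → g ∈ a.sides → g ∈ b.sides →
        (Covered (insert q (insert p T)) a (a.opp g) ↔ Covered T a (a.opp g)) := by
      intro a b ha hb hab hga hgb
      rw [h.covered_old_iff ha (Tile.opp_mem hga), or_iff_left_iff_imp]
      rintro ⟨rfl, hg | hg⟩
      · exfalso
        apply h.not_covered_right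
        rw [← hg, Tile.opp_opp hga]
        exact ⟨b, hb, hab.symm, hgb⟩
      · exfalso
        apply h.not_covered_left
        rw [← Tile.opp_opp h.left.side, ← hg, Tile.opp_opp hga]
        exact ⟨b, hb, hab.symm, hgb⟩
    rw [key ha' hb' hab hga hgb, key hb' ha' hab.symm hgb hga]
    exact hR a ha' b hb' hab g hga hgb

theorem adj_left (h : AttachesPair T t p q e f) : adjGraph.Adj p t :=
  ⟨(h.ne_left h.left.mem).symm, f, h.left.side', h.left.side⟩

/-- The tile `p` touches the tile beyond `e`. -/
theorem touch_left (h : AttachesPair T t p q e f) {m : Tile} (hm : m ∈ T) (hem : e ∈ m.sides) :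
    touchGraph.Adj p m := by
  obtain ⟨v, hve, hvf⟩ := Tile.exists_common_end h.side h.left.side h.not_parallel
  exact ⟨(h.ne_left hm).symm, v, Tile.ends_subset h.left.side' hvf, Tile.ends_subset hem hve⟩

theorem connected_of_remove (h : AttachesPair T t p q e f)
    (hrem : ∀ s ∈ T, (touchGraph.induce ((T : Set Tile) \ {s})).Connected)
    (hconn : (touchGraph.induce (T : Set Tile)).Connected) :
    ∀ s ∈ insert q (insert p T),
      (touchGraph.induce (((insert q (insert p T) : Finset Tile) : Set Tile) \ {s})).Connected := by
  have hpT := h.left.notMem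
  have hqT := h.right.notMem
  have hqp := h.ne
  have hpt := touchGraph_adj_of_adj h.adj_left
  have hqt := touchGraph_adj_of_adj h.symm.adj_left
  have htT := h.left.mem
  obtain ⟨m, hm, hmt, hem⟩ := h.covered
  intro s hs
  rcases mem_insert.1 hs with rfl | rfl | hs
  · have h1 : (((insert s (insert p T) : Finset Tile) : Set Tile) \ {s}) = insert p (T : Set Tile) := by
      ext x
      simp only [Finset.coe_insert, Set.mem_sdiff, Set.mem_insert_iff, Set.mem_singleton_iff,
        Finset.mem_coe]
      grind
    rw [h1]
    exact induce_insert_connected hconn htT hpt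
  · have h1 : (((insert q (insert s T) : Finset Tile) : Set Tile) \ {s}) = insert q (T : Set Tile) := by
      ext x
      simp only [Finset.coe_insert, Set.mem_sdiff, Set.mem_insert_iff, Set.mem_singleton_iff,
        Finset.mem_coe]
      grind
    rw [h1]
    exact induce_insert_connected hconn htT hqt
  · have h1 : (((insert q (insert p T) : Finset Tile) : Set Tile) \ {s}) =
        insert q (insert p ((T : Set Tile) \ {s})) := by
      ext x
      simp only [Finset.coe_insert, Set.mem_sdiff, Set.mem_insert_iff, Set.mem_singleton_iff,
        Finset.mem_coe]
      grind
    rw [h1]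
    -- When `t` is removed, `p` and `q` still touch the tile `m` beyond `e`, at the two ends of `e`.
    by_cases hst : s = t
    · subst hst
      have hmS : m ∈ (T : Set Tile) \ {s} := ⟨hm, hmt⟩
      exact induce_insert_connected (induce_insert_connected (hrem s hs) hmS (h.touch_left hm hem))
        (Set.mem_insert_of_mem _ hmS) (h.symm.touch_left hm hem)
    · have htS : t ∈ (T : Set Tile) \ {s} := ⟨htT, fun h => hst h.symm⟩
      exact induce_insert_connected (induce_insert_connected (hrem s hs) htS hpt)
        (Set.mem_insert_of_mem _ htS) hqt

theorem midSides_of_ne (h : AttachesPair T t p q e f) {s : Tile} (hs : s ∈ T) (hst : s ≠ t) :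
    midSides (insert q (insert p T)) s = midSides T s := by
  ext g
  simp only [mem_midSides]
  refine and_congr_right fun hg => ?_
  rw [h.covered_old_iff hs hg, h.covered_old_iff hs (Tile.opp_mem hg)]
  simp [hst]

theorem midCount_left (h : AttachesPair T t p q e f) :
    midCount (insert q (insert p T)) p = 0 := by
  rw [midCount, Finset.card_eq_zero, Finset.image_eq_empty, Finset.eq_empty_iff_forall_notMem]
  intro g hg
  obtain ⟨h1, h2, h3⟩ := mem_midSides.1 hg
  rw [h.covered_left_iff h1] at h2
  rw [h.covered_left_iff (Tile.opp_mem h1), ← h2] at h3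
  exact Tile.opp_ne h1 h3

theorem midCount_right (h : AttachesPair T t p q e f) :
    midCount (insert q (insert p T)) q = 0 := by
  rw [insert_comm]
  exact h.symm.midCount_left

theorem eq_of_covered (h : AttachesPair T t p q e f) {g : Edge} (hg : g ∈ t.sides)
    (hc : Covered T t g) : g = e := by
  by_cases hge : g.2 = e.2
  · rcases Tile.eq_or_eq_opp h.side hg hge with h1 | rfl
    · exact h1
    · exact absurd hc h.not_covered_opp
  · have h1 : g.2 = f.2 := by
      have h2 := t.exists_sides_eq
      obtain ⟨a, b, hset, hab, ha, hb⟩ := h2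
      have key : ∀ c ∈ t.sides, c.2 = a.2 ∨ c.2 = b.2 := by
        intro c hc
        rw [hset] at hc
        simp only [Finset.mem_insert, Finset.mem_singleton] at hc
        rcases hc with rfl | rfl | rfl | rfl
        · exact Or.inl rfl
        · exact Or.inl (Tile.opp_snd ha)
        · exact Or.inr rfl
        · exact Or.inr (Tile.opp_snd hb)
      have h3 := h.not_parallel
      rcases key g hg with h4 | h4 <;> rcases key e h.side with h5 | h5 <;>
        rcases key f h.left.side with h6 | h6 <;> simp_all
    rcases Tile.eq_or_eq_opp h.left.side hg h1 with rfl | rfl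
    · exact absurd hc h.not_covered_left
    · exact absurd hc h.not_covered_right

theorem midCount_tip_old (h : AttachesPair T t p q e f) : midCount T t = 0 := by
  rw [midCount, Finset.card_eq_zero, Finset.image_eq_empty, Finset.eq_empty_iff_forall_notMem]
  intro g hg
  obtain ⟨h1, h2, h3⟩ := mem_midSides.1 hg
  have h4 := h.eq_of_covered h1 h2
  have h5 := h.eq_of_covered (Tile.opp_mem h1) h3
  exact Tile.opp_ne h1 (h5.trans h4.symm)

theorem midCount_tip (h : AttachesPair T t p q e f) :
    midCount (insert q (insert p T)) t = 1 := by
  have htT := h.left.mem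
  have h1 : (midSides (insert q (insert p T)) t).image Prod.snd = {f.2} := by
    rw [Finset.eq_singleton_iff_unique_mem]
    constructor
    · refine Finset.mem_image.2 ⟨f, mem_midSides.2 ⟨h.left.side, ?_, ?_⟩, rfl⟩
      · exact (h.covered_old_iff htT h.left.side).2 (Or.inr ⟨rfl, Or.inl rfl⟩)
      · exact (h.covered_old_iff htT h.right.side).2 (Or.inr ⟨rfl, Or.inr rfl⟩)
    · intro i hi
      obtain ⟨g, hg, rfl⟩ := Finset.mem_image.1 hi
      obtain ⟨h1, h2, h3⟩ := mem_midSides.1 hg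
      rw [h.covered_old_iff htT h1] at h2
      rw [h.covered_old_iff htT (Tile.opp_mem h1)] at h3
      have h4 := Tile.opp_snd h.left.side
      rcases h2 with h2 | ⟨-, rfl | rfl⟩
      · rcases h3 with h3 | ⟨-, h3 | h3⟩
        · exact absurd ((h.eq_of_covered (Tile.opp_mem h1) h3).trans (h.eq_of_covered h1 h2).symm)
            (Tile.opp_ne h1)
        · rw [← Tile.opp_snd h1, h3]
        · rw [← Tile.opp_snd h1, h3, h4]
      · rfl
      · exact h4
  rw [midCount, h1, Finset.card_singleton]

theorem sum_midCount (h : AttachesPair T t p q e f) :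
    ∑ s ∈ insert q (insert p T), midCount (insert q (insert p T)) s = ∑ s ∈ T, midCount T s + 1 := by
  rw [Finset.sum_insert h.notMem_right, Finset.sum_insert h.left.notMem, h.midCount_left,
    h.midCount_right, ← Finset.add_sum_erase _ _ h.left.mem, ← Finset.add_sum_erase _ _ h.left.mem,
    h.midCount_tip, h.midCount_tip_old]
  have : ∀ s ∈ T.erase t, midCount (insert q (insert p T)) s = midCount T s := fun s hs => by
    rw [Finset.mem_erase] at hs
    rw [midCount, h.midSides_of_ne hs.2 hs.1]
    rfl
  rw [Finset.sum_congr rfl this]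
  ring

theorem card (h : AttachesPair T t p q e f) : (insert q (insert p T)).card = T.card + 2 := by
  rw [Finset.card_insert_of_notMem h.notMem_right, Finset.card_insert_of_notMem h.left.notMem]

theorem isIrreducible (h : AttachesPair T t p q e f) (hT : IsIrreducible T) :
    IsIrreducible (insert q (insert p T)) := by
  have hN := hT.1.nonOverlapping
  have hR := hT.1.runsOfThree
  have htT := h.left.mem
  have hcoe : ((insert q (insert p T) : Finset Tile) : Set Tile) = insert q (insert p (T : Set Tile)) := by
    simp
  refine isIrreducible_of_local ?_ (h.nonOverlapping hN) (h.runsOfThree hR) ?_ ?_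
    (h.noHoles hT.1.noHoles) ?_
  · have := hT.1.four_lt_card
    rw [h.card]
    omega
  · rw [hcoe]
    exact induce_insert_connected (induce_insert_connected hT.1.edge_connected htT h.adj_left)
      (Set.mem_insert_of_mem _ htT) h.symm.adj_left
  · refine h.connected_of_remove hT.1.connected_of_remove ?_
    exact hT.1.edge_connected.mono fun a b hab => touchGraph_adj_of_adj hab
  · obtain ⟨m, hm, hmt, hem⟩ := h.covered
    -- The spine gains exactly `t`, which is adjacent to `m`. The latter is a middle, because the
    -- run through `e` ends at `t`.
    have hsp : {s | s ∈ insert q (insert p T) ∧ 0 < midCount (insert q (insert p T)) s} =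
        insert t (spine T) := by
      ext s
      simp only [Set.mem_ofPred_eq, Set.mem_insert_iff, hT.1.mem_spine_iff]
      constructor
      · rintro ⟨hs, hs0⟩
        rcases mem_insert.1 hs with rfl | rfl | hs
        · rw [h.midCount_right] at hs0
          exact absurd hs0 (lt_irrefl 0)
        · rw [h.midCount_left] at hs0
          exact absurd hs0 (lt_irrefl 0)
        · by_cases hst : s = t
          · exact Or.inl hst
          · rw [midCount, h.midSides_of_ne hs hst] at hs0
            exact Or.inr ⟨hs, hs0⟩
      · rintro (rfl | ⟨hs, hs0⟩)
        · exact ⟨by simp [htT], by rw [h.midCount_tip]; exact one_pos⟩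
        · refine ⟨by simp [hs], ?_⟩
          have hst : s ≠ t := by
            rintro rfl
            rw [h.midCount_tip_old] at hs0
            exact absurd hs0 (lt_irrefl 0)
          rwa [midCount, h.midSides_of_ne hs hst]
    rw [hsp]
    have hms : m ∈ spine T := by
      refine hT.1.mem_spine_iff.2 ⟨hm, midCount_pos_of_mem (e := e) ?_⟩
      rcases hR.mem_endSides_or hm htT hmt hem h.side with h1 | h1
      · exact absurd (mem_midSides.1 h1.2).2.2 h.not_covered_opp
      · exact h1.1
    exact induce_insert_connected hT.2 hms ⟨hmt.symm, e, h.side, hem⟩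

theorem numRuns (h : AttachesPair T t p q e f) (hT : IsIrreducible T) :
    numRuns (insert q (insert p T)) = numRuns T + 1 := by
  rw [(h.isIrreducible hT).numRuns_eq, hT.numRuns_eq, h.sum_midCount]

end AttachesPair

/-! ### The staircase. -/

/-- The forward slanting tile with base `b` is a tile of `T` at which another pair of tiles can be
attached. It is adjacent to another tile along one side, of direction `i`, and all corners of tiles of
`T` that are not below `b` are known. -/
def ChainTip (T : Finset Tile) (i j : Fin 3) (b : Point) : Prop :=
  ⟨.F, b⟩ ∈ T ∧ Covered T ⟨.F, b⟩ (b, i) ∧ ¬ Covered T ⟨.F, b⟩ (b + dir j, i) ∧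
    ¬ Covered T ⟨.F, b⟩ (b, j) ∧ ¬ Covered T ⟨.F, b⟩ (b + dir i, j) ∧
    ∀ s ∈ T, ∀ v ∈ s.vertices, b.1 + b.2 ≤ v.1 + v.2 →
      v ∈ [b, b + (dir i - dir j), b + (dir i - dir j) + (dir i - dir j), b + dir i, b + dir j,
        b + dir i + dir j]

instance (T : Finset Tile) (i j : Fin 3) (b : Point) : Decidable (ChainTip T i j b) := by
  unfold ChainTip
  infer_instance

/-- The forward tile above the old tip becomes the new tip, and its partner hangs from the lower
side of the old tip. The staircase thus turns alternately up and right, so `i` and `j` change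
places. The second and third points listed in `ChainTip` are the only corners of the partner not
below the new tip; all other points at or above the level of the tip are free for the next pair,
apart from the corners of the tip. -/
theorem ChainTip.exists_next_up {T : Finset Tile} (hT : IsIrreducible T) {b : Point}
    (h : ChainTip T 1 0 b) : ∃ T', IsIrreducible T' ∧ ChainTip T' 0 1 (b + dir 1) ∧
      numRuns T' = numRuns T + 1 ∧ T'.card = T.card + 2 := by
  obtain ⟨x, y⟩ := b
  obtain ⟨hmem, hc, hn₁, hn₂, hn₃, hv⟩ := h
  simp only [dir, Fin.isValue, Matrix.cons_val_zero, Matrix.cons_val_one, Prod.mk_add_mk, add_zero,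
    Prod.mk_sub_mk, List.mem_cons, List.not_mem_nil, or_false,
    Prod.forall, Prod.mk.injEq] at *
  have hopp : (⟨.F, (x, y)⟩ : Tile).opp ((x, y), 1) = ((x + 1, y), 1) := by
    simp [Tile.opp, Kind.first, Kind.second, dir]
  have hopp' : (⟨.F, (x, y)⟩ : Tile).opp ((x, y + 1), 0) = ((x, y), 0) := by
    simp [Tile.opp, Kind.first, Kind.second, dir]
  have hoppp : (⟨.F, (x, y + 1)⟩ : Tile).opp ((x, y + 1), 0) = ((x, y + 2), 0) := by
    simp [Tile.opp, Kind.first, Kind.second, dir]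
    ring
  have hoppq : (⟨.B, (x + 1, y - 1)⟩ : Tile).opp ((x, y), 0) = ((x + 1, y - 1), 0) := by
    simp [Tile.opp, Kind.first, Kind.second, dir]
  have hpair : AttachesPair T ⟨.F, (x, y)⟩ ⟨.F, (x, y + 1)⟩ ⟨.B, (x + 1, y - 1)⟩ ((x, y), 1)
      ((x, y + 1), 0) := by
    refine ⟨⟨hmem, ?_, ?_, ?_⟩, ⟨hmem, ?_, ?_, ?_⟩, ?_, by simp, hc, ?_, hn₃, ?_, ?_, ?_⟩
    · simp [Tile.sides, Kind.first, Kind.second, dir]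
    · simp [Tile.sides, Kind.first, Kind.second, dir]
    · rw [hoppp]
      intro v hve s hs hvs
      simp only [Edge.ends, dir, Finset.mem_insert, Finset.mem_singleton] at hve
      rcases hve with rfl | rfl
      · have := hv s hs _ _ hvs
        simp at this
        omega
      · have := hv s hs _ _ hvs
        simp at this
        omega
    · simp [hopp', Tile.sides, Kind.first, Kind.second, dir]
    · simp [hopp', Tile.sides, Kind.first, Kind.second, dir]
    · rw [hopp', hoppq]
      intro v hve s hs hvs
      simp only [Edge.ends, dir, Finset.mem_insert, Finset.mem_singleton] at hve
      rcases hve with rfl | rfl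
      · have := hv s hs _ _ hvs
        simp at this
        omega
      · have := hv s hs _ _ hvs
        simp at this
        omega
    · simp [Tile.sides, Kind.first, Kind.second, dir]
    · rwa [hopp]
    · rwa [hopp']
    · rw [hoppp]
      intro v hve
      simp only [Edge.ends, dir, Finset.mem_insert, Finset.mem_singleton] at hve
      rcases hve with rfl | rfl <;>
        simp [Tile.vertices, Kind.first, Kind.second, dir] <;> omega
    · rw [hopp', hoppq]
      intro v hve
      simp only [Edge.ends, dir, Finset.mem_insert, Finset.mem_singleton] at hve
      rcases hve with rfl | rfl <;>
        simp [Tile.vertices, Kind.first, Kind.second, dir] <;> omega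
  refine ⟨_, hpair.isIrreducible hT, ⟨by simp, ?_, ?_, ?_, ?_, ?_⟩, hpair.numRuns hT, hpair.card⟩
  · rw [hpair.covered_left_iff]
    simp [Tile.sides, Kind.first, Kind.second, dir]
  · rw [hpair.covered_left_iff]
    · simp [dir]
    · simp [Tile.sides, Kind.first, Kind.second, dir]
  · rw [hpair.covered_left_iff]
    · simp
    · simp [Tile.sides, Kind.first, Kind.second, dir]
  · rw [hpair.covered_left_iff]
    · simp [dir]
    · simp [Tile.sides, Kind.first, Kind.second, dir]
  · rintro s hs ⟨v, w⟩ hvs hle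
    rcases AttachesPair.mem_insert.1 hs with rfl | rfl | hs
    · simp [Tile.vertices, Kind.first, Kind.second, dir] at hvs hle ⊢
      omega
    · simp [Tile.vertices, Kind.first, Kind.second, dir] at hvs hle ⊢
      omega
    · have := hv s hs v w hvs
      simp [dir] at hle ⊢
      omega

theorem ChainTip.exists_next_right {T : Finset Tile} (hT : IsIrreducible T) {b : Point}
    (h : ChainTip T 0 1 b) : ∃ T', IsIrreducible T' ∧ ChainTip T' 1 0 (b + dir 0) ∧
      numRuns T' = numRuns T + 1 ∧ T'.card = T.card + 2 := by
  obtain ⟨x, y⟩ := b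
  obtain ⟨hmem, hc, hn₁, hn₂, hn₃, hv⟩ := h
  simp only [dir, Fin.isValue, Matrix.cons_val_zero, Matrix.cons_val_one, Prod.mk_add_mk, add_zero,
    Prod.mk_sub_mk, List.mem_cons, List.not_mem_nil, or_false,
    Prod.forall, Prod.mk.injEq] at *
  have hopp : (⟨.F, (x, y)⟩ : Tile).opp ((x, y), 0) = ((x, y + 1), 0) := by
    simp [Tile.opp, Kind.first, Kind.second, dir]
  have hopp' : (⟨.F, (x, y)⟩ : Tile).opp ((x + 1, y), 1) = ((x, y), 1) := by
    simp [Tile.opp, Kind.first, Kind.second, dir]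
  have hoppp : (⟨.F, (x + 1, y)⟩ : Tile).opp ((x + 1, y), 1) = ((x + 2, y), 1) := by
    simp [Tile.opp, Kind.first, Kind.second, dir]
    ring
  have hoppq : (⟨.D, (x, y)⟩ : Tile).opp ((x, y), 1) = ((x - 1, y + 1), 1) := by
    simp [Tile.opp, Kind.first, Kind.second, dir]
    ring
  have hpair : AttachesPair T ⟨.F, (x, y)⟩ ⟨.F, (x + 1, y)⟩ ⟨.D, (x, y)⟩ ((x, y), 0)
      ((x + 1, y), 1) := by
    refine ⟨⟨hmem, ?_, ?_, ?_⟩, ⟨hmem, ?_, ?_, ?_⟩, ?_, by simp, hc, ?_, hn₃, ?_, ?_, ?_⟩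
    · simp [Tile.sides, Kind.first, Kind.second, dir]
    · simp [Tile.sides, Kind.first, Kind.second, dir]
    · rw [hoppp]
      intro v hve s hs hvs
      simp only [Edge.ends, dir, Finset.mem_insert, Finset.mem_singleton] at hve
      rcases hve with rfl | rfl
      · have := hv s hs _ _ hvs
        simp at this
        omega
      · have := hv s hs _ _ hvs
        simp at this
        omega
    · simp [hopp', Tile.sides, Kind.first, Kind.second, dir]
    · simp [hopp', Tile.sides, Kind.first, Kind.second, dir]
    · rw [hopp', hoppq]
      intro v hve s hs hvs
      simp only [Edge.ends, dir, Finset.mem_insert, Finset.mem_singleton] at hve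
      rcases hve with rfl | rfl
      · have := hv s hs _ _ hvs
        simp at this
        omega
      · have := hv s hs _ _ hvs
        simp at this
        omega
    · simp [Tile.sides, Kind.first, Kind.second, dir]
    · rwa [hopp]
    · rwa [hopp']
    · rw [hoppp]
      intro v hve
      simp only [Edge.ends, dir, Finset.mem_insert, Finset.mem_singleton] at hve
      rcases hve with rfl | rfl <;>
        simp [Tile.vertices, Kind.first, Kind.second, dir]
    · rw [hopp', hoppq]
      intro v hve
      simp only [Edge.ends, dir, Finset.mem_insert, Finset.mem_singleton] at hve
      rcases hve with rfl | rfl <;>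
        simp [Tile.vertices, Kind.first, Kind.second, dir] <;> omega
  refine ⟨_, hpair.isIrreducible hT, ⟨by simp, ?_, ?_, ?_, ?_, ?_⟩, hpair.numRuns hT, hpair.card⟩
  · rw [hpair.covered_left_iff]
    simp [Tile.sides, Kind.first, Kind.second, dir]
  · rw [hpair.covered_left_iff]
    · simp [dir]
    · simp [Tile.sides, Kind.first, Kind.second, dir]
  · rw [hpair.covered_left_iff]
    · simp
    · simp [Tile.sides, Kind.first, Kind.second, dir]
  · rw [hpair.covered_left_iff]
    · simp [dir]
    · simp [Tile.sides, Kind.first, Kind.second, dir]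
  · rintro s hs ⟨v, w⟩ hvs hle
    rcases AttachesPair.mem_insert.1 hs with rfl | rfl | hs
    · simp [Tile.vertices, Kind.first, Kind.second, dir] at hvs hle ⊢
      omega
    · simp [Tile.vertices, Kind.first, Kind.second, dir] at hvs hle ⊢
      omega
    · have := hv s hs v w hvs
      simp [dir] at hle ⊢
      omega

theorem exists_longer {T : Finset Tile} (hT : IsIrreducible T) {b : Point}
    (h : ChainTip T 0 1 b ∨ ChainTip T 1 0 b) (n : ℕ) : ∃ T', IsIrreducible T' ∧
      numRuns T' = numRuns T + n ∧ T'.card = T.card + 2 * n := by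
  suffices ∃ T' b', IsIrreducible T' ∧ (ChainTip T' 0 1 b' ∨ ChainTip T' 1 0 b') ∧
      numRuns T' = numRuns T + n ∧ T'.card = T.card + 2 * n by
    obtain ⟨T', b', h1, -, h2, h3⟩ := this
    exact ⟨T', h1, h2, h3⟩
  induction n with
  | zero => exact ⟨T, b, hT, h, rfl, rfl⟩
  | succ n ih =>
    obtain ⟨T', b', h1, h2 | h2, h3, h4⟩ := ih
    · obtain ⟨T'', a1, a2, a3, a4⟩ := h2.exists_next_right h1
      exact ⟨T'', _, a1, Or.inr a2, by omega, by omega⟩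
    · obtain ⟨T'', a1, a2, a3, a4⟩ := h2.exists_next_up h1
      exact ⟨T'', _, a1, Or.inl a2, by omega, by omega⟩

/-! ### Explicit tilings. -/

/-- The tiles of the list form an irreducible tiling with `r` runs. -/
theorem GoodList.exists_tiling {l : List Tile} (h : GoodList l) {r : ℕ}
    (hr : ∑ t ∈ l.toFinset, midCount l.toFinset t = r) :
    ∃ T, IsIrreducible T ∧ T.card = l.length ∧ numRuns T = r :=
  ⟨l.toFinset, h.isIrreducible, List.toFinset_card_of_nodup h.2.1,
    h.isIrreducible.numRuns_eq.trans hr⟩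

theorem GoodList.exists_tiling_of_chainTip {l : List Tile} (h : GoodList l) {r : ℕ} {b : Point}
    (hr : ∑ t ∈ l.toFinset, midCount l.toFinset t = r)
    (hb : ChainTip l.toFinset 0 1 b ∨ ChainTip l.toFinset 1 0 b) (n : ℕ) :
    ∃ T, IsIrreducible T ∧ T.card = l.length + 2 * n ∧ numRuns T = r + n := by
  obtain ⟨T, h1, h2, h3⟩ := exists_longer h.isIrreducible hb n
  refine ⟨T, h1, ?_, ?_⟩
  · rw [h3, List.toFinset_card_of_nodup h.2.1]
  · rw [h2, h.isIrreducible.numRuns_eq, hr]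

/-- In this and the following lists the order matters: it makes the links to later and earlier
tiles, the contact of the first with the last tile and the hole-free build-up from the end checkable
by evaluation. -/
theorem exists_five_two : ∃ T, IsIrreducible T ∧ T.card = 5 ∧ numRuns T = 2 :=
  GoodList.exists_tiling (l := [⟨.D, (1, -1)⟩, ⟨.D, (0, 1)⟩, ⟨.D, (-1, 1)⟩, ⟨.D, (0, 0)⟩,
    ⟨.B, (-1, 0)⟩]) (by decide +kernel) (by decide +kernel)

theorem exists_seven_three : ∃ T, IsIrreducible T ∧ T.card = 7 ∧ numRuns T = 3 :=
  GoodList.exists_tiling (l := [⟨.F, (0, 1)⟩, ⟨.F, (1, 0)⟩, ⟨.B, (1, -1)⟩, ⟨.F, (0, 0)⟩,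
    ⟨.F, (-1, -1)⟩, ⟨.F, (-1, 0)⟩, ⟨.B, (-1, 1)⟩]) (by decide +kernel) (by decide +kernel)

theorem exists_six_three : ∃ T, IsIrreducible T ∧ T.card = 6 ∧ numRuns T = 3 :=
  GoodList.exists_tiling (l := [⟨.D, (-1, 1)⟩, ⟨.F, (-1, 1)⟩, ⟨.D, (1, 0)⟩, ⟨.B, (1, -1)⟩,
    ⟨.B, (0, 0)⟩, ⟨.B, (-1, 0)⟩]) (by decide +kernel) (by decide +kernel)

theorem exists_seven_four : ∃ T, IsIrreducible T ∧ T.card = 7 ∧ numRuns T = 4 :=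
  GoodList.exists_tiling (l := [⟨.B, (-1, 1)⟩, ⟨.D, (0, -1)⟩, ⟨.B, (0, 0)⟩, ⟨.F, (0, -1)⟩,
    ⟨.F, (1, -2)⟩, ⟨.F, (1, -1)⟩, ⟨.B, (1, 0)⟩]) (by decide +kernel) (by decide +kernel)

theorem exists_eight_five : ∃ T, IsIrreducible T ∧ T.card = 8 ∧ numRuns T = 5 :=
  GoodList.exists_tiling (l := [⟨.F, (1, 1)⟩, ⟨.F, (1, 0)⟩, ⟨.F, (1, -1)⟩, ⟨.F, (0, -1)⟩,
    ⟨.D, (0, -1)⟩, ⟨.F, (-1, 1)⟩, ⟨.B, (0, 0)⟩, ⟨.D, (1, 0)⟩])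
    (by decide +kernel) (by decide +kernel)

theorem exists_nine_six : ∃ T, IsIrreducible T ∧ T.card = 9 ∧ numRuns T = 6 :=
  GoodList.exists_tiling (l := [⟨.D, (0, -1)⟩, ⟨.F, (0, -1)⟩, ⟨.F, (0, 0)⟩, ⟨.F, (0, 1)⟩,
    ⟨.D, (0, 1)⟩, ⟨.D, (0, 0)⟩, ⟨.D, (-1, 2)⟩, ⟨.D, (-1, 1)⟩, ⟨.D, (-1, 0)⟩])
    (by decide +kernel) (by decide +kernel)

theorem exists_eight_four_add (n : ℕ) :
    ∃ T, IsIrreducible T ∧ T.card = 8 + 2 * n ∧ numRuns T = 4 + n :=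
  GoodList.exists_tiling_of_chainTip (l := [⟨.B, (1, -1)⟩, ⟨.D, (0, -1)⟩, ⟨.F, (-2, 1)⟩,
    ⟨.B, (0, 0)⟩, ⟨.F, (-1, 1)⟩, ⟨.F, (0, 2)⟩, ⟨.F, (0, 1)⟩, ⟨.B, (1, 0)⟩]) (b := (0, 2))
    (by decide +kernel) (by decide +kernel) (by decide +kernel) n

theorem exists_nine_five_add (n : ℕ) :
    ∃ T, IsIrreducible T ∧ T.card = 9 + 2 * n ∧ numRuns T = 5 + n :=
  GoodList.exists_tiling_of_chainTip (l := [⟨.F, (1, 2)⟩, ⟨.F, (1, 1)⟩, ⟨.F, (1, 0)⟩,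
    ⟨.F, (0, -1)⟩, ⟨.B, (-1, 0)⟩, ⟨.D, (0, 0)⟩, ⟨.F, (0, 0)⟩, ⟨.D, (0, 1)⟩, ⟨.F, (0, 1)⟩])
    (b := (1, 2)) (by decide +kernel) (by decide +kernel) (by decide +kernel) n

theorem exists_ten_six_add (n : ℕ) :
    ∃ T, IsIrreducible T ∧ T.card = 10 + 2 * n ∧ numRuns T = 6 + n :=
  GoodList.exists_tiling_of_chainTip (l := [⟨.B, (-2, 2)⟩, ⟨.F, (-2, 1)⟩, ⟨.F, (-2, 0)⟩,
    ⟨.D, (0, -1)⟩, ⟨.F, (0, -1)⟩, ⟨.D, (0, 0)⟩, ⟨.F, (0, 0)⟩, ⟨.F, (1, 1)⟩, ⟨.F, (0, 1)⟩,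
    ⟨.D, (0, 1)⟩]) (b := (1, 1)) (by decide +kernel) (by decide +kernel) (by decide +kernel) n

theorem exists_eleven_seven_add (n : ℕ) :
    ∃ T, IsIrreducible T ∧ T.card = 11 + 2 * n ∧ numRuns T = 7 + n :=
  GoodList.exists_tiling_of_chainTip (l := [⟨.B, (0, 1)⟩, ⟨.B, (-1, 1)⟩, ⟨.F, (-1, 0)⟩,
    ⟨.F, (-1, -1)⟩, ⟨.F, (0, -1)⟩, ⟨.F, (1, -1)⟩, ⟨.F, (0, 0)⟩, ⟨.F, (1, 0)⟩, ⟨.F, (2, 1)⟩,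
    ⟨.F, (1, 1)⟩, ⟨.D, (1, 1)⟩]) (b := (2, 1))
    (by decide +kernel) (by decide +kernel) (by decide +kernel) n

/-- The least case ρ = 3 + `k` has a tiling of its own. The staircase for `k` starts from a tiling
with 4 + `k` runs and keeps 2ρ − τ fixed. -/
theorem exists_of_le {k r : ℕ} (hk : k ≤ 3) (hr : 3 + k ≤ r) :
    ∃ T, IsIrreducible T ∧ numRuns T = r ∧ (T.card : ℤ) = 2 * (r : ℤ) - k := by
  have hbase : ∃ T, IsIrreducible T ∧ T.card = 6 + k ∧ numRuns T = 3 + k := by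
    interval_cases k
    · exact exists_six_three
    · exact exists_seven_four
    · exact exists_eight_five
    · exact exists_nine_six
  have hchain : ∀ n, ∃ T, IsIrreducible T ∧ T.card = 8 + k + 2 * n ∧ numRuns T = 4 + k + n := by
    interval_cases k
    · exact exists_eight_four_add
    · exact exists_nine_five_add
    · exact exists_ten_six_add
    · exact exists_eleven_seven_add
  rcases hr.eq_or_lt with rfl | hlt
  · obtain ⟨T, h1, h2, h3⟩ := hbase
    exact ⟨T, h1, h3, by omega⟩
  · obtain ⟨T, h1, h2, h3⟩ := hchain (r - (4 + k))
    exact ⟨T, h1, by omega, by omega⟩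

end Tredoku

theorem theorem2 :
    (∃ T : Finset Tredoku.Tile,
      Tredoku.IsIrreducible T ∧ T.card = 5 ∧ Tredoku.numRuns T = 2) ∧
    (∃ T : Finset Tredoku.Tile,
      Tredoku.IsIrreducible T ∧ T.card = 7 ∧ Tredoku.numRuns T = 3) ∧
    (∀ T : Finset Tredoku.Tile, Tredoku.IsIrreducible T →
      ¬ (T.card = 5 ∧ Tredoku.numRuns T = 2) →
      ¬ (T.card = 7 ∧ Tredoku.numRuns T = 3) →
      2 * (Tredoku.numRuns T : ℤ) - 3 ≤ (T.card : ℤ) ∧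
        (T.card : ℤ) ≤ 2 * (Tredoku.numRuns T : ℤ)) ∧
    (∀ k : ℕ, k ≤ 3 → ∀ r : ℕ, 3 + k ≤ r →
      ∃ T : Finset Tredoku.Tile, Tredoku.IsIrreducible T ∧
        Tredoku.numRuns T = r ∧ (T.card : ℤ) = 2 * (r : ℤ) - (k : ℤ)) :=
  ⟨Tredoku.exists_five_two, Tredoku.exists_seven_three, fun _ h h5 h7 => h.card_bounds h5 h7,
    fun _ hk _ hr => Tredoku.exists_of_le hk hr⟩
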